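/- Let $q:[0,1]\to\mathbb C$ be Lebesgue integrable with $\int_0^1 q(t)\,dt=0$, and let $\beta_1,\beta_2\in\mathbb C$ with $\beta_1\neq\pm1$ and $\beta_2\neq0$. Let $T_1^1(q)$ be the operator in $L_2[0,1]$ generated by $-y''+q(x)y$ and the boundary conditions $$y'(0)+\beta_1y'(1)+\beta_2y(1)=0,\qquad y(0)-y(1)=0;$$ its domain consists of the functions $y$ with $y'$ absolutely continuous on $[0,1]$ and $-y''+qy\in L_2[0,1]$ that satisfy the boundary conditions. The root subspace of an eigenvalue $\lambda$ is $\bigcup_k\ker(T_1^1(q)-\lambda)^k$, and $\lambda$ is called simple if its root subspace is one-dimensional. A system of the root functions of $T_1^1(q)$ is made up of a basis of each of its root subspaces. Put $$s_n=\int_0^1\sin(4\pi nt)\,q(t)\,dt ,\qquad n=1,2,\dots$$ (a) If $s_n=o(1/n)$ as $n\to\infty$ (in particular, if $\int_0^1\sin(2\pi nt)\,q(t)\,dt=o(1/n)$), then all eigenvalues of $T_1^1(q)$ except finitely many are simple, and the square roots (with nonnegative real part) of these eigenvalues form two sequences $\{\mu_{n,1}\}_{n\ge N}$ and $\{\mu_{n,2}\}_{n\ge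 N}$, which list them once each, such that $$\mu_{n,1}=2\pi n+o\left(\frac1n\right),\qquad \mu_{n,2}=2\pi n+\frac{\beta_2}{\beta_1-1}\,\frac1{\pi n}+o\left(\frac1n\right).$$ Moreover, eigenfunctions $\varphi_{n,1}$ and $\varphi_{n,2}$ for the eigenvalues $\mu_{n,1}^2$ and $\mu_{n,2}^2$, normalized in $L_2[0,1]$ (and with suitable constant factors of modulus one), both satisfy $$\varphi_{n,j}(x)=\sqrt2\cos2\pi nx+O\left(\frac1n\right),\qquad j=1,2,$$ uniformly for $x\in[0,1]$. (b) If there is a subsequence $n_1<n_2<\cdots$ such that $s_{n_k}=o(1/n_k)$ as $k\to\infty$, then no system of the root functions of $T_1^1(q)$ is a Riesz basis of $L_2[0,1]$. -/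

import Mathlib

open MeasureTheory Set Filter Asymptotics
open scoped Real

noncomputable section

/-- Lebesgue measure on `[0,1]`. -/
abbrev unitMeasure : Measure ℝ := volume.restrict (Icc (0 : ℝ) 1)

/-- The complex Hilbert space `L₂[0,1]`. -/
abbrev L2 : Type := Lp ℂ 2 unitMeasure

/-- `IsSLPair q β₁ β₂ y f`: on `[0,1]` the function `y` is differentiable with absolutely continuous
derivative `z = y'`, `-y'' + q y = f` almost everywhere, and `y` satisfies the boundary conditions
`y'(0) + β₁ y'(1) + β₂ y(1) = 0` and `y(0) - y(1) = 0`. -/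
def IsSLPair (q : ℝ → ℂ) (β₁ β₂ : ℂ) (y f : ℝ → ℂ) : Prop :=
  ∃ z : ℝ → ℂ,
    (∀ x ∈ Icc (0 : ℝ) 1, HasDerivWithinAt y (z x) (Icc 0 1) x) ∧
    AbsolutelyContinuousOnInterval z 0 1 ∧
    (∀ᵐ x ∂unitMeasure, HasDerivAt z (q x * y x - f x) x) ∧
    z 0 + β₁ * z 1 + β₂ * y 1 = 0 ∧
    y 0 - y 1 = 0

/-- The graph of the Sturm-Liouville operator in `L₂[0,1] × L₂[0,1]`: the pairs `(u, f)` such that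
`u` has a representative `y` with `-y'' + q y = f` that satisfies the boundary conditions. -/
def slGraph (q : ℝ → ℂ) (β₁ β₂ : ℂ) : Submodule ℂ (L2 × L2) where
  carrier := {p | ∃ y : ℝ → ℂ, p.1 =ᵐ[unitMeasure] y ∧ IsSLPair q β₁ β₂ y p.2}
  zero_mem' := by
    refine ⟨fun _ => 0, Lp.coeFn_zero _ _ _, fun _ => 0, fun x _ => hasDerivWithinAt_const _ _ _,
      ?_, ?_, by simp, by simp⟩
    · exact (LipschitzWith.const (0 : ℂ)).lipschitzOnWith.absolutelyContinuousOnInterval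
    · filter_upwards [Lp.coeFn_zero ℂ 2 unitMeasure] with x hx
      have h : ((0 : L2 × L2).2 : ℝ → ℂ) x = 0 := hx
      rw [h]
      simpa using hasDerivAt_const x (0 : ℂ)
  add_mem' := by
    rintro ⟨u, f⟩ ⟨v, g⟩ ⟨y, hy, z, hz, hac, hd, hb, hb'⟩ ⟨y₂, hy₂, z₂, hz₂, hac₂, hd₂, hb₂, hb₂'⟩
    refine ⟨y + y₂, (Lp.coeFn_add u v).trans (hy.add hy₂), z + z₂,
      fun x hx => (hz x hx).add (hz₂ x hx), hac.add hac₂, ?_, ?_, ?_⟩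
    · filter_upwards [hd, hd₂, Lp.coeFn_add f g] with x h h₂ hx
      have e : (((u, f) + (v, g) : L2 × L2).2 : ℝ → ℂ) x = f x + g x := hx
      rw [e]
      refine (h.add h₂).congr_deriv ?_
      simp only [Pi.add_apply]
      ring
    · simp only [Pi.add_apply]
      linear_combination hb + hb₂
    · simp only [Pi.add_apply]
      linear_combination hb' + hb₂'
  smul_mem' := by
    rintro c ⟨u, f⟩ ⟨y, hy, z, hz, hac, hd, hb, hb'⟩
    refine ⟨c • y, (Lp.coeFn_smul c u).trans (hy.const_smul c), c • z,
      fun x hx => (hz x hx).const_smul c, hac.const_smul c, ?_, ?_, ?_⟩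
    · filter_upwards [hd, Lp.coeFn_smul c f] with x h hx
      have e : ((c • (u, f) : L2 × L2).2 : ℝ → ℂ) x = c * f x := hx
      rw [e]
      refine (h.const_smul c).congr_deriv ?_
      simp only [Pi.smul_apply, smul_eq_mul]
      ring
    · simp only [Pi.smul_apply, smul_eq_mul]
      linear_combination c * hb
    · simp only [Pi.smul_apply, smul_eq_mul]
      linear_combination c * hb'

/-- The operator `T₁¹(q)` in `L₂[0,1]` generated by `-y'' + q y` and the boundary conditions
`y'(0) + β₁ y'(1) + β₂ y(1) = 0`, `y(0) - y(1) = 0`, as an unbounded linear operator. -/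
def slOperator (q : ℝ → ℂ) (β₁ β₂ : ℂ) : L2 →ₗ.[ℂ] L2 :=
  (slGraph q β₁ β₂).toLinearPMap

/-- `slGraph` is single valued, so it is the graph of `slOperator`. -/
theorem slOperator_graph (q : ℝ → ℂ) (β₁ β₂ : ℂ) :
    (slOperator q β₁ β₂).graph = slGraph q β₁ β₂ := by
  apply Submodule.toLinearPMap_graph_eq
  rintro ⟨u, f⟩ ⟨y, hy, z, hz, -, hd, -, -⟩ hu
  dsimp only at hu hy hd ⊢
  subst hu
  have hy0 : ∀ᵐ x ∂unitMeasure, y x = 0 := by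
    filter_upwards [hy, Lp.coeFn_zero ℂ 2 unitMeasure] with x h h0
    rw [← h, h0]; rfl
  have hyc : ContinuousOn y (Icc 0 1) := fun x hx => (hz x hx).continuousWithinAt
  have hyI : EqOn y (fun _ => 0) (Icc 0 1) :=
    Measure.eqOn_Icc_of_ae_eq volume (by norm_num) hy0 hyc continuousOn_const
  have hz0 : ∀ x ∈ Icc (0 : ℝ) 1, z x = 0 := fun x hx => by
    have h1 : HasDerivWithinAt y 0 (Icc 0 1) x :=
      (hasDerivWithinAt_const x (Icc 0 1) (0 : ℂ)).congr hyI (hyI hx)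
    exact (uniqueDiffOn_Icc (by norm_num : (0 : ℝ) < 1) x hx).eq_deriv _ (hz x hx) h1
  have hI : ∀ᵐ x ∂unitMeasure, x ∈ Ioo (0 : ℝ) 1 := by
    rw [unitMeasure, ← Measure.restrict_congr_set Ioo_ae_eq_Icc]
    exact ae_restrict_mem measurableSet_Ioo
  rw [Lp.eq_zero_iff_ae_eq_zero]
  filter_upwards [hd, hI] with x hx hxI
  have h1 : HasDerivAt z 0 x := by
    refine (hasDerivAt_const x (0 : ℂ)).congr_of_eventuallyEq ?_
    filter_upwards [Ioo_mem_nhds hxI.1 hxI.2] with t ht using hz0 t (Ioo_subset_Icc_self ht)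
  have h2 := hx.unique h1
  rw [hyI (Ioo_subset_Icc_self hxI)] at h2
  simpa using h2

section Spectral

variable {H : Type*} [NormedAddCommGroup H] [InnerProductSpace ℂ H]

/-- `ev` is an eigenvalue of the unbounded operator `T`. -/
def IsEigenvalue (T : H →ₗ.[ℂ] H) (ev : ℂ) : Prop :=
  ∃ u : T.domain, (u : H) ≠ 0 ∧ T u = ev • (u : H)

/-- The kernel of `(T - ev)^k`: `u` is in the kernel of `(T - ev)^(k+1)` if it is in the domain
of `T` and `T u - ev u` is in the kernel of `(T - ev)^k`. -/
def powKer (T : H →ₗ.[ℂ] H) (ev : ℂ) : ℕ → Submodule ℂ H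
  | 0 => ⊥
  | k + 1 => (T.graph ⊓ (powKer T ev k).comap
      (LinearMap.snd ℂ H H - ev • LinearMap.fst ℂ H H)).map (LinearMap.fst ℂ H H)

/-- The root subspace of `T` at `ev`: its nonzero elements are the root functions (eigenfunctions
and associated functions) for `ev`; its dimension is the algebraic multiplicity of `ev`. -/
def rootSubspace (T : H →ₗ.[ℂ] H) (ev : ℂ) : Submodule ℂ H := ⨆ k, powKer T ev k

/-- `ev` is a simple eigenvalue: an eigenvalue of algebraic multiplicity one. -/
def IsSimpleEigenvalue (T : H →ₗ.[ℂ] H) (ev : ℂ) : Prop :=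
  IsEigenvalue T ev ∧ Module.finrank ℂ (rootSubspace T ev) = 1

/-- `e` is a system of the root functions of `T`: it is made up of a basis of each of the root
subspaces of `T`; `ev i` is the eigenvalue to which `e i` belongs. -/
def IsRootSystem {ι : Type*} (T : H →ₗ.[ℂ] H) (e : ι → H) : Prop :=
  ∃ ev : ι → ℂ, ∀ w : ℂ,
    LinearIndependent ℂ (fun i : {i : ι // ev i = w} => e i) ∧
    Submodule.span ℂ (e '' {i | ev i = w}) = rootSubspace T w

/-- A Riesz basis: the image of an orthonormal basis under a bounded operator with a bounded
inverse. -/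
def IsRieszBasis {ι : Type*} (e : ι → H) : Prop :=
  ∃ (b : HilbertBasis ι ℂ H) (A : H ≃L[ℂ] H), ∀ i, e i = A (b i)

end Spectral

/-- `φ` is (the continuous representative on `[0,1]` of) an eigenfunction of `T` for the eigenvalue
`ev`, with norm one in `L₂[0,1]`. -/
def IsNormalizedEigenfunction (T : L2 →ₗ.[ℂ] L2) (ev : ℂ) (φ : ℝ → ℂ) : Prop :=
  ContinuousOn φ (Icc 0 1) ∧
    ∃ u : T.domain, (u : L2) =ᵐ[unitMeasure] φ ∧ ‖(u : L2)‖ = 1 ∧ T u = ev • (u : L2)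

/-- The sine integral `∫₀¹ sin (2 μ t) q(t) dt` at `μ = 2 π n`. -/
def sineCoeff (q : ℝ → ℂ) (n : ℕ) : ℂ :=
  ∫ t in (0 : ℝ)..1, (Real.sin (4 * π * n * t) : ℂ) * q t

end

/-!
The eigenvalues are the zeros of an entire function, the characteristic determinant
`Δ = 1 - c(1) + β₁ (s'(1) - 1) + β₂ s(1)`, where `c` and `s` are the solutions of
`-y'' + q y = ev y` with `c(0) = s'(0) = 1` and `c'(0) = s(0) = 0`. They are constructed by
inverting a Volterra operator on `C[0,1]`, which depends holomorphically on `ev`.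
A zero of `Δ` that is simple as a zero is a simple eigenvalue (`rootSubspace_eq_span`): an
associated function would exist only if the derivative of `Δ` vanished (`eq_smul_eigenSol_of_isSLPair`).

For `q = 0` and `β₂ = 0` the determinant is `(1 - β₁) (1 - cos √ev)`, with double zeros at
`(2 π n) ^ 2`, and the perturbation has to be computed to second order to see how they split. With
`ev = (2 π n) ^ 2 + τ`, two iterations of the variation of constants formula and the
Riemann-Lebesgue lemma give (`exists_charDet_expansion`)
`(2 π n) ^ 2 Δ = (1 - β₁) τ ^ 2 / 8 + β₂ τ / 2 + (1 + β₁) π n s_n + o(1)`,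
where `s_n` is the sine coefficient; all other second-order terms vanish in the limit because `q`
has mean zero. If `s_n = o(1/n)`, only a quadratic polynomial with the distinct simple roots `0` and
`4 β₂ / (β₁ - 1)` is left, and a contraction argument (`exists_simple_zero`) produces exactly one
simple zero near each root. Taking square roots gives the asymptotics of the eigenvalues, and both
eigenfunctions are within `O(1/n)` of `√2 cos (2 π n x)`, since `c` is close to the cosine, `s` is
`O(1/n)`, and the coefficient of `s` is bounded when `β₁ ≠ -1` (`exists_eigenvalue_pairs`).

That no other large eigenvalues exist takes two steps: an elementary estimate of `1 - cos` in the
complex plane places every large zero at a distance at most `η n` from some `(2 π n) ^ 2`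
(`exists_freq_near_of_charDet_eq_zero`), and in this range the error term of the expansion is still
dominated by the quadratic term, which forces `τ` to be bounded
(`exists_bound_of_localDet_eq_zero`).

All of this holds along any filter of indices on which `s_n = o(1/n)`, except for the localization
of all eigenvalues, which uses the whole sequence. Along a subsequence, the root system
contains the two normalized eigenfunctions for `n`, up to scalars, and their distance tends to zero;
but distinct normalized elements of a Riesz basis have a distance bounded below
(`not_isRieszBasis_of_isRootSystem`).
-/

open scoped Topology

/-! ### Primitives of integrable functions -/

/-- `IsPrimitive u w`: on `[0,1]` the function `u` is an indefinite integral of the integrable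
function `w`; equivalently `u` is absolutely continuous there with `u' = w` almost everywhere. -/
def IsPrimitive (u w : ℝ → ℂ) : Prop :=
  IntervalIntegrable w volume 0 1 ∧ ∀ x ∈ Icc (0 : ℝ) 1, u x = u 0 + ∫ t in (0 : ℝ)..x, w t

theorem intervalIntegrable_zero_of_mem {w : ℝ → ℂ} (hw : IntervalIntegrable w volume 0 1) {x : ℝ}
    (hx : x ∈ Icc (0 : ℝ) 1) : IntervalIntegrable w volume 0 x := by
  refine hw.mono_set ?_
  rw [uIcc_of_le hx.1, uIcc_of_le zero_le_one]
  exact Icc_subset_Icc_right hx.2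

theorem ae_unitMeasure_iff {P : ℝ → Prop} :
    (∀ᵐ x ∂unitMeasure, P x) ↔ ∀ᵐ x, x ∈ Icc (0 : ℝ) 1 → P x :=
  ae_restrict_iff' measurableSet_Icc

theorem ae_unitMeasure_mem_Ioo : ∀ᵐ x ∂unitMeasure, x ∈ Ioo (0 : ℝ) 1 := by
  rw [unitMeasure, ← Measure.restrict_congr_set Ioo_ae_eq_Icc]
  exact ae_restrict_mem measurableSet_Ioo

theorem intervalIntegrable_iff_unitMeasure {E : Type*} [NormedAddCommGroup E] {w : ℝ → E} :
    IntervalIntegrable w volume 0 1 ↔ Integrable w unitMeasure := by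
  rw [intervalIntegrable_iff_integrableOn_Icc_of_le zero_le_one]; rfl

theorem integral_congr_ae_unitMeasure {u w : ℝ → ℂ} (h : u =ᵐ[unitMeasure] w) {x : ℝ}
    (hx : x ∈ Icc (0 : ℝ) 1) : ∫ t in (0 : ℝ)..x, u t = ∫ t in (0 : ℝ)..x, w t := by
  refine intervalIntegral.integral_congr_ae ?_
  filter_upwards [ae_unitMeasure_iff.1 h] with t ht hm
  rw [uIoc_of_le hx.1] at hm
  exact ht ⟨hm.1.le, hm.2.trans hx.2⟩

namespace IsPrimitive

variable {u v w z : ℝ → ℂ}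

theorem continuousOn (h : IsPrimitive u w) : ContinuousOn u (Icc 0 1) := by
  have h1 : ContinuousOn (fun x => u 0 + ∫ t in (0 : ℝ)..x, w t) (Icc 0 1) := by
    have := intervalIntegral.continuousOn_primitive_interval' h.1 (a := 0) (by simp)
    rw [uIcc_of_le zero_le_one] at this
    exact continuousOn_const.add this
  exact h1.congr h.2

/-- A complex primitive inherits absolute continuity from the primitive of the norm of its
density. -/
theorem absolutelyContinuousOnInterval (h : IsPrimitive u w) :
    AbsolutelyContinuousOnInterval u 0 1 := by
  have hn := h.1.norm.absolutelyContinuousOnInterval_intervalIntegral (c := 0) (by simp)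
  rw [absolutelyContinuousOnInterval_iff] at hn ⊢
  intro ε hε
  obtain ⟨δ, hδ, H⟩ := hn ε hε
  refine ⟨δ, hδ, fun E hE hs => lt_of_le_of_lt (Finset.sum_le_sum fun i hi => ?_) (H E hE hs)⟩
  obtain ⟨h1, h2⟩ := hE.1 i hi
  rw [uIcc_of_le zero_le_one] at h1 h2
  rw [h.2 _ h1, h.2 _ h2, dist_add_left, dist_eq_norm, dist_eq_norm,
    intervalIntegral.integral_interval_sub_left (intervalIntegrable_zero_of_mem h.1 h1)
      (intervalIntegrable_zero_of_mem h.1 h2),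
    intervalIntegral.integral_interval_sub_left (intervalIntegrable_zero_of_mem h.1 h1).norm
      (intervalIntegrable_zero_of_mem h.1 h2).norm, Real.norm_eq_abs]
  exact intervalIntegral.norm_integral_le_abs_integral_norm

theorem ae_hasDerivAt (h : IsPrimitive u w) : ∀ᵐ x ∂unitMeasure, HasDerivAt u (w x) x := by
  filter_upwards [ae_unitMeasure_iff.2 (by
    simpa only [uIcc_of_le (zero_le_one' ℝ)] using h.1.ae_hasDerivAt_integral),
    ae_unitMeasure_mem_Ioo] with x hx hI
  have h1 := (hx 0 (by simp)).const_add (u 0)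
  refine h1.congr_of_eventuallyEq ?_
  filter_upwards [Ioo_mem_nhds hI.1 hI.2] with t ht using h.2 t (Ioo_subset_Icc_self ht)

theorem of_absolutelyContinuous (hu : AbsolutelyContinuousOnInterval u 0 1)
    (hw : IntervalIntegrable w volume 0 1) (hd : ∀ᵐ x ∂unitMeasure, HasDerivAt u (w x) x) :
    IsPrimitive u w := by
  refine ⟨hw, ?_⟩
  have hp : IsPrimitive (fun x => ∫ t in (0 : ℝ)..x, w t) w := ⟨hw, by simp⟩
  obtain ⟨C, hC⟩ := (hu.sub hp.absolutelyContinuousOnInterval).const_of_ae_hasDerivAt_zero (by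
    rw [uIcc_of_le zero_le_one, ← ae_unitMeasure_iff]
    filter_upwards [hd, hp.ae_hasDerivAt] with x h1 h2
    simpa using h1.sub h2)
  rw [uIcc_of_le zero_le_one] at hC
  intro x hx
  have h1 := hC x hx
  have h0 := hC 0 (by simp)
  simp only [Pi.sub_apply, intervalIntegral.integral_same] at h1 h0
  linear_combination h1 - h0

theorem of_hasDerivAt (hd : ∀ x, HasDerivAt u (w x) x) (hw : Continuous w) : IsPrimitive u w := by
  refine ⟨hw.intervalIntegrable _ _, fun x _ => ?_⟩
  rw [intervalIntegral.integral_eq_sub_of_hasDerivAt (fun t _ => hd t) (hw.intervalIntegrable _ _)]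
  ring

theorem congr_ae (h : IsPrimitive u w) (hv : v =ᵐ[unitMeasure] w) : IsPrimitive u v :=
  ⟨intervalIntegrable_iff_unitMeasure.2 ((intervalIntegrable_iff_unitMeasure.1 h.1).congr hv.symm),
    fun x hx => by rw [h.2 x hx, integral_congr_ae_unitMeasure hv hx]⟩

theorem mul_continuousOn (hw : IntervalIntegrable w volume 0 1) (hu : ContinuousOn u (Icc 0 1)) :
    IntervalIntegrable (fun t => w t * u t) volume 0 1 :=
  hw.mul_continuousOn (by rwa [uIcc_of_le zero_le_one])

/-- The product rule, in integrated form. -/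
theorem mul (hu : IsPrimitive u w) (hv : IsPrimitive v z) :
    IsPrimitive (fun x => u x * v x) (fun x => w x * v x + u x * z x) := by
  refine of_absolutelyContinuous (hu.absolutelyContinuousOnInterval.smul
    hv.absolutelyContinuousOnInterval) ?_ ?_
  · refine (mul_continuousOn hu.1 hv.continuousOn).add ?_
    simpa only [mul_comm] using mul_continuousOn hv.1 hu.continuousOn
  · filter_upwards [hu.ae_hasDerivAt, hv.ae_hasDerivAt] with x h1 h2 using h1.mul h2

theorem add (hu : IsPrimitive u w) (hv : IsPrimitive v z) :
    IsPrimitive (fun x => u x + v x) (fun x => w x + z x) := by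
  refine ⟨hu.1.add hv.1, fun x hx => ?_⟩
  rw [intervalIntegral.integral_add (intervalIntegrable_zero_of_mem hu.1 hx)
    (intervalIntegrable_zero_of_mem hv.1 hx)]
  linear_combination hu.2 x hx + hv.2 x hx

theorem const_mul (c : ℂ) (hu : IsPrimitive u w) :
    IsPrimitive (fun x => c * u x) (fun x => c * w x) := by
  refine ⟨hu.1.const_mul c, fun x hx => ?_⟩
  rw [intervalIntegral.integral_const_mul]
  linear_combination c * hu.2 x hx

/-- A primitive of a function continuous on `[0,1]` is differentiable there. -/
theorem hasDerivWithinAt (h : IsPrimitive u w) (hw : ContinuousOn w (Icc 0 1)) {x : ℝ}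
    (hx : x ∈ Icc (0 : ℝ) 1) : HasDerivWithinAt u (w x) (Icc 0 1) x := by
  set W : ℝ → ℂ := IccExtend (zero_le_one' ℝ) ((Icc (0:ℝ) 1).domRestrict w)
  have hWc : Continuous W := (continuousOn_iff_continuous_domRestrict.1 hw).Icc_extend'
  have hW : ∀ t ∈ Icc (0 : ℝ) 1, W t = w t := fun t ht => by
    simp [W, IccExtend_of_mem _ _ ht, domRestrict]
  have h1 : HasDerivAt (fun x => u 0 + ∫ t in (0 : ℝ)..x, W t) (W x) x :=
    (intervalIntegral.integral_hasDerivAt_right (hWc.intervalIntegrable _ _)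
      (hWc.stronglyMeasurableAtFilter _ _) hWc.continuousAt).const_add _
  rw [← hW x hx]
  have key : ∀ y ∈ Icc (0 : ℝ) 1, u y = u 0 + ∫ t in (0 : ℝ)..y, W t := fun y hy => by
    rw [h.2 y hy]
    congr 1
    refine intervalIntegral.integral_congr fun t ht => ?_
    rw [uIcc_of_le hy.1] at ht
    exact (hW t ⟨ht.1, ht.2.trans hy.2⟩).symm
  exact h1.hasDerivWithinAt.congr key (key x hx)

end IsPrimitive

theorem IsPrimitive.of_hasDerivWithinAt {u w : ℝ → ℂ}
    (h : ∀ x ∈ Icc (0 : ℝ) 1, HasDerivWithinAt u (w x) (Icc 0 1) x)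
    (hw : ContinuousOn w (Icc 0 1)) : IsPrimitive u w := by
  have hwi : IntervalIntegrable w volume 0 1 :=
    ContinuousOn.intervalIntegrable (by rwa [uIcc_of_le zero_le_one])
  refine ⟨hwi, fun x hx => ?_⟩
  rw [intervalIntegral.integral_eq_sub_of_hasDeriv_right_of_le hx.1
    (f := u) (fun t ht => ?_) (fun t ht => ?_) (intervalIntegrable_zero_of_mem hwi hx)]
  · ring
  · exact (h t ⟨ht.1, ht.2.trans hx.2⟩).continuousWithinAt.mono (Icc_subset_Icc_right hx.2)
  · have ht1 : t < 1 := ht.2.trans_le hx.2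
    exact ((h t ⟨ht.1.le, ht1.le⟩).hasDerivAt (Icc_mem_nhds ht.1 ht1)).hasDerivWithinAt

/-- `IsSLPair` in integrated form: `y` is a primitive of `z`, and `z` is a primitive of
`q y - f`. -/
theorem isSLPair_iff_isPrimitive {q y f : ℝ → ℂ} {β₁ β₂ : ℂ}
    (hq : IntervalIntegrable q volume 0 1) (hf : IntervalIntegrable f volume 0 1) :
    IsSLPair q β₁ β₂ y f ↔ ∃ z : ℝ → ℂ, IsPrimitive y z ∧ IsPrimitive z (fun x => q x * y x - f x) ∧
      z 0 + β₁ * z 1 + β₂ * y 1 = 0 ∧ y 0 - y 1 = 0 := by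
  constructor
  · rintro ⟨z, hz, hac, hd, hb, hb'⟩
    have hzc : ContinuousOn z (Icc 0 1) := by
      simpa only [uIcc_of_le (zero_le_one' ℝ)] using hac.continuousOn
    have hyp := IsPrimitive.of_hasDerivWithinAt hz hzc
    exact ⟨z, hyp, IsPrimitive.of_absolutelyContinuous hac
      ((IsPrimitive.mul_continuousOn hq hyp.continuousOn).sub hf) hd, hb, hb'⟩
  · rintro ⟨z, hy, hz, hb, hb'⟩
    exact ⟨z, fun x hx => hy.hasDerivWithinAt hz.continuousOn hx,
      hz.absolutelyContinuousOnInterval, hz.ae_hasDerivAt, hb, hb'⟩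

/-! ### Solutions of the differential equation -/

/-- `IsSolution p y z`: on `[0,1]` the function `y` solves `y'' = p y`, and `z = y'`. -/
def IsSolution (p y z : ℝ → ℂ) : Prop :=
  IsPrimitive y z ∧ IsPrimitive z (fun t => p t * y t)

/-- Variation of constants: a solution of `y'' = (p - m ^ 2) y` in terms of the free solutions
`cos (m x)` and `sin (m x)`. -/
theorem IsSolution.variation_of_constants {p P y z : ℝ → ℂ} {m : ℂ} (h : IsSolution P y z)
    (hP : ∀ t, P t = p t - m ^ 2) {x : ℝ} (hx : x ∈ Icc (0 : ℝ) 1) :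
    m * y x = m * y 0 * Complex.cos (m * x) + z 0 * Complex.sin (m * x) +
        ∫ t in (0 : ℝ)..x, Complex.sin (m * (x - t)) * (p t * y t) ∧
    z x = - m * y 0 * Complex.sin (m * x) + z 0 * Complex.cos (m * x) +
        ∫ t in (0 : ℝ)..x, Complex.cos (m * (x - t)) * (p t * y t) := by
  obtain ⟨hy, hz⟩ := h
  have hin : ∀ t : ℝ, HasDerivAt (fun t : ℝ => m * ((x : ℂ) - t)) (-m) t := fun t => by
    have := ((Complex.ofRealCLM.hasDerivAt (x := t)).const_sub (x : ℂ)).const_mul m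
    simpa using this
  have hs : IsPrimitive (fun t : ℝ => Complex.sin (m * (x - t)))
      (fun t : ℝ => Complex.cos (m * (x - t)) * -m) :=
    .of_hasDerivAt (fun t => (Complex.hasDerivAt_sin _).comp t (hin t)) (by fun_prop)
  have hc : IsPrimitive (fun t : ℝ => Complex.cos (m * (x - t)))
      (fun t : ℝ => -Complex.sin (m * (x - t)) * -m) :=
    .of_hasDerivAt (fun t => (Complex.hasDerivAt_cos _).comp t (hin t)) (by fun_prop)
  have h1 := ((hs.mul hz).add ((hc.mul hy).const_mul m)).2 x hx
  have h2 := ((hc.mul hz).add ((hs.mul hy).const_mul (-m))).2 x hx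
  have e1 : ∀ t : ℝ, Complex.cos (m * (x - t)) * -m * z t + Complex.sin (m * (x - t)) * (P t * y t)
      + m * (-Complex.sin (m * (x - t)) * -m * y t + Complex.cos (m * (x - t)) * z t) =
      Complex.sin (m * (x - t)) * (p t * y t) := fun t => by rw [hP]; ring
  have e2 : ∀ t : ℝ, -Complex.sin (m * (x - t)) * -m * z t + Complex.cos (m * (x - t)) * (P t * y t)
      + -m * (Complex.cos (m * (x - t)) * -m * y t + Complex.sin (m * (x - t)) * z t) =
      Complex.cos (m * (x - t)) * (p t * y t) := fun t => by rw [hP]; ring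
  simp only [e1, e2] at h1 h2
  simp only [sub_self, mul_zero, Complex.sin_zero, Complex.cos_zero, Complex.ofReal_zero,
    sub_zero] at h1 h2
  constructor
  · linear_combination h1
  · linear_combination h2

/-- The Wronskian of two solutions is constant. -/
theorem IsSolution.wronskian {p y z y₂ z₂ : ℝ → ℂ} (h : IsSolution p y z)
    (h₂ : IsSolution p y₂ z₂) {x : ℝ} (hx : x ∈ Icc (0 : ℝ) 1) :
    y x * z₂ x - z x * y₂ x = y 0 * z₂ 0 - z 0 * y₂ 0 := by
  have h1 := ((h.1.mul h₂.2).add ((h.2.mul h₂.1).const_mul (-1))).2 x hx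
  have e : ∀ t, z t * z₂ t + y t * (p t * y₂ t) + -1 * (p t * y t * y₂ t + z t * z₂ t) = 0 :=
    fun t => by ring
  simp only [e, intervalIntegral.integral_zero] at h1
  linear_combination h1

/-! ### Volterra operators on `C[0,1]` -/

/-- The Banach space `C[0,1]`. -/
abbrev C01 : Type := C(Icc (0 : ℝ) 1, ℂ)

/-- The extension of `f ∈ C[0,1]` to the line that is constant outside `[0,1]`. -/
noncomputable def C01.extend (f : C01) : ℝ → ℂ := IccExtend (zero_le_one' ℝ) f

namespace C01

theorem continuous_extend (f : C01) : Continuous f.extend := f.continuous.Icc_extend'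

theorem extend_of_mem (f : C01) {x : ℝ} (hx : x ∈ Icc (0 : ℝ) 1) : f.extend x = f ⟨x, hx⟩ :=
  IccExtend_of_mem _ _ hx

theorem extend_coe (f : C01) (x : Icc (0 : ℝ) 1) : f.extend x = f x :=
  IccExtend_val _ _ x

theorem norm_extend_le (f : C01) (x : ℝ) : ‖f.extend x‖ ≤ ‖f‖ := f.norm_coe_le_norm _

theorem extend_add (f g : C01) (x : ℝ) : (f + g).extend x = f.extend x + g.extend x := rfl

theorem extend_sub (f g : C01) (x : ℝ) : (f - g).extend x = f.extend x - g.extend x := rfl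

theorem extend_smul (c : ℂ) (f : C01) (x : ℝ) : (c • f).extend x = c * f.extend x := rfl

theorem extend_one (x : ℝ) : (1 : C01).extend x = 1 := rfl

/-- The element of `C[0,1]` given by a function continuous on `[0,1]`. -/
noncomputable def ofContinuousOn (u : ℝ → ℂ) (hu : ContinuousOn u (Icc 0 1)) : C01 :=
  ⟨(Icc (0 : ℝ) 1).domRestrict u, continuousOn_iff_continuous_domRestrict.1 hu⟩

theorem extend_ofContinuousOn {u : ℝ → ℂ} (hu : ContinuousOn u (Icc 0 1)) {x : ℝ}
    (hx : x ∈ Icc (0 : ℝ) 1) : (ofContinuousOn u hu).extend x = u x := by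
  rw [extend_of_mem _ hx]; rfl

theorem ext_extend {f g : C01} (h : ∀ x ∈ Icc (0 : ℝ) 1, f.extend x = g.extend x) : f = g := by
  ext x
  rw [← extend_coe, ← extend_coe, h x x.2]

end C01

theorem intervalIntegrable_mul_extend {p : ℝ → ℂ} (hp : IntervalIntegrable p volume 0 1) (f : C01)
    {x : ℝ} (hx : x ∈ Icc (0 : ℝ) 1) :
    IntervalIntegrable (fun t => p t * f.extend t) volume 0 x :=
  intervalIntegrable_zero_of_mem (hp.mul_continuousOn f.continuous_extend.continuousOn) hx

theorem continuousOn_integral_mul_extend {p : ℝ → ℂ} (hp : IntervalIntegrable p volume 0 1)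
    (f : C01) : ContinuousOn (fun x => ∫ t in (0 : ℝ)..x, p t * f.extend t) (Icc 0 1) := by
  have := intervalIntegral.continuousOn_primitive_interval'
    (intervalIntegrable_mul_extend hp f (right_mem_Icc.2 zero_le_one)) (a := 0) (by simp)
  rwa [uIcc_of_le zero_le_one] at this

theorem norm_integral_mul_le {p u : ℝ → ℂ} (hp : IntervalIntegrable p volume 0 1) {x C : ℝ}
    (hx : x ∈ Icc (0 : ℝ) 1) (hu : ∀ t ∈ Icc (0 : ℝ) x, ‖u t‖ ≤ C) (hC : 0 ≤ C) :
    ‖∫ t in (0 : ℝ)..x, p t * u t‖ ≤ (∫ t in (0 : ℝ)..1, ‖p t‖) * C := by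
  have h1 : ‖∫ t in (0 : ℝ)..x, p t * u t‖ ≤ ∫ t in (0 : ℝ)..x, ‖p t‖ * C := by
    refine intervalIntegral.norm_integral_le_of_norm_le hx.1 (ae_of_all _ fun t ht => ?_)
      ((intervalIntegrable_zero_of_mem hp hx).norm.mul_const C)
    rw [norm_mul]
    exact mul_le_mul_of_nonneg_left (hu t ⟨ht.1.le, ht.2⟩) (norm_nonneg _)
  rw [intervalIntegral.integral_mul_const] at h1
  refine h1.trans (mul_le_mul_of_nonneg_right ?_ hC)
  exact intervalIntegral.integral_mono_interval le_rfl hx.1 hx.2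
    (ae_of_all _ fun t => norm_nonneg _) hp.norm

theorem integral_norm_nonneg (p : ℝ → ℂ) : 0 ≤ ∫ t in (0 : ℝ)..1, ‖p t‖ :=
  intervalIntegral.integral_nonneg zero_le_one fun _ _ => norm_nonneg _

/-- The Volterra operator `f ↦ ∫₀ˣ p f` on `C[0,1]`. -/
noncomputable def volterra (p : ℝ → ℂ) (hp : IntervalIntegrable p volume 0 1) : C01 →L[ℂ] C01 :=
  LinearMap.mkContinuous
    { toFun := fun f => C01.ofContinuousOn (fun x => ∫ t in (0 : ℝ)..x, p t * f.extend t)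
        (continuousOn_integral_mul_extend hp f)
      map_add' := fun f g => by
        refine C01.ext_extend fun x hx => ?_
        rw [C01.extend_add]
        simp only [C01.extend_ofContinuousOn _ hx]
        rw [← intervalIntegral.integral_add (intervalIntegrable_mul_extend hp f hx)
          (intervalIntegrable_mul_extend hp g hx)]
        simp only [C01.extend_add, mul_add]
      map_smul' := fun c f => by
        refine C01.ext_extend fun x hx => ?_
        rw [RingHom.id_apply, C01.extend_smul]
        simp only [C01.extend_ofContinuousOn _ hx]
        rw [← intervalIntegral.integral_const_mul]
        simp only [C01.extend_smul, mul_left_comm] }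
    (∫ t in (0 : ℝ)..1, ‖p t‖) (fun f => by
      rw [ContinuousMap.norm_le _ (mul_nonneg (integral_norm_nonneg p) (norm_nonneg f))]
      rintro ⟨x, hx⟩
      exact norm_integral_mul_le hp hx (fun t _ => f.norm_extend_le t) (norm_nonneg _))

theorem extend_volterra {p : ℝ → ℂ} (hp : IntervalIntegrable p volume 0 1) (f : C01) {x : ℝ}
    (hx : x ∈ Icc (0 : ℝ) 1) :
    (volterra p hp f).extend x = ∫ t in (0 : ℝ)..x, p t * f.extend t :=
  C01.extend_ofContinuousOn (continuousOn_integral_mul_extend hp f) hx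

/-- Integration `f ↦ ∫₀ˣ f` on `C[0,1]`. -/
noncomputable def integration : C01 →L[ℂ] C01 := volterra (fun _ => 1) (by simp)

theorem extend_integration (f : C01) {x : ℝ} (hx : x ∈ Icc (0 : ℝ) 1) :
    (integration f).extend x = ∫ t in (0 : ℝ)..x, f.extend t := by
  rw [integration, extend_volterra _ _ hx]
  simp only [one_mul]

theorem volterra_sub_const {q : ℝ → ℂ} (hq : IntervalIntegrable q volume 0 1) (ev : ℂ) :
    volterra (fun t => q t - ev) (hq.sub (by simp)) = volterra q hq - ev • integration := by
  ext1 f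
  refine C01.ext_extend fun x hx => ?_
  change _ = (volterra q hq f - ev • integration f).extend x
  rw [C01.extend_sub, C01.extend_smul, extend_volterra _ _ hx, extend_volterra _ _ hx,
    extend_integration _ hx, ← intervalIntegral.integral_const_mul, ← intervalIntegral.integral_sub
      (intervalIntegrable_mul_extend hq f hx)
      ((f.continuous_extend.intervalIntegrable _ _).const_mul _)]
  simp only [sub_mul]

/-- The factor `integration` gains one power of `x`, which makes the iterates of
`integration * volterra p` decay factorially. -/
theorem norm_integration_volterra_le {p : ℝ → ℂ} (hp : IntervalIntegrable p volume 0 1) (f : C01)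
    {C : ℝ} (hC : 0 ≤ C) (m : ℕ) (hf : ∀ x ∈ Icc (0 : ℝ) 1, ‖f.extend x‖ ≤ C * x ^ m) {x : ℝ}
    (hx : x ∈ Icc (0 : ℝ) 1) :
    ‖(integration (volterra p hp f)).extend x‖ ≤
      (∫ t in (0 : ℝ)..1, ‖p t‖) * C / (m + 1) * x ^ (m + 1) := by
  set P := ∫ t in (0 : ℝ)..1, ‖p t‖
  rw [extend_integration _ hx]
  have h1 : ‖∫ t in (0 : ℝ)..x, (volterra p hp f).extend t‖ ≤ ∫ t in (0 : ℝ)..x, P * C * t ^ m := by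
    refine intervalIntegral.norm_integral_le_of_norm_le hx.1 (ae_of_all _ fun t ht => ?_)
      (Continuous.intervalIntegrable (by fun_prop) _ _)
    have ht' : t ∈ Icc (0 : ℝ) 1 := ⟨ht.1.le, ht.2.trans hx.2⟩
    rw [extend_volterra _ _ ht', mul_assoc]
    refine norm_integral_mul_le hp ht' (fun s hs => ?_) (by have := ht'.1; positivity)
    refine (hf s ⟨hs.1, hs.2.trans ht'.2⟩).trans (mul_le_mul_of_nonneg_left ?_ hC)
    exact pow_le_pow_left₀ hs.1 hs.2 m
  refine h1.trans_eq ?_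
  rw [intervalIntegral.integral_const_mul, integral_pow]
  simp
  ring

theorem norm_pow_integration_volterra_le {p : ℝ → ℂ} (hp : IntervalIntegrable p volume 0 1)
    (m : ℕ) (f : C01) {x : ℝ} (hx : x ∈ Icc (0 : ℝ) 1) :
    ‖(((integration * volterra p hp) ^ m) f).extend x‖ ≤
      (∫ t in (0 : ℝ)..1, ‖p t‖) ^ m / m.factorial * ‖f‖ * x ^ m := by
  induction m generalizing x with
  | zero => simpa using f.norm_extend_le x
  | succ m ih =>
    rw [pow_succ']
    refine (norm_integration_volterra_le hp (((integration * volterra p hp) ^ m) f)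
      (C := (∫ t in (0 : ℝ)..1, ‖p t‖) ^ m / m.factorial * ‖f‖)
      (by have := integral_norm_nonneg p; positivity) m (fun x hx => ih hx) hx).trans_eq ?_
    rw [Nat.factorial_succ]
    push_cast
    field_simp
    ring

/-- Some power of the Volterra operator has norm less than one, and a geometric sum recovers the
inverse of `1 - K` from that of `1 - K ^ m`. -/
theorem isUnit_one_sub_integration_volterra {p : ℝ → ℂ} (hp : IntervalIntegrable p volume 0 1) :
    IsUnit (1 - integration * volterra p hp) := by
  set K := integration * volterra p hp
  set P := ∫ t in (0 : ℝ)..1, ‖p t‖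
  have hP : 0 ≤ P := integral_norm_nonneg p
  obtain ⟨m, hm⟩ := ((FloorSemiring.tendsto_pow_div_factorial_atTop P).eventually
    (gt_mem_nhds one_pos)).exists
  have hn : ‖K ^ m‖ < 1 := by
    refine lt_of_le_of_lt (ContinuousLinearMap.opNorm_le_bound _ (by positivity) fun f => ?_) hm
    rw [ContinuousMap.norm_le _ (by positivity)]
    intro x
    rw [← C01.extend_coe]
    refine (norm_pow_integration_volterra_le hp m f x.2).trans ?_
    exact mul_le_of_le_one_right (by positivity) (pow_le_one₀ x.2.1 x.2.2)
  have h1 : IsUnit (1 - K ^ m) := isUnit_one_sub_of_norm_lt_one (R := C01 →L[ℂ] C01) hn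
  rw [← mul_neg_geom_sum K m] at h1
  refine ((Commute.isUnit_mul_iff ?_).1 h1).1
  rw [Commute, SemiconjBy, mul_neg_geom_sum, geom_sum_mul_neg]

theorem hasDerivAt_inverse_one_sub_mul {E : Type*} [NormedAddCommGroup E] [NormedSpace ℂ E]
    [CompleteSpace E] (J N : E →L[ℂ] E) (ev : ℂ) (hu : IsUnit (1 - J * (N - ev • J))) (g : E) :
    HasDerivAt (fun w : ℂ => Ring.inverse (1 - J * (N - w • J)) g)
      (-Ring.inverse (1 - J * (N - ev • J))
        (J (J (Ring.inverse (1 - J * (N - ev • J)) g)))) ev := by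
  obtain ⟨U, hU⟩ := hu
  have h1 : HasDerivAt (fun w : ℂ => 1 - J * (N - w • J)) (J * J) ev := by
    have h := (((hasDerivAt_id ev).smul_const J).const_sub N).const_mul J |>.const_sub 1
    refine h.congr_deriv ?_
    simp
  have h2 := hasFDerivAt_ringInverse (𝕜 := ℂ) U
  rw [hU] at h2
  have h3 := h2.comp_hasDerivAt ev h1
  have h4 := ((ContinuousLinearMap.apply ℂ E g).hasFDerivAt.comp_hasDerivAt ev h3)
  refine h4.congr_deriv ?_
  rw [← hU, Ring.inverse_unit]
  rfl

/-! ### The initial value problem -/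

section InitialValue

variable {q : ℝ → ℂ} (hq : IntervalIntegrable q volume 0 1)

/-- The inverse of `1 - J (N - ev J)`, where `J` is integration and `N f = ∫₀ˣ q f`: it turns the
free solution into the solution of `y'' = (q - ev) y` with the same initial data. -/
noncomputable def slResolvent (ev : ℂ) : C01 →L[ℂ] C01 :=
  Ring.inverse (1 - integration * (volterra q hq - ev • integration))

theorem isUnit_resolvent_denominator (ev : ℂ) :
    IsUnit (1 - integration * (volterra q hq - ev • integration)) := by
  rw [← volterra_sub_const hq]
  exact isUnit_one_sub_integration_volterra _

theorem eq_resolvent_iff (ev : ℂ) (y g : C01) :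
    y = slResolvent hq ev g ↔ y = g + integration (volterra q hq y - ev • integration y) := by
  obtain ⟨U, hU⟩ := isUnit_resolvent_denominator hq ev
  have h1 : (U : C01 →L[ℂ] C01) y = y - integration (volterra q hq y - ev • integration y) := by
    rw [hU]; rfl
  rw [slResolvent, ← hU, Ring.inverse_unit]
  have e1 : (↑U⁻¹ : C01 →L[ℂ] C01) ((U : C01 →L[ℂ] C01) y) = y := by
    change ((↑U⁻¹ * ↑U : C01 →L[ℂ] C01)) y = y
    rw [Units.inv_mul]; rfl
  have e2 : (U : C01 →L[ℂ] C01) ((↑U⁻¹ : C01 →L[ℂ] C01) g) = g := by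
    change ((↑U * ↑U⁻¹ : C01 →L[ℂ] C01)) g = g
    rw [Units.mul_inv]; rfl
  rw [← sub_eq_iff_eq_add, ← h1]
  exact ⟨fun h => by rw [h, e2], fun h => by rw [← h, e1]⟩

/-- The resolvent identity in differential form: the denominator depends affinely on `ev`. -/
theorem hasDerivAt_resolvent (ev : ℂ) (g : C01) :
    HasDerivAt (fun w => slResolvent hq w g)
      (-slResolvent hq ev (integration (integration (slResolvent hq ev g)))) ev :=
  hasDerivAt_inverse_one_sub_mul _ _ ev (isUnit_resolvent_denominator hq ev) g

end InitialValue

/-! ### Fundamental solutions and the characteristic determinant -/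

/-- Evaluation at the right end point, as a functional on `C[0,1]`. -/
noncomputable def evalOne : C01 →L[ℂ] ℂ := ContinuousMap.evalCLM ℂ ⟨1, right_mem_Icc.2 zero_le_one⟩

theorem evalOne_apply (f : C01) : evalOne f = f.extend 1 :=
  (f.extend_of_mem (right_mem_Icc.2 zero_le_one)).symm

section Fundamental

variable {q : ℝ → ℂ} (hq : IntervalIntegrable q volume 0 1)

/-- `∫₀ˣ (q - ev) y`: the derivative of a solution `y`, up to its initial value. -/
noncomputable def slopeOf (ev : ℂ) : C01 →L[ℂ] C01 := volterra q hq - ev • integration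

theorem slopeOf_apply (ev : ℂ) (y : C01) :
    slopeOf hq ev y = volterra q hq y - ev • integration y := rfl

theorem extend_slopeOf (ev : ℂ) (y : C01) {x : ℝ} (hx : x ∈ Icc (0 : ℝ) 1) :
    (slopeOf hq ev y).extend x = ∫ t in (0 : ℝ)..x, (q t - ev) * y.extend t := by
  rw [slopeOf, ← volterra_sub_const, extend_volterra _ _ hx]

/-- The solution of `y'' = (q - ev) y` with `y(0) = 1`, `y'(0) = 0`. -/
noncomputable def cosSol (ev : ℂ) : C01 := slResolvent hq ev 1

/-- The solution of `y'' = (q - ev) y` with `y(0) = 0`, `y'(0) = 1`. -/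
noncomputable def sinSol (ev : ℂ) : C01 := slResolvent hq ev (integration 1)

/-- The derivative of `cosSol`. -/
noncomputable def cosSol' (ev : ℂ) : C01 := slopeOf hq ev (cosSol hq ev)

/-- The derivative of `sinSol`. -/
noncomputable def sinSol' (ev : ℂ) : C01 := 1 + slopeOf hq ev (sinSol hq ev)

theorem cosSol_eq (ev : ℂ) : cosSol hq ev = 1 + integration (cosSol' hq ev) :=
  (eq_resolvent_iff hq ev _ _).1 rfl

theorem sinSol_eq (ev : ℂ) : sinSol hq ev = integration (sinSol' hq ev) := by
  rw [sinSol', map_add]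
  exact (eq_resolvent_iff hq ev _ _).1 rfl

theorem extend_integration_zero (f : C01) : (integration f).extend 0 = 0 := by
  rw [extend_integration _ (by simp)]; simp

theorem extend_slopeOf_zero (ev : ℂ) (f : C01) : (slopeOf hq ev f).extend 0 = 0 := by
  rw [extend_slopeOf _ _ _ (by simp)]; simp

theorem cosSol_zero (ev : ℂ) : (cosSol hq ev).extend 0 = 1 := by
  rw [cosSol_eq, C01.extend_add, extend_integration_zero, C01.extend_one, add_zero]

theorem cosSol'_zero (ev : ℂ) : (cosSol' hq ev).extend 0 = 0 := extend_slopeOf_zero ..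

theorem sinSol_zero (ev : ℂ) : (sinSol hq ev).extend 0 = 0 := by
  rw [sinSol_eq, extend_integration_zero]

theorem sinSol'_zero (ev : ℂ) : (sinSol' hq ev).extend 0 = 1 := by
  rw [sinSol', C01.extend_add, extend_slopeOf_zero, C01.extend_one, add_zero]

theorem isSolution_of_eq {ev a b : ℂ} {y z : C01} (hy : y = a • 1 + integration z)
    (hz : z = b • 1 + slopeOf hq ev y) :
    IsSolution (fun t => q t - ev) y.extend z.extend := by
  have hy' : ∀ x ∈ Icc (0 : ℝ) 1, y.extend x = a + ∫ t in (0 : ℝ)..x, z.extend t := fun x hx => by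
    nth_rw 1 [hy]
    rw [C01.extend_add, C01.extend_smul, extend_integration _ hx, C01.extend_one, mul_one]
  have hz' : ∀ x ∈ Icc (0 : ℝ) 1, z.extend x = b + ∫ t in (0 : ℝ)..x, (q t - ev) * y.extend t :=
    fun x hx => by
      nth_rw 1 [hz]
      rw [C01.extend_add, C01.extend_smul, extend_slopeOf _ _ _ hx, C01.extend_one, mul_one]
  have hp : IntervalIntegrable (fun t => q t - ev) volume 0 1 := hq.sub (by simp)
  refine ⟨⟨z.continuous_extend.intervalIntegrable _ _, fun x hx => ?_⟩,
    ⟨IsPrimitive.mul_continuousOn hp y.continuous_extend.continuousOn, fun x hx => ?_⟩⟩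
  · rw [hy' x hx, hy' 0 (by simp)]; simp
  · rw [hz' x hx, hz' 0 (by simp)]; simp

theorem isSolution_cosSol (ev : ℂ) :
    IsSolution (fun t => q t - ev) (cosSol hq ev).extend (cosSol' hq ev).extend :=
  isSolution_of_eq hq (a := 1) (b := 0) (by rw [one_smul]; exact cosSol_eq hq ev)
    (by rw [show (0 : ℂ) • (1 : C01) = 0 from C01.ext_extend fun _ _ => zero_mul _, zero_add]; rfl)

theorem isSolution_sinSol (ev : ℂ) :
    IsSolution (fun t => q t - ev) (sinSol hq ev).extend (sinSol' hq ev).extend :=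
  isSolution_of_eq hq (a := 0) (b := 1)
    (by rw [show (0 : ℂ) • (1 : C01) = 0 from C01.ext_extend fun _ _ => zero_mul _, zero_add]
        exact sinSol_eq hq ev)
    (by rw [one_smul]; rfl)

theorem IsSolution.const_mul_add {p y z y₂ z₂ : ℝ → ℂ} (h : IsSolution p y z)
    (h₂ : IsSolution p y₂ z₂) (c : ℂ) :
    IsSolution p (fun x => y x + c * y₂ x) (fun x => z x + c * z₂ x) := by
  refine ⟨h.1.add (h₂.1.const_mul c), ?_⟩
  have := h.2.add (h₂.2.const_mul c)
  refine this.congr_ae (ae_of_all _ fun x => ?_)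
  simp only
  ring

/-- The derivative with respect to the spectral parameter of a solution `slResolvent ev g`. -/
noncomputable def evDeriv (ev : ℂ) (g : C01) : C01 :=
  -slResolvent hq ev (integration (integration (slResolvent hq ev g)))

theorem hasDerivAt_evalOne (ev : ℂ) (g : C01) :
    HasDerivAt (fun w => evalOne (slResolvent hq w g)) (evalOne (evDeriv hq ev g)) ev :=
  evalOne.hasFDerivAt.comp_hasDerivAt ev (hasDerivAt_resolvent hq ev g)

theorem hasDerivAt_evalOne_slopeOf (ev : ℂ) (g : C01) :
    HasDerivAt (fun w => evalOne (slopeOf hq w (slResolvent hq w g)))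
      (evalOne (slopeOf hq ev (evDeriv hq ev g) - integration (slResolvent hq ev g))) ev := by
  have h := hasDerivAt_resolvent hq ev g
  have h1 := (evalOne.comp (volterra q hq)).hasFDerivAt.comp_hasDerivAt ev h
  have h2 := (evalOne.comp integration).hasFDerivAt.comp_hasDerivAt ev h
  have h3 := h1.sub ((hasDerivAt_id ev).mul h2)
  refine (h3.congr_deriv ?_).congr_of_eventuallyEq (Eventually.of_forall fun w => ?_)
  · simp only [evDeriv, slopeOf_apply, map_sub, map_smul, ContinuousLinearMap.comp_apply,
      Function.comp_apply, id_eq, smul_eq_mul]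
    ring
  · simp only [slopeOf_apply, map_sub, map_smul, ContinuousLinearMap.comp_apply,
      Function.comp_apply, id_eq, smul_eq_mul, Pi.sub_apply, Pi.mul_apply]

variable (β₁ β₂ : ℂ)

/-- The first boundary form `y'(0) + β₁ y'(1) + β₂ y(1)` of `cosSol`. -/
noncomputable def cosBoundary (ev : ℂ) : ℂ :=
  β₁ * evalOne (slopeOf hq ev (cosSol hq ev)) + β₂ * evalOne (cosSol hq ev)

/-- The first boundary form `y'(0) + β₁ y'(1) + β₂ y(1)` of `sinSol`. -/
noncomputable def sinBoundary (ev : ℂ) : ℂ :=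
  1 + β₁ * (1 + evalOne (slopeOf hq ev (sinSol hq ev))) + β₂ * evalOne (sinSol hq ev)

/-- The characteristic determinant: `a • cosSol + b • sinSol` satisfies both boundary conditions
if and only if `(a, b)` is in the kernel of the matrix of the boundary forms. -/
noncomputable def charDet (ev : ℂ) : ℂ :=
  (1 - evalOne (cosSol hq ev)) * sinBoundary hq β₁ β₂ ev +
    evalOne (sinSol hq ev) * cosBoundary hq β₁ β₂ ev

/-- By constancy of the Wronskian the determinant is linear in the fundamental solutions. -/
theorem charDet_eq (ev : ℂ) :
    charDet hq β₁ β₂ ev = (1 - (cosSol hq ev).extend 1) + β₁ * ((sinSol' hq ev).extend 1 - 1) +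
      β₂ * (sinSol hq ev).extend 1 := by
  have hw := (isSolution_cosSol hq ev).wronskian (isSolution_sinSol hq ev)
    (right_mem_Icc.2 zero_le_one)
  rw [cosSol_zero, cosSol'_zero, sinSol'_zero] at hw
  have e : (sinSol' hq ev).extend 1 = 1 + (slopeOf hq ev (sinSol hq ev)).extend 1 := rfl
  have e' : (cosSol' hq ev).extend 1 = (slopeOf hq ev (cosSol hq ev)).extend 1 := rfl
  rw [charDet, sinBoundary, cosBoundary]
  simp only [evalOne_apply]
  rw [e, e'] at hw
  rw [e]
  linear_combination -β₁ * hw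

theorem hasDerivAt_sinBoundary (ev : ℂ) : HasDerivAt (sinBoundary hq β₁ β₂)
    (β₁ * evalOne (slopeOf hq ev (evDeriv hq ev (integration 1)) - integration (sinSol hq ev)) +
      β₂ * evalOne (evDeriv hq ev (integration 1))) ev :=
  ((((hasDerivAt_evalOne_slopeOf hq ev (integration 1)).const_add 1).const_mul β₁).const_add 1).add
    ((hasDerivAt_evalOne hq ev (integration 1)).const_mul β₂)

theorem hasDerivAt_cosBoundary (ev : ℂ) : HasDerivAt (cosBoundary hq β₁ β₂)
    (β₁ * evalOne (slopeOf hq ev (evDeriv hq ev 1) - integration (cosSol hq ev)) +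
      β₂ * evalOne (evDeriv hq ev 1)) ev :=
  ((hasDerivAt_evalOne_slopeOf hq ev 1).const_mul β₁).add
    ((hasDerivAt_evalOne hq ev 1).const_mul β₂)

theorem hasDerivAt_charDet (ev : ℂ) : HasDerivAt (charDet hq β₁ β₂)
    ((-evalOne (evDeriv hq ev 1)) * sinBoundary hq β₁ β₂ ev + (1 - evalOne (cosSol hq ev)) *
      (β₁ * evalOne (slopeOf hq ev (evDeriv hq ev (integration 1)) - integration (sinSol hq ev)) +
        β₂ * evalOne (evDeriv hq ev (integration 1))) +
      (evalOne (evDeriv hq ev (integration 1)) * cosBoundary hq β₁ β₂ ev +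
        evalOne (sinSol hq ev) *
        (β₁ * evalOne (slopeOf hq ev (evDeriv hq ev 1) - integration (cosSol hq ev)) +
          β₂ * evalOne (evDeriv hq ev 1)))) ev :=
  (((hasDerivAt_evalOne hq ev 1).const_sub 1).mul (hasDerivAt_sinBoundary hq β₁ β₂ ev)).add
    ((hasDerivAt_evalOne hq ev (integration 1)).mul (hasDerivAt_cosBoundary hq β₁ β₂ ev))

theorem differentiable_charDet : Differentiable ℂ (charDet hq β₁ β₂) :=
  fun ev => (hasDerivAt_charDet hq β₁ β₂ ev).differentiableAt

variable {β₁ β₂}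

/-- A solution of `-y'' + q y = ev y + g` that satisfies the boundary conditions, in terms of the
resolvent. -/
theorem exists_eq_resolvent_of_isSLPair {ev : ℂ} {y f : ℝ → ℂ} (h : IsSLPair q β₁ β₂ y f)
    (hfi : IntervalIntegrable f volume 0 1) (g : C01)
    (hf : f =ᵐ[unitMeasure] fun x => ev * y x + g.extend x) :
    ∃ (Y : C01) (a b : ℂ), (∀ x ∈ Icc (0 : ℝ) 1, Y.extend x = y x) ∧
      Y = slResolvent hq ev (a • 1 + b • integration 1 - integration (integration g)) ∧
      a - evalOne Y = 0 ∧
      b + β₁ * (b + evalOne (slopeOf hq ev Y - integration g)) + β₂ * evalOne Y = 0 := by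
  obtain ⟨z, hy, hz, hb, hb'⟩ := (isSLPair_iff_isPrimitive hq hfi).1 h
  set Y := C01.ofContinuousOn y hy.continuousOn
  set Z := C01.ofContinuousOn z hz.continuousOn
  have hY : ∀ x ∈ Icc (0 : ℝ) 1, Y.extend x = y x := fun x hx => C01.extend_ofContinuousOn _ hx
  have hZ : ∀ x ∈ Icc (0 : ℝ) 1, Z.extend x = z x := fun x hx => C01.extend_ofContinuousOn _ hx
  have h0 : (0 : ℝ) ∈ Icc (0 : ℝ) 1 := by simp
  have h1 : (1 : ℝ) ∈ Icc (0 : ℝ) 1 := by simp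
  have eZ : Z = z 0 • 1 + (slopeOf hq ev Y - integration g) := by
    refine C01.ext_extend fun x hx => ?_
    have e : (fun t => q t * y t - f t) =ᵐ[unitMeasure]
        fun t => (q t - ev) * Y.extend t - g.extend t := by
      filter_upwards [hf, ae_restrict_mem measurableSet_Icc] with t ht hm
      rw [ht, hY t hm]
      ring
    rw [hZ x hx, hz.2 x hx, integral_congr_ae_unitMeasure e hx, C01.extend_add, C01.extend_smul,
      C01.extend_sub, extend_slopeOf _ _ _ hx, extend_integration _ hx, C01.extend_one, mul_one,
      intervalIntegral.integral_sub]
    · exact intervalIntegrable_mul_extend (hq.sub (by simp)) Y hx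
    · exact g.continuous_extend.intervalIntegrable _ _
  have eY : Y = y 0 • 1 + integration Z := by
    refine C01.ext_extend fun x hx => ?_
    rw [hY x hx, hy.2 x hx, C01.extend_add, C01.extend_smul, extend_integration _ hx,
      C01.extend_one, mul_one]
    congr 1
    refine intervalIntegral.integral_congr fun t ht => ?_
    rw [uIcc_of_le hx.1] at ht
    exact (hZ t ⟨ht.1, ht.2.trans hx.2⟩).symm
  refine ⟨Y, y 0, z 0, hY, ?_, ?_, ?_⟩
  · rw [eq_resolvent_iff, ← slopeOf_apply]
    nth_rw 1 [eY, eZ]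
    simp only [map_add, map_sub, map_smul]
    abel
  · rw [evalOne_apply, hY 1 h1, hb']
  · have e1 : z 1 = z 0 + evalOne (slopeOf hq ev Y - integration g) := by
      rw [← hZ 1 h1, eZ, C01.extend_add, C01.extend_smul, C01.extend_one, mul_one, evalOne_apply]
    rw [evalOne_apply Y, hY 1 h1, ← e1, hb]

variable (β₁ β₂) in
/-- The candidate eigenfunction: the combination of `cosSol` and `sinSol` with value `1` at `0`
that satisfies the first boundary condition, if `sinBoundary` does not vanish. -/
noncomputable def eigenSol (ev : ℂ) : C01 :=
  cosSol hq ev + (-(cosBoundary hq β₁ β₂ ev / sinBoundary hq β₁ β₂ ev)) • sinSol hq ev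

theorem isSLPair_eigenSol {ev : ℂ} (hdet : charDet hq β₁ β₂ ev = 0)
    (hs : sinBoundary hq β₁ β₂ ev ≠ 0) :
    IsSLPair q β₁ β₂ (eigenSol hq β₁ β₂ ev).extend
      (fun x => ev * (eigenSol hq β₁ β₂ ev).extend x) := by
  set b := -(cosBoundary hq β₁ β₂ ev / sinBoundary hq β₁ β₂ ev) with hb
  have hsol := (isSolution_cosSol hq ev).const_mul_add (isSolution_sinSol hq ev) b
  have hb' : cosBoundary hq β₁ β₂ ev + b * sinBoundary hq β₁ β₂ ev = 0 := by
    rw [hb]; field_simp; ring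
  refine (isSLPair_iff_isPrimitive hq (((C01.continuous_extend _).const_mul
    ev).intervalIntegrable _ _)).2 ⟨_, hsol.1, hsol.2.congr_ae (ae_of_all _ fun x => ?_), ?_, ?_⟩
  · change _ = (q x - ev) * (eigenSol hq β₁ β₂ ev).extend x
    ring
  · change _ + β₁ * _ + β₂ * ((cosSol hq ev).extend 1 + b * (sinSol hq ev).extend 1) = 0
    have e : (sinSol' hq ev).extend 1 = 1 + (slopeOf hq ev (sinSol hq ev)).extend 1 := rfl
    have e' : (cosSol' hq ev).extend 1 = (slopeOf hq ev (cosSol hq ev)).extend 1 := rfl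
    rw [cosSol'_zero, sinSol'_zero, e, e']
    rw [cosBoundary, sinBoundary] at hb'
    simp only [evalOne_apply] at hb'
    linear_combination hb'
  · change (cosSol hq ev).extend 0 + b * (sinSol hq ev).extend 0 -
      ((cosSol hq ev).extend 1 + b * (sinSol hq ev).extend 1) = 0
    rw [cosSol_zero, sinSol_zero]
    rw [charDet] at hdet
    simp only [evalOne_apply] at hdet
    refine mul_left_cancel₀ hs ?_
    linear_combination hdet - (sinSol hq ev).extend 1 * hb'

/-- If `ev` is a simple zero of the characteristic determinant, then `-v'' + q v = ev v + κ u` has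
no solution satisfying the boundary conditions, for an eigenfunction `u`, unless `κ = 0`; the
solutions for `κ = 0` are the multiples of `u`. A particular solution without boundary conditions
is the derivative of `u` with respect to the spectral parameter, so that solvability would make
the derivative of the determinant vanish. -/
theorem eq_smul_eigenSol_of_isSLPair {ev : ℂ} (hdet : charDet hq β₁ β₂ ev = 0)
    (hs : sinBoundary hq β₁ β₂ ev ≠ 0) (hd : deriv (charDet hq β₁ β₂) ev ≠ 0) {v f : ℝ → ℂ} {κ : ℂ}
    (h : IsSLPair q β₁ β₂ v f) (hfi : IntervalIntegrable f volume 0 1)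
    (hf : f =ᵐ[unitMeasure] fun x => ev * v x + κ * (eigenSol hq β₁ β₂ ev).extend x) :
    κ = 0 ∧ ∃ a : ℂ, ∀ x ∈ Icc (0 : ℝ) 1, v x = a * (eigenSol hq β₁ β₂ ev).extend x := by
  obtain ⟨Y, a, b, hY, eY, h1, h2⟩ := exists_eq_resolvent_of_isSLPair hq h hfi
    (κ • eigenSol hq β₁ β₂ ev) hf
  set B := -(cosBoundary hq β₁ β₂ ev / sinBoundary hq β₁ β₂ ev) with hB
  have hB' : cosBoundary hq β₁ β₂ ev = - B * sinBoundary hq β₁ β₂ ev := by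
    rw [hB]; field_simp
  have eu : eigenSol hq β₁ β₂ ev = slResolvent hq ev 1 + B • slResolvent hq ev (integration 1) :=
    rfl
  have eY' : Y = a • cosSol hq ev + b • sinSol hq ev +
      κ • (evDeriv hq ev 1 + B • evDeriv hq ev (integration 1)) := by
    rw [eY, eu, evDeriv, evDeriv, cosSol, sinSol]
    simp only [map_add, map_sub, map_smul]
    module
  have hdv := (hasDerivAt_charDet hq β₁ β₂ ev).deriv
  rw [charDet] at hdet
  have hu : eigenSol hq β₁ β₂ ev = cosSol hq ev + B • sinSol hq ev := rfl
  rw [eY'] at h1 h2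
  rw [hu] at h2
  rw [hB'] at hdv hdet
  have hS : sinBoundary hq β₁ β₂ ev = 1 + β₁ * (1 + evalOne (slopeOf hq ev (sinSol hq ev))) +
    β₂ * evalOne (sinSol hq ev) := rfl
  have hC : cosBoundary hq β₁ β₂ ev =
    β₁ * evalOne (slopeOf hq ev (cosSol hq ev)) + β₂ * evalOne (cosSol hq ev) := rfl
  rw [hB'] at hC
  simp only [map_add, map_sub, map_smul, smul_eq_mul] at h1 h2 hdv
  generalize sinBoundary hq β₁ β₂ ev = S at *
  -- eliminate `a` and `b` from the two boundary conditions; `charDet' ev` remains as factor of `κ`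
  have hκ : κ = 0 := by
    have : κ * deriv (charDet hq β₁ β₂) ev = 0 := by
      have hc1 : (1 - evalOne (cosSol hq ev)) = evalOne (sinSol hq ev) * B := by
        refine mul_right_cancel₀ hs ?_
        linear_combination hdet
      rw [hdv]
      rw [hc1]
      linear_combination S * h1 + evalOne (sinSol hq ev) * h2 + evalOne (sinSol hq ev) * b * hS +
        evalOne (sinSol hq ev) * a * hC - a * S * hc1
    exact (mul_eq_zero.1 this).resolve_right hd
  refine ⟨hκ, a, fun x hx => ?_⟩
  rw [hκ] at h2
  have hb : b = a * B := by
    refine mul_right_cancel₀ hs ?_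
    linear_combination h2 + b * hS + a * hC
  rw [← hY x hx, eY', hκ, hb, hu]
  simp only [C01.extend_add, C01.extend_smul]
  ring

end Fundamental

/-! ### Eigenvalues and root subspaces -/

theorem C01.memLp_extend (f : C01) : MemLp f.extend 2 unitMeasure :=
  MemLp.of_bound f.continuous_extend.aestronglyMeasurable ‖f‖ (ae_of_all _ f.norm_extend_le)

/-- The class of `f ∈ C[0,1]` in `L₂[0,1]`. -/
noncomputable def C01.toL2 (f : C01) : L2 := f.memLp_extend.toLp _

theorem C01.coeFn_toL2 (f : C01) : (f.toL2 : ℝ → ℂ) =ᵐ[unitMeasure] f.extend := MemLp.coeFn_toLp _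

theorem C01.toL2_ne_zero {f : C01} {x : ℝ} (hx : x ∈ Icc (0 : ℝ) 1) (hf : f.extend x ≠ 0) :
    f.toL2 ≠ 0 := fun h => by
  have h0 : ∀ᵐ x ∂unitMeasure, f.extend x = 0 := by
    filter_upwards [f.coeFn_toL2, Lp.coeFn_zero ℂ 2 unitMeasure] with x h1 h2
    rw [← h1, h, h2]; rfl
  exact hf (Measure.eqOn_Icc_of_ae_eq volume zero_ne_one h0
    f.continuous_extend.continuousOn continuousOn_const hx)

theorem intervalIntegrable_L2 (f : L2) : IntervalIntegrable f volume 0 1 :=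
  intervalIntegrable_iff_unitMeasure.2 ((Lp.memLp f).integrable (by norm_num))

theorem IsSLPair.congr_ae {q y f g : ℝ → ℂ} {β₁ β₂ : ℂ} (h : IsSLPair q β₁ β₂ y f)
    (hfg : f =ᵐ[unitMeasure] g) : IsSLPair q β₁ β₂ y g := by
  obtain ⟨z, hz, hac, hd, hb⟩ := h
  refine ⟨z, hz, hac, ?_, hb⟩
  filter_upwards [hd, hfg] with x h1 h2
  rwa [← h2]

theorem mem_powKer_succ {q : ℝ → ℂ} {β₁ β₂ : ℂ} (ev : ℂ) (k : ℕ) (v : L2) :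
    v ∈ powKer (slOperator q β₁ β₂) ev (k + 1) ↔
      ∃ f : L2, (v, f) ∈ slGraph q β₁ β₂ ∧ f - ev • v ∈ powKer (slOperator q β₁ β₂) ev k := by
  rw [powKer, slOperator_graph]
  simp only [Submodule.mem_map, Submodule.mem_inf, Submodule.mem_comap]
  constructor
  · rintro ⟨⟨u, f⟩, ⟨h1, h2⟩, rfl⟩
    exact ⟨f, h1, h2⟩
  · rintro ⟨f, h1, h2⟩
    exact ⟨(v, f), ⟨h1, h2⟩, rfl⟩

section Spectrum

variable {q : ℝ → ℂ} (hq : IntervalIntegrable q volume 0 1) {β₁ β₂ : ℂ}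

theorem isEigenvalue_iff {T : L2 →ₗ.[ℂ] L2} {ev : ℂ} :
    IsEigenvalue T ev ↔ ∃ u : L2, u ≠ 0 ∧ (u, ev • u) ∈ T.graph := by
  constructor
  · rintro ⟨u, h0, h⟩
    exact ⟨u, h0, (LinearPMap.mem_graph_iff T).2 ⟨u, rfl, h⟩⟩
  · rintro ⟨u, h0, h⟩
    obtain ⟨y, hy, hT⟩ := (LinearPMap.mem_graph_iff T).1 h
    dsimp only at hy hT
    subst hy
    exact ⟨y, h0, hT⟩

theorem charDet_eq_zero_of_isEigenvalue {ev : ℂ} (h : IsEigenvalue (slOperator q β₁ β₂) ev) :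
    charDet hq β₁ β₂ ev = 0 := by
  obtain ⟨u, h0, h⟩ := isEigenvalue_iff.1 h
  rw [slOperator_graph] at h
  obtain ⟨y, hy, h⟩ := h
  dsimp only at hy h
  obtain ⟨Y, a, b, hY, eY, h1, h2⟩ := exists_eq_resolvent_of_isSLPair hq (ev := ev) h
    (intervalIntegrable_L2 _) 0 (by
      filter_upwards [hy, Lp.coeFn_smul ev u] with x h1 h2
      rw [h2, Pi.smul_apply, h1, smul_eq_mul]
      exact (add_zero _).symm)
  rw [map_zero, map_zero, sub_zero, map_add, map_smul, map_smul] at eY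
  rw [map_zero, sub_zero] at h2
  change Y = a • cosSol hq ev + b • sinSol hq ev at eY
  by_contra hdet
  have hS : sinBoundary hq β₁ β₂ ev = 1 + β₁ * (1 + evalOne (slopeOf hq ev (sinSol hq ev))) +
    β₂ * evalOne (sinSol hq ev) := rfl
  have hC : cosBoundary hq β₁ β₂ ev =
    β₁ * evalOne (slopeOf hq ev (cosSol hq ev)) + β₂ * evalOne (cosSol hq ev) := rfl
  have hD : charDet hq β₁ β₂ ev = (1 - evalOne (cosSol hq ev)) * sinBoundary hq β₁ β₂ ev +
    evalOne (sinSol hq ev) * cosBoundary hq β₁ β₂ ev := rfl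
  rw [eY] at h1 h2
  simp only [map_add, map_smul, smul_eq_mul] at h1 h2
  -- Cramer's rule for the two boundary conditions
  have ha : a = 0 := by
    refine (mul_eq_zero.1 ?_).resolve_right hdet
    linear_combination a * hD + sinBoundary hq β₁ β₂ ev * h1 + evalOne (sinSol hq ev) * h2 +
      evalOne (sinSol hq ev) * b * hS + evalOne (sinSol hq ev) * a * hC
  have hb : b = 0 := by
    refine (mul_eq_zero.1 ?_).resolve_right hdet
    linear_combination b * hD + (1 - evalOne (cosSol hq ev)) * h2 +
      (1 - evalOne (cosSol hq ev)) * b * hS +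
      (1 - evalOne (cosSol hq ev)) * a * hC - cosBoundary hq β₁ β₂ ev * h1
  refine h0 ((Lp.eq_zero_iff_ae_eq_zero).2 ?_)
  filter_upwards [hy, ae_restrict_mem measurableSet_Icc] with x h3 hx
  rw [h3, ← hY x hx, eY, ha, hb, C01.extend_add, C01.extend_smul, C01.extend_smul]
  simp

theorem mem_slGraph_eigenSol {ev : ℂ} (hdet : charDet hq β₁ β₂ ev = 0)
    (hs : sinBoundary hq β₁ β₂ ev ≠ 0) :
    ((eigenSol hq β₁ β₂ ev).toL2, ev • (eigenSol hq β₁ β₂ ev).toL2) ∈ slGraph q β₁ β₂ := by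
  refine ⟨_, C01.coeFn_toL2 _, (isSLPair_eigenSol hq hdet hs).congr_ae ?_⟩
  filter_upwards [C01.coeFn_toL2 (eigenSol hq β₁ β₂ ev),
    Lp.coeFn_smul ev (eigenSol hq β₁ β₂ ev).toL2] with x h1 h2
  rw [h2, Pi.smul_apply, h1, smul_eq_mul]

theorem eigenSol_zero (ev : ℂ) : (eigenSol hq β₁ β₂ ev).extend 0 = 1 := by
  rw [eigenSol, C01.extend_add, C01.extend_smul, cosSol_zero, sinSol_zero, mul_zero, add_zero]

theorem eigenSol_toL2_ne_zero (ev : ℂ) : (eigenSol hq β₁ β₂ ev).toL2 ≠ 0 :=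
  C01.toL2_ne_zero (x := 0) (by simp) (by rw [eigenSol_zero]; exact one_ne_zero)

/-- At a simple zero of the determinant no associated function exists, so that by induction every
kernel of a power of `T - ev` stays within the line of eigenfunctions. -/
theorem rootSubspace_eq_span {ev : ℂ} (hdet : charDet hq β₁ β₂ ev = 0)
    (hs : sinBoundary hq β₁ β₂ ev ≠ 0) (hd : deriv (charDet hq β₁ β₂) ev ≠ 0) :
    rootSubspace (slOperator q β₁ β₂) ev = Submodule.span ℂ {(eigenSol hq β₁ β₂ ev).toL2} := by
  apply le_antisymm
  · refine iSup_le fun k => ?_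
    induction k with
    | zero => exact bot_le
    | succ k ih =>
      intro v hv
      obtain ⟨f, ⟨y, hy, h⟩, hf⟩ := (mem_powKer_succ ev k v).1 hv
      dsimp only at hy h
      obtain ⟨κ, hκ⟩ := Submodule.mem_span_singleton.1 (ih hf)
      obtain ⟨-, a, ha⟩ := eq_smul_eigenSol_of_isSLPair hq hdet hs hd (κ := κ) h
        (intervalIntegrable_L2 _) (by
          have e : f = ev • v + κ • (eigenSol hq β₁ β₂ ev).toL2 := by rw [hκ]; abel
          filter_upwards [hy, Lp.coeFn_smul ev v, C01.coeFn_toL2 (eigenSol hq β₁ β₂ ev),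
            Lp.coeFn_smul κ (eigenSol hq β₁ β₂ ev).toL2,
            Lp.coeFn_add (ev • v) (κ • (eigenSol hq β₁ β₂ ev).toL2)] with x h1 h2 h3 h4 h5
          rw [e, h5, Pi.add_apply, h2, h4, Pi.smul_apply, Pi.smul_apply, h1, h3, smul_eq_mul,
            smul_eq_mul])
      refine Submodule.mem_span_singleton.2 ⟨a, Lp.ext ?_⟩
      filter_upwards [hy, Lp.coeFn_smul a (eigenSol hq β₁ β₂ ev).toL2,
        C01.coeFn_toL2 (eigenSol hq β₁ β₂ ev), ae_restrict_mem measurableSet_Icc] with x h1 h2 h3 hx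
      rw [h2, h1, Pi.smul_apply, h3, ha x hx, smul_eq_mul]
  · rw [Submodule.span_singleton_le_iff_mem]
    refine le_iSup (powKer (slOperator q β₁ β₂) ev) 1 ?_
    rw [mem_powKer_succ]
    exact ⟨_, mem_slGraph_eigenSol hq hdet hs, by simp⟩

theorem isEigenvalue_of_charDet {ev : ℂ} (hdet : charDet hq β₁ β₂ ev = 0)
    (hs : sinBoundary hq β₁ β₂ ev ≠ 0) : IsEigenvalue (slOperator q β₁ β₂) ev :=
  isEigenvalue_iff.2 ⟨_, eigenSol_toL2_ne_zero hq ev, by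
    rw [slOperator_graph]; exact mem_slGraph_eigenSol hq hdet hs⟩

theorem isSimpleEigenvalue_of_charDet {ev : ℂ} (hdet : charDet hq β₁ β₂ ev = 0)
    (hs : sinBoundary hq β₁ β₂ ev ≠ 0) (hd : deriv (charDet hq β₁ β₂) ev ≠ 0) :
    IsSimpleEigenvalue (slOperator q β₁ β₂) ev := by
  refine ⟨isEigenvalue_of_charDet hq hdet hs, ?_⟩
  rw [rootSubspace_eq_span hq hdet hs hd]
  exact finrank_span_singleton (eigenSol_toL2_ne_zero hq ev)

end Spectrum

/-! ### Bounds for solutions at high frequency -/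

theorem norm_exp_mul_I_le (z : ℂ) : ‖Complex.exp (z * Complex.I)‖ ≤ Real.exp |z.im| := by
  rw [Complex.norm_exp]
  refine Real.exp_le_exp.2 ?_
  simpa using neg_le_abs z.im

theorem norm_cos_le_exp (z : ℂ) : ‖Complex.cos z‖ ≤ Real.exp |z.im| := by
  have h1 := norm_exp_mul_I_le z
  have h2 := norm_exp_mul_I_le (-z)
  rw [Complex.neg_im, abs_neg] at h2
  rw [Complex.cos, norm_div, Complex.norm_ofNat, div_le_iff₀ two_pos]
  exact (norm_add_le _ _).trans (by linarith)

theorem norm_sin_le_exp (z : ℂ) : ‖Complex.sin z‖ ≤ Real.exp |z.im| := by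
  have h1 := norm_exp_mul_I_le z
  have h2 := norm_exp_mul_I_le (-z)
  rw [Complex.neg_im, abs_neg] at h2
  rw [Complex.sin, norm_div, Complex.norm_ofNat, norm_mul, Complex.norm_I, mul_one,
    div_le_iff₀ two_pos]
  exact (norm_sub_le _ _).trans (by linarith)

theorem abs_im_mul_ofReal (m : ℂ) {x : ℝ} (hx : 0 ≤ x) : |(m * x).im| = |m.im| * x := by
  rw [Complex.im_mul_ofReal, abs_mul, abs_of_nonneg hx]

/-- High-frequency bounds: `y'' = (p - m ^ 2) y` with `2 ‖p‖₁ ≤ ‖m‖` is a perturbation of the free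
equation, with relative error of order `‖p‖₁ / ‖m‖` after division by the exponential growth of the
free solutions. -/
theorem IsSolution.norm_sub_free_le {p P y z : ℝ → ℂ} {m : ℂ} (h : IsSolution P y z)
    (hp : IntervalIntegrable p volume 0 1) (hP : ∀ t, P t = p t - m ^ 2) {Q : ℝ}
    (hQ : ∫ t in (0 : ℝ)..1, ‖p t‖ ≤ Q) (hQm : 2 * Q ≤ ‖m‖) (hm : m ≠ 0) {K : ℝ}
    (hK : ‖m * y 0‖ + ‖z 0‖ ≤ K) {x : ℝ} (hx : x ∈ Icc (0 : ℝ) 1) :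
    ‖m * y x‖ ≤ 2 * K * Real.exp (|m.im| * x) ∧
    ‖m * y x - (m * y 0 * Complex.cos (m * x) + z 0 * Complex.sin (m * x))‖ ≤
      2 * K * Q / ‖m‖ * Real.exp (|m.im| * x) ∧
    ‖z x - (-m * y 0 * Complex.sin (m * x) + z 0 * Complex.cos (m * x))‖ ≤
      2 * K * Q / ‖m‖ * Real.exp (|m.im| * x) := by
  have hm0 : 0 < ‖m‖ := norm_pos_iff.2 hm
  have hK0 : 0 ≤ K := le_trans (by positivity) hK
  have hQ0 : 0 ≤ Q := (integral_norm_nonneg p).trans hQ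
  -- the integral terms are controlled by the weighted supremum of the solution
  have key : ∀ T : ℂ → ℂ, (∀ w, ‖T w‖ ≤ Real.exp |w.im|) → ∀ S : ℝ, 0 ≤ S →
      (∀ t ∈ Icc (0 : ℝ) 1, ‖m * y t‖ ≤ S * Real.exp (|m.im| * t)) → ∀ x ∈ Icc (0 : ℝ) 1,
      ‖∫ t in (0 : ℝ)..x, T (m * (x - t)) * (p t * y t)‖ ≤
        S * Q / ‖m‖ * Real.exp (|m.im| * x) := by
    intro T hT S hS hy x hx
    have h1 := norm_integral_mul_le hp hx (u := fun t => T (m * (x - t)) * y t)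
      (C := S / ‖m‖ * Real.exp (|m.im| * x)) (fun t ht => ?_) (by positivity)
    · simp only [mul_left_comm (T _) (p _)]
      refine h1.trans ((mul_le_mul_of_nonneg_right hQ (by positivity)).trans_eq ?_)
      ring
    · have h2 := hT (m * ((x - t : ℝ) : ℂ))
      rw [abs_im_mul_ofReal _ (sub_nonneg.2 ht.2)] at h2
      have h3 := hy t ⟨ht.1, ht.2.trans hx.2⟩
      rw [norm_mul, mul_comm, ← le_div_iff₀ hm0] at h3
      rw [norm_mul]
      push_cast at h2
      refine (mul_le_mul h2 h3 (norm_nonneg _) (Real.exp_nonneg _)).trans_eq ?_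
      rw [mul_sub, Real.exp_sub]
      field_simp
  have hfree : ∀ T T' : ℂ → ℂ, (∀ w, ‖T w‖ ≤ Real.exp |w.im|) → (∀ w, ‖T' w‖ ≤ Real.exp |w.im|) →
      ∀ x ∈ Icc (0 : ℝ) 1, ‖m * y 0 * T (m * x) + z 0 * T' (m * x)‖ ≤
        K * Real.exp (|m.im| * x) := by
    intro T T' hT hT' x hx
    have h1 := hT (m * x)
    have h2 := hT' (m * x)
    rw [abs_im_mul_ofReal _ hx.1] at h1 h2
    refine (norm_add_le _ _).trans ?_
    rw [norm_mul _ (T _), norm_mul _ (T' _)]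
    refine (add_le_add (mul_le_mul_of_nonneg_left h1 (norm_nonneg _))
      (mul_le_mul_of_nonneg_left h2 (norm_nonneg _))).trans ?_
    rw [← add_mul]
    exact mul_le_mul_of_nonneg_right hK (Real.exp_nonneg _)
  have hbound : ∀ x ∈ Icc (0 : ℝ) 1, ‖m * y x‖ ≤ 2 * K * Real.exp (|m.im| * x) := by
    have hcont : ContinuousOn (fun x => ‖m * y x‖ * Real.exp (-(|m.im| * x))) (Icc 0 1) :=
      (continuousOn_const.mul h.1.continuousOn).norm.mul (by fun_prop)
    obtain ⟨x₀, hx₀, hmax⟩ := isCompact_Icc.exists_isMaxOn (nonempty_Icc.2 zero_le_one) hcont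
    set S := ‖m * y x₀‖ * Real.exp (-(|m.im| * x₀))
    have hS0 : 0 ≤ S := by positivity
    have hS : ∀ t ∈ Icc (0 : ℝ) 1, ‖m * y t‖ ≤ S * Real.exp (|m.im| * t) := fun t ht => by
      have := hmax ht
      simp only [mem_ofPred_eq] at this
      rw [Real.exp_neg, ← div_eq_mul_inv, div_le_iff₀ (Real.exp_pos _)] at this
      exact this
    have h1 : ‖m * y x₀‖ ≤ K * Real.exp (|m.im| * x₀) + S * Q / ‖m‖ * Real.exp (|m.im| * x₀) := by
      rw [(h.variation_of_constants hP hx₀).1]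
      exact (norm_add_le _ _).trans (add_le_add (hfree _ _ norm_cos_le_exp norm_sin_le_exp _ hx₀)
        (key _ norm_sin_le_exp S hS0 hS x₀ hx₀))
    have h2 : S ≤ K + S * Q / ‖m‖ := by
      simp only [S, Real.exp_neg]
      rw [← div_eq_mul_inv, div_le_iff₀ (Real.exp_pos _)]
      rw [add_mul]
      simpa only [S, Real.exp_neg, div_eq_mul_inv] using h1
    have h3 : S * Q / ‖m‖ ≤ S / 2 := by
      rw [div_le_div_iff₀ hm0 two_pos]
      nlinarith
    intro x hx
    refine (hS x hx).trans (mul_le_mul_of_nonneg_right ?_ (Real.exp_nonneg _))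
    linarith
  refine ⟨hbound x hx, ?_, ?_⟩
  · rw [(h.variation_of_constants hP hx).1, add_sub_cancel_left]
    exact key _ norm_sin_le_exp _ (by positivity) hbound x hx
  · rw [(h.variation_of_constants hP hx).2, add_sub_cancel_left]
    exact key _ norm_cos_le_exp _ (by positivity) hbound x hx

/-! ### Oscillating integrals -/

/-- The weights `α n` converge weakly to the constant `a`: they are continuous, bounded by one, and
`∫₀ˣ α n f → a ∫₀ˣ f` for integrable `f`. -/
def WeakLimit (α : ℕ → ℝ → ℂ) (a : ℂ) : Prop :=
  (∀ n, Continuous (α n)) ∧ (∀ n, ∀ t, ‖α n t‖ ≤ 1) ∧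
    ∀ f : ℝ → ℂ, IntervalIntegrable f volume 0 1 → ∀ x ∈ Icc (0 : ℝ) 1,
      Tendsto (fun n => ∫ t in (0 : ℝ)..x, α n t * f t) atTop (𝓝 (a * ∫ t in (0 : ℝ)..x, f t))

/-- The Riemann-Lebesgue lemma on an interval. -/
theorem tendsto_integral_exp_mul {c : ℝ} (hc : c ≠ 0) (f : ℝ → ℂ) {x : ℝ} (hx : 0 ≤ x) :
    Tendsto (fun n : ℕ => ∫ t in (0 : ℝ)..x, Complex.exp ((c * n * t : ℝ) * Complex.I) * f t) atTop
      (𝓝 0) := by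
  have h := Real.tendsto_integral_exp_smul_cocompact ((Ioc 0 x).indicator f)
  have hw : Tendsto (fun n : ℕ => -(c / (2 * π)) * (n : ℝ)) atTop (cocompact ℝ) :=
    (Filter.tendsto_cocompact_mul_left₀ (neg_ne_zero.2 (div_ne_zero hc (by positivity)))).comp
      (tendsto_natCast_atTop_atTop.mono_right atTop_le_cocompact)
  refine (h.comp hw).congr fun n => ?_
  rw [Function.comp_apply, intervalIntegral.integral_of_le hx,
    ← integral_indicator measurableSet_Ioc]
  refine integral_congr_ae (ae_of_all _ fun t => ?_)
  simp only [indicator]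
  split_ifs
  · rw [Circle.smul_def, Real.fourierChar_apply, smul_eq_mul]
    congr 3
    push_cast
    have := Real.pi_ne_zero
    field_simp
  · simp

theorem intervalIntegrable_mul_of_continuous {α f : ℝ → ℂ} (hα : Continuous α)
    (hf : IntervalIntegrable f volume 0 1) {x : ℝ} (hx : x ∈ Icc (0 : ℝ) 1) :
    IntervalIntegrable (fun t => α t * f t) volume 0 x :=
  (intervalIntegrable_zero_of_mem hf hx).continuousOn_mul hα.continuousOn

theorem tendsto_integral_cos_mul {f : ℝ → ℂ} (hf : IntervalIntegrable f volume 0 1) {x : ℝ}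
    (hx : x ∈ Icc (0 : ℝ) 1) :
    Tendsto (fun n : ℕ => ∫ t in (0 : ℝ)..x, Complex.cos ((4 * π * n * t : ℝ)) * f t) atTop
      (𝓝 0) := by
  have h1 := tendsto_integral_exp_mul (c := 4 * π) (by positivity) f hx.1
  have h2 := tendsto_integral_exp_mul (c := -(4 * π)) (by simp [Real.pi_ne_zero]) f hx.1
  have h3 := (h1.add h2).div_const 2
  rw [add_zero, zero_div] at h3
  refine h3.congr fun n => ?_
  rw [← intervalIntegral.integral_add
    (intervalIntegrable_mul_of_continuous (by fun_prop) hf hx)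
    (intervalIntegrable_mul_of_continuous (by fun_prop) hf hx), ← intervalIntegral.integral_div]
  refine intervalIntegral.integral_congr fun t _ => ?_
  simp only [Complex.cos]
  push_cast
  ring_nf

theorem tendsto_integral_sin_mul {f : ℝ → ℂ} (hf : IntervalIntegrable f volume 0 1) {x : ℝ}
    (hx : x ∈ Icc (0 : ℝ) 1) :
    Tendsto (fun n : ℕ => ∫ t in (0 : ℝ)..x, Complex.sin ((4 * π * n * t : ℝ)) * f t) atTop
      (𝓝 0) := by
  have h1 := tendsto_integral_exp_mul (c := 4 * π) (by positivity) f hx.1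
  have h2 := tendsto_integral_exp_mul (c := -(4 * π)) (by simp [Real.pi_ne_zero]) f hx.1
  have h3 := ((h2.sub h1).mul_const (Complex.I)).div_const 2
  rw [sub_zero, zero_mul, zero_div] at h3
  refine h3.congr fun n => ?_
  rw [← intervalIntegral.integral_sub
    (intervalIntegrable_mul_of_continuous (by fun_prop) hf hx)
    (intervalIntegrable_mul_of_continuous (by fun_prop) hf hx),
    ← intervalIntegral.integral_mul_const, ← intervalIntegral.integral_div]
  refine intervalIntegral.integral_congr fun t _ => ?_
  simp only [Complex.sin]
  push_cast
  ring_nf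

/-- The frequency `2 π n` of the free periodic problem, as a complex number. -/
noncomputable def freq (n : ℕ) : ℂ := ((2 * π * n : ℝ) : ℂ)

theorem freq_mul_im (n : ℕ) (t : ℝ) : (freq n * t).im = 0 := by
  rw [freq, ← Complex.ofReal_mul, Complex.ofReal_im]

theorem norm_sin_freq_le (n : ℕ) (t : ℝ) : ‖Complex.sin (freq n * t)‖ ≤ 1 :=
  (norm_sin_le_exp (freq n * t)).trans (by rw [freq_mul_im, abs_zero, Real.exp_zero])

theorem norm_cos_freq_le (n : ℕ) (t : ℝ) : ‖Complex.cos (freq n * t)‖ ≤ 1 :=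
  (norm_cos_le_exp (freq n * t)).trans (by rw [freq_mul_im, abs_zero, Real.exp_zero])

theorem four_pi_mul_eq (n : ℕ) (t : ℝ) : ((4 * π * n * t : ℝ) : ℂ) = 2 * (freq n * t) := by
  rw [freq]; push_cast; ring

theorem weakLimit_sin_sq : WeakLimit (fun n t => Complex.sin (freq n * t) ^ 2) (1 / 2) := by
  refine ⟨fun n => by fun_prop, fun n t => ?_, fun f hf x hx => ?_⟩
  · rw [norm_pow]; exact pow_le_one₀ (norm_nonneg _) (norm_sin_freq_le n t)
  · have h := ((tendsto_integral_cos_mul hf hx).const_sub (∫ t in (0 : ℝ)..x, f t)).div_const 2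
    rw [sub_zero, div_eq_inv_mul, inv_eq_one_div] at h
    refine h.congr fun n => ?_
    rw [← intervalIntegral.integral_sub (intervalIntegrable_zero_of_mem hf hx)
      (intervalIntegrable_mul_of_continuous (by fun_prop) hf hx), ← intervalIntegral.integral_div]
    refine intervalIntegral.integral_congr fun t _ => ?_
    simp only [four_pi_mul_eq, Complex.cos_two_mul, Complex.cos_sq']
    ring

theorem weakLimit_cos_sq : WeakLimit (fun n t => Complex.cos (freq n * t) ^ 2) (1 / 2) := by
  refine ⟨fun n => by fun_prop, fun n t => ?_, fun f hf x hx => ?_⟩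
  · rw [norm_pow]; exact pow_le_one₀ (norm_nonneg _) (norm_cos_freq_le n t)
  · have h := ((tendsto_integral_cos_mul hf hx).const_add (∫ t in (0 : ℝ)..x, f t)).div_const 2
    rw [add_zero, div_eq_inv_mul, inv_eq_one_div] at h
    refine h.congr fun n => ?_
    rw [← intervalIntegral.integral_add (intervalIntegrable_zero_of_mem hf hx)
      (intervalIntegrable_mul_of_continuous (by fun_prop) hf hx), ← intervalIntegral.integral_div]
    refine intervalIntegral.integral_congr fun t _ => ?_
    simp only [four_pi_mul_eq, Complex.cos_two_mul]
    ring

theorem weakLimit_sin_mul_cos :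
    WeakLimit (fun n t => Complex.sin (freq n * t) * Complex.cos (freq n * t)) 0 := by
  refine ⟨fun n => by fun_prop, fun n t => ?_, fun f hf x hx => ?_⟩
  · rw [norm_mul]
    exact mul_le_one₀ (norm_sin_freq_le n t) (norm_nonneg _) (norm_cos_freq_le n t)
  · have h := (tendsto_integral_sin_mul hf hx).div_const 2
    rw [zero_div] at h
    rw [zero_mul]
    refine h.congr fun n => ?_
    rw [← intervalIntegral.integral_div]
    refine intervalIntegral.integral_congr fun t _ => ?_
    simp only [four_pi_mul_eq, Complex.sin_two_mul]
    ring

/-- The iterated integral `∫₀¹ f(t) ∫₀ᵗ g`. -/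
noncomputable def iterInt (f g : ℝ → ℂ) : ℂ :=
  ∫ t in (0 : ℝ)..1, f t * ∫ u in (0 : ℝ)..t, g u

theorem isPrimitive_integral {g : ℝ → ℂ} (hg : IntervalIntegrable g volume 0 1) :
    IsPrimitive (fun t => ∫ u in (0 : ℝ)..t, g u) g := ⟨hg, by simp⟩

theorem intervalIntegrable_iter {f g : ℝ → ℂ} (hf : IntervalIntegrable f volume 0 1)
    (hg : IntervalIntegrable g volume 0 1) :
    IntervalIntegrable (fun t => f t * ∫ u in (0 : ℝ)..t, g u) volume 0 1 :=
  IsPrimitive.mul_continuousOn hf (isPrimitive_integral hg).continuousOn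

theorem iterInt_add_swap {f g : ℝ → ℂ} (hf : IntervalIntegrable f volume 0 1)
    (hg : IntervalIntegrable g volume 0 1) :
    iterInt f g + iterInt g f = (∫ t in (0 : ℝ)..1, f t) * ∫ t in (0 : ℝ)..1, g t := by
  have h := ((isPrimitive_integral hf).mul (isPrimitive_integral hg)).2 1 (by simp)
  simp only [intervalIntegral.integral_same, mul_zero, zero_add] at h
  rw [h, iterInt, iterInt, ← intervalIntegral.integral_add (intervalIntegrable_iter hf hg)
    (intervalIntegrable_iter hg hf)]
  simp only [mul_comm (g _)]

/-- Weak convergence of the weights passes to iterated integrals, by dominated convergence for the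
inner integral. -/
theorem WeakLimit.tendsto_iterInt {α γ : ℕ → ℝ → ℂ} {a c : ℂ} (hα : WeakLimit α a)
    (hγ : WeakLimit γ c) {f g : ℝ → ℂ} (hf : IntervalIntegrable f volume 0 1)
    (hg : IntervalIntegrable g volume 0 1) :
    Tendsto (fun n => iterInt (fun t => α n t * f t) (fun t => γ n t * g t)) atTop
      (𝓝 (a * c * iterInt f g)) := by
  have h1 : (1 : ℝ) ∈ Icc (0 : ℝ) 1 := by simp
  have hγg : ∀ n, IntervalIntegrable (fun t => γ n t * g t) volume 0 1 := fun n =>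
    intervalIntegrable_mul_of_continuous (hγ.1 n) hg h1
  have hαf : ∀ n, IntervalIntegrable (fun t => α n t * f t) volume 0 1 := fun n =>
    intervalIntegrable_mul_of_continuous (hα.1 n) hf h1
  -- the inner integral may be replaced by its limit
  have hlim : Tendsto (fun n => ∫ t in (0 : ℝ)..1, α n t * f t *
      ((∫ u in (0 : ℝ)..t, γ n u * g u) - c * ∫ u in (0 : ℝ)..t, g u)) atTop
      (𝓝 (∫ t in (0 : ℝ)..1, (0 : ℂ))) := by
    refine intervalIntegral.tendsto_integral_filter_of_dominated_convergence
      (fun t => ‖f t‖ * ((1 + ‖c‖) * ∫ u in (0 : ℝ)..1, ‖g u‖)) (Eventually.of_forall fun n => ?_)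
      (Eventually.of_forall fun n => ae_of_all _ fun t ht => ?_) (hf.norm.mul_const _)
      (ae_of_all _ fun t ht => ?_)
    · have hm : IntervalIntegrable (fun t => α n t * f t *
          ((∫ u in (0 : ℝ)..t, γ n u * g u) - c * ∫ u in (0 : ℝ)..t, g u)) volume 0 1 :=
        IsPrimitive.mul_continuousOn (hαf n) ((isPrimitive_integral (hγg n)).continuousOn.sub
          (continuousOn_const.mul (isPrimitive_integral hg).continuousOn))
      exact hm.aestronglyMeasurable_restrict_uIoc
    · rw [uIoc_of_le zero_le_one] at ht
      have ht' : t ∈ Icc (0 : ℝ) 1 := Ioc_subset_Icc_self ht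
      have e1 := norm_integral_mul_le hg ht' (u := γ n) (C := 1) (fun u _ => hγ.2.1 n u) zero_le_one
      have e2 := norm_integral_mul_le hg ht' (u := fun _ => 1) (C := 1) (by simp) zero_le_one
      simp only [mul_one, mul_comm (g _) (γ n _)] at e1 e2
      rw [norm_mul, norm_mul]
      refine mul_le_mul (mul_le_of_le_one_left (norm_nonneg _) (hα.2.1 n t)) ?_ (norm_nonneg _)
        (norm_nonneg _)
      refine (norm_sub_le _ _).trans ?_
      rw [norm_mul, add_mul, one_mul]
      exact add_le_add e1 (mul_le_mul_of_nonneg_left e2 (norm_nonneg _))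
    · rw [uIoc_of_le zero_le_one] at ht
      have e := ((hγ.2.2 g hg t (Ioc_subset_Icc_self ht)).sub_const (c * ∫ u in (0 : ℝ)..t, g u))
      rw [sub_self] at e
      refine squeeze_zero_norm (a := fun n => ‖f t‖ * ‖(∫ u in (0 : ℝ)..t, γ n u * g u) -
        c * ∫ u in (0 : ℝ)..t, g u‖) (fun n => ?_) (by simpa using e.norm.const_mul ‖f t‖)
      rw [norm_mul, norm_mul]
      exact mul_le_mul_of_nonneg_right (mul_le_of_le_one_left (norm_nonneg _) (hα.2.1 n t))
        (norm_nonneg _)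
  rw [intervalIntegral.integral_zero] at hlim
  have hout := (hα.2.2 _ (intervalIntegrable_iter hf hg) 1 h1).const_mul c
  have h := hlim.add hout
  rw [zero_add] at h
  convert! h using 2 with n
  · rw [← intervalIntegral.integral_const_mul, ← intervalIntegral.integral_add]
    · refine intervalIntegral.integral_congr fun t _ => ?_
      simp only
      ring
    · exact IsPrimitive.mul_continuousOn (hαf n) ((isPrimitive_integral (hγg n)).continuousOn.sub
        (continuousOn_const.mul (isPrimitive_integral hg).continuousOn))
    · exact (intervalIntegrable_mul_of_continuous (hα.1 n)
        (intervalIntegrable_iter hf hg) h1).const_mul c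
  · rw [iterInt]; ring

/-! ### Asymptotics of the characteristic determinant near the free eigenvalues -/

theorem sin_freq (n : ℕ) : Complex.sin (freq n) = 0 := by
  rw [freq, show ((2 * π * n : ℝ) : ℂ) = (n : ℂ) * (2 * π) by push_cast; ring]
  simpa using Complex.sin_nat_mul_two_pi_sub 0 n

theorem cos_freq (n : ℕ) : Complex.cos (freq n) = 1 := by
  rw [freq, show ((2 * π * n : ℝ) : ℂ) = (n : ℂ) * (2 * π) by push_cast; ring]
  exact Complex.cos_nat_mul_two_pi n

theorem sin_freq_one_sub (n : ℕ) (t : ℝ) :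
    Complex.sin (freq n * ((1 : ℝ) - t)) = -Complex.sin (freq n * t) := by
  rw [Complex.ofReal_one, mul_sub, mul_one, Complex.sin_sub, sin_freq, cos_freq]
  ring

theorem cos_freq_one_sub (n : ℕ) (t : ℝ) :
    Complex.cos (freq n * ((1 : ℝ) - t)) = Complex.cos (freq n * t) := by
  rw [Complex.ofReal_one, mul_sub, mul_one, Complex.cos_sub, sin_freq, cos_freq]
  ring

theorem norm_freq (n : ℕ) : ‖freq n‖ = 2 * π * n := by
  rw [freq, Complex.norm_real, Real.norm_of_nonneg (by positivity)]

theorem freq_ne_zero {n : ℕ} (hn : 1 ≤ n) : freq n ≠ 0 := by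
  rw [← norm_pos_iff, norm_freq]
  have : (1 : ℝ) ≤ n := by exact_mod_cast hn
  positivity

theorem freq_im (n : ℕ) : (freq n).im = 0 := Complex.ofReal_im _

theorem integral_sin_mul_cos_freq {n : ℕ} (hn : 1 ≤ n) :
    ∫ t in (0 : ℝ)..1, Complex.sin (freq n * t) * Complex.cos (freq n * t) = 0 := by
  have hd : ∀ t : ℝ, HasDerivAt (fun t : ℝ => Complex.sin (freq n * t) ^ 2)
      (2 * freq n * (Complex.sin (freq n * t) * Complex.cos (freq n * t))) t := fun t => by
    have h1 : HasDerivAt (fun t : ℝ => freq n * (t : ℂ)) (freq n) t := by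
      simpa using (Complex.ofRealCLM.hasDerivAt (x := t)).const_mul (freq n)
    refine (((Complex.hasDerivAt_sin _).comp t h1).pow 2).congr_deriv ?_
    simp only [Function.comp_apply]
    ring
  have h := (IsPrimitive.of_hasDerivAt hd (by fun_prop)).2 1 (by simp)
  rw [intervalIntegral.integral_const_mul] at h
  simpa [sin_freq, freq_ne_zero hn] using h

theorem iterInt_sub_const_mul {f₁ f₂ g₁ g₂ : ℝ → ℂ} (hf₁ : IntervalIntegrable f₁ volume 0 1)
    (hf₂ : IntervalIntegrable f₂ volume 0 1) (hg₁ : IntervalIntegrable g₁ volume 0 1)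
    (hg₂ : IntervalIntegrable g₂ volume 0 1) (τ : ℂ) :
    iterInt (fun t => f₁ t - τ * f₂ t) (fun t => g₁ t - τ * g₂ t) =
      iterInt f₁ g₁ - τ * (iterInt f₁ g₂ + iterInt f₂ g₁) + τ ^ 2 * iterInt f₂ g₂ := by
  simp only [iterInt]
  rw [← intervalIntegral.integral_add (intervalIntegrable_iter hf₁ hg₂)
      (intervalIntegrable_iter hf₂ hg₁), ← intervalIntegral.integral_const_mul,
    ← intervalIntegral.integral_const_mul, ← intervalIntegral.integral_sub
      (intervalIntegrable_iter hf₁ hg₁) (((intervalIntegrable_iter hf₁ hg₂).add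
      (intervalIntegrable_iter hf₂ hg₁)).const_mul τ), ← intervalIntegral.integral_add
      ((intervalIntegrable_iter hf₁ hg₁).sub (((intervalIntegrable_iter hf₁ hg₂).add
      (intervalIntegrable_iter hf₂ hg₁)).const_mul τ))
      ((intervalIntegrable_iter hf₂ hg₂).const_mul (τ ^ 2))]
  refine intervalIntegral.integral_congr fun t ht => ?_
  rw [uIcc_of_le zero_le_one] at ht
  rw [intervalIntegral.integral_sub (intervalIntegrable_zero_of_mem hg₁ ht)
    ((intervalIntegrable_zero_of_mem hg₂ ht).const_mul τ), intervalIntegral.integral_const_mul]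
  ring

theorem WeakLimit.integral_shift {q : ℝ → ℂ} (hq : IntervalIntegrable q volume 0 1)
    {α : ℕ → ℝ → ℂ} {a : ℂ} (hα : WeakLimit α a) (n : ℕ) (τ : ℂ) :
    ∫ t in (0 : ℝ)..1, α n t * (q t - τ) =
      (∫ t in (0 : ℝ)..1, α n t * q t) - τ * ∫ t in (0 : ℝ)..1, α n t := by
  rw [← intervalIntegral.integral_const_mul, ← intervalIntegral.integral_sub
    (intervalIntegrable_mul_of_continuous (hα.1 n) hq (by simp))
    (((hα.1 n).intervalIntegrable _ _).const_mul _)]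
  refine intervalIntegral.integral_congr fun t _ => ?_
  ring

theorem WeakLimit.exists_integral_shift_le {q : ℝ → ℂ} (hq : IntervalIntegrable q volume 0 1)
    (hq0 : ∫ t in (0 : ℝ)..1, q t = 0) {α : ℕ → ℝ → ℂ} {a : ℂ} (hα : WeakLimit α a) :
    ∃ δ : ℕ → ℝ, Tendsto δ atTop (𝓝 0) ∧ ∀ n τ,
      ‖(∫ t in (0 : ℝ)..1, α n t * (q t - τ)) + a * τ‖ ≤ δ n * (1 + ‖τ‖) ^ 2 := by
  have h1 := hα.2.2 q hq 1 (by simp)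
  have h2 := (hα.2.2 (fun _ => 1) (by simp) 1 (by simp)).sub_const a
  simp only [mul_one, intervalIntegral.integral_const, sub_zero, one_smul, sub_self] at h2
  rw [hq0, mul_zero] at h1
  refine ⟨_, by simpa using h1.norm.add h2.norm, fun n τ => ?_⟩
  rw [hα.integral_shift hq]
  have e : (∫ t in (0 : ℝ)..1, α n t * q t) - τ * (∫ t in (0 : ℝ)..1, α n t) + a * τ =
    (∫ t in (0 : ℝ)..1, α n t * q t) - τ * ((∫ t in (0 : ℝ)..1, α n t) - a) := by ring
  rw [e]
  refine (norm_sub_le _ _).trans ?_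
  rw [norm_mul]
  set A := ‖∫ t in (0 : ℝ)..1, α n t * q t‖
  set B := ‖(∫ t in (0 : ℝ)..1, α n t) - a‖
  have hA : 0 ≤ A := norm_nonneg _
  have hB : 0 ≤ B := norm_nonneg _
  nlinarith [norm_nonneg τ, mul_nonneg hA (norm_nonneg τ), mul_nonneg hB (norm_nonneg τ),
    mul_nonneg hA (sq_nonneg ‖τ‖), mul_nonneg hB (sq_nonneg ‖τ‖)]

/-- Second-order terms for the potential `q - τ`: since `q` has mean zero, only the constant part
`τ` contributes in the limit. -/
theorem WeakLimit.exists_iterInt_shift_le {q : ℝ → ℂ} (hq : IntervalIntegrable q volume 0 1)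
    (hq0 : ∫ t in (0 : ℝ)..1, q t = 0) {α γ : ℕ → ℝ → ℂ} {a c : ℂ} (hα : WeakLimit α a)
    (hγ : WeakLimit γ c) :
    ∃ δ : ℕ → ℝ, Tendsto δ atTop (𝓝 0) ∧ ∀ n τ,
      ‖iterInt (fun t => α n t * (q t - τ)) (fun t => γ n t * (q t - τ)) - a * c * τ ^ 2 / 2‖ ≤
        δ n * (1 + ‖τ‖) ^ 2 := by
  have h1i : IntervalIntegrable (fun _ : ℝ => (1 : ℂ)) volume 0 1 := by simp
  have h11 := hα.tendsto_iterInt hγ hq hq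
  have h12 := hα.tendsto_iterInt hγ hq h1i
  have h21 := hα.tendsto_iterInt hγ h1i hq
  have h22 := hα.tendsto_iterInt hγ h1i h1i
  have e11 := iterInt_add_swap hq hq
  have e12 := iterInt_add_swap hq h1i
  have e22 := iterInt_add_swap h1i h1i
  rw [hq0] at e11 e12
  rw [mul_zero] at e11
  rw [zero_mul] at e12
  simp only [intervalIntegral.integral_const, sub_zero, one_smul, mul_one] at e22
  rw [show iterInt q q = 0 by linear_combination e11 / 2, mul_zero] at h11
  have hs := h12.add h21
  rw [← mul_add, e12, mul_zero] at hs
  rw [show iterInt (fun _ : ℝ => (1 : ℂ)) (fun _ : ℝ => (1 : ℂ)) = 1 / 2 by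
    linear_combination e22 / 2] at h22
  have h22' := h22.sub_const (a * c * (1 / 2))
  rw [sub_self] at h22'
  refine ⟨_, by simpa only [norm_zero, add_zero] using (h11.norm.add hs.norm).add h22'.norm,
    fun n τ => ?_⟩
  have hm : ∀ {α : ℕ → ℝ → ℂ} {a : ℂ}, WeakLimit α a → ∀ {f : ℝ → ℂ},
      IntervalIntegrable f volume 0 1 → IntervalIntegrable (fun t => α n t * f t) volume 0 1 :=
    fun h _ hf => intervalIntegrable_mul_of_continuous (h.1 n) hf (by simp)
  have e : ∀ α : ℕ → ℝ → ℂ, (fun t => α n t * (q t - τ)) =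
      fun t => α n t * q t - τ * (α n t * 1) := fun α => by funext t; ring
  rw [e α, e γ, iterInt_sub_const_mul (hm hα hq) (hm hα h1i) (hm hγ hq) (hm hγ h1i)]
  set A := iterInt (fun t => α n t * q t) (fun t => γ n t * q t)
  set B := iterInt (fun t => α n t * q t) (fun t => γ n t * 1) +
    iterInt (fun t => α n t * 1) (fun t => γ n t * q t)
  set D := iterInt (fun t => α n t * 1) (fun t => γ n t * 1)
  rw [show A - τ * B + τ ^ 2 * D - a * c * τ ^ 2 / 2 =
    A - τ * B + τ ^ 2 * (D - a * c * (1 / 2)) by ring]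
  refine (norm_add_le _ _).trans ((add_le_add_left (norm_sub_le _ _) _).trans ?_)
  rw [norm_mul, norm_mul, norm_pow]
  have hA : 0 ≤ ‖A‖ := norm_nonneg _
  have hB : 0 ≤ ‖B‖ := norm_nonneg _
  have hD : 0 ≤ ‖D - a * c * (1 / 2)‖ := norm_nonneg _
  nlinarith [norm_nonneg τ, mul_nonneg hA (norm_nonneg τ), mul_nonneg hB (norm_nonneg τ),
    mul_nonneg hD (norm_nonneg τ), mul_nonneg hA (sq_nonneg ‖τ‖), mul_nonneg hB (sq_nonneg ‖τ‖)]

/-- Second-order expansion of a solution at the frequency `freq n`. -/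
theorem IsSolution.second_order {p P y z : ℝ → ℂ} {n : ℕ} (hn : 1 ≤ n) (h : IsSolution P y z)
    (hp : IntervalIntegrable p volume 0 1) (hP : ∀ t, P t = p t - freq n ^ 2) {Q : ℝ}
    (hQ : ∫ t in (0 : ℝ)..1, ‖p t‖ ≤ Q) (hQm : 2 * Q ≤ 2 * π * n)
    (hK : ‖freq n * y 0‖ + ‖z 0‖ ≤ 2 * π * n) (T : ℝ → ℂ)
    (hT : ∀ t : ℝ, freq n * T t = freq n * y 0 * Complex.cos (freq n * t) +
      z 0 * Complex.sin (freq n * t)) {x : ℝ}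
    (hx : x ∈ Icc (0 : ℝ) 1) :
    ‖freq n * y x - (freq n * T x +
      ∫ t in (0 : ℝ)..x, Complex.sin (freq n * (x - t)) * (p t * T t))‖ ≤
      2 * Q ^ 2 / (2 * π * n) := by
  have hm := freq_ne_zero hn
  have hM : (0 : ℝ) < 2 * π * n := by rw [← norm_freq]; exact norm_pos_iff.2 hm
  have hQ0 : 0 ≤ Q := (integral_norm_nonneg p).trans hQ
  have hTc : Continuous T := by
    have : T = fun t : ℝ => (freq n * y 0 * Complex.cos (freq n * t) +
        z 0 * Complex.sin (freq n * t)) / freq n := by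
      funext t; rw [← hT, mul_div_cancel_left₀ _ hm]
    rw [this]
    fun_prop
  have hdiff : ∀ t ∈ Icc (0 : ℝ) 1, ‖y t - T t‖ ≤ 2 * Q / (2 * π * n) := fun t ht => by
    have h1 := (h.norm_sub_free_le hp hP hQ (by rwa [norm_freq]) hm hK ht).2.1
    rw [← hT, ← mul_sub, norm_mul, norm_freq, freq_im, abs_zero, zero_mul, Real.exp_zero, mul_one]
      at h1
    rw [le_div_iff₀ hM, mul_comm]
    refine h1.trans_eq ?_
    field_simp
  have hs : Continuous fun t : ℝ => Complex.sin (freq n * (x - t)) := by fun_prop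
  have h1 := (h.variation_of_constants hP hx).1
  rw [h1, ← hT, add_sub_add_left_eq_sub, ← intervalIntegral.integral_sub
    ((intervalIntegrable_zero_of_mem (IsPrimitive.mul_continuousOn hp h.1.continuousOn)
      hx).continuousOn_mul hs.continuousOn)
    (((intervalIntegrable_zero_of_mem hp hx).mul_continuousOn hTc.continuousOn).continuousOn_mul
      hs.continuousOn)]
  have h2 := norm_integral_mul_le hp hx
    (u := fun t => Complex.sin (freq n * (x - t)) * (y t - T t)) (C := 2 * Q / (2 * π * n))
    (fun t ht => by
      rw [norm_mul]
      refine (mul_le_of_le_one_left (norm_nonneg _) ?_).trans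
        (hdiff t ⟨ht.1, ht.2.trans hx.2⟩)
      have := norm_sin_freq_le n (x - t)
      push_cast at this
      exact this) (by positivity)
  refine (le_of_eq ?_).trans (h2.trans ((mul_le_mul_of_nonneg_right hQ (by positivity)).trans_eq
    (by ring)))
  congr 1
  refine intervalIntegral.integral_congr fun t _ => ?_
  ring

theorem IsSolution.const_mul {p y z : ℝ → ℂ} (h : IsSolution p y z) (c : ℂ) :
    IsSolution p (fun x => c * y x) (fun x => c * z x) :=
  ⟨h.1.const_mul c, (h.2.const_mul c).congr_ae (ae_of_all _ fun _ => mul_left_comm _ _ _)⟩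

/-- A weighted integral of a solution, to second order. -/
theorem IsSolution.integral_second_order {p P y z : ℝ → ℂ} {n : ℕ} (hn : 1 ≤ n)
    (h : IsSolution P y z)
    (hp : IntervalIntegrable p volume 0 1) (hP : ∀ t, P t = p t - freq n ^ 2) {Q : ℝ}
    (hQ : ∫ t in (0 : ℝ)..1, ‖p t‖ ≤ Q) (hQm : 2 * Q ≤ 2 * π * n)
    (hK : ‖freq n * y 0‖ + ‖z 0‖ ≤ 2 * π * n) {T U : ℝ → ℂ} (hTc : Continuous T)
    (hT : ∀ t : ℝ, freq n * T t = freq n * y 0 * Complex.cos (freq n * t) +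
      z 0 * Complex.sin (freq n * t)) (hUc : Continuous U) (hU : ∀ t, ‖U t‖ ≤ 1) :
    ‖(∫ t in (0 : ℝ)..1, U t * p t * (freq n * y t)) -
      (freq n * (∫ t in (0 : ℝ)..1, U t * T t * p t) +
        (iterInt (fun t => U t * Complex.sin (freq n * t) * p t)
          (fun t => Complex.cos (freq n * t) * T t * p t) -
        iterInt (fun t => U t * Complex.cos (freq n * t) * p t)
          (fun t => Complex.sin (freq n * t) * T t * p t)))‖ ≤
      2 * Q ^ 3 / (2 * π * n) := by
  have h1 : (1 : ℝ) ∈ Icc (0 : ℝ) 1 := by simp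
  have hcp : ∀ {V : ℝ → ℂ}, Continuous V → IntervalIntegrable (fun t => V t * p t) volume 0 1 :=
    fun hV => intervalIntegrable_mul_of_continuous hV hp h1
  have hI : ∀ x ∈ Icc (0 : ℝ) 1,
      ∫ t in (0 : ℝ)..x, Complex.sin (freq n * (x - t)) * (p t * T t) =
      Complex.sin (freq n * x) * (∫ t in (0 : ℝ)..x, Complex.cos (freq n * t) * T t * p t) -
      Complex.cos (freq n * x) * ∫ t in (0 : ℝ)..x, Complex.sin (freq n * t) * T t * p t := by
    intro x hx
    rw [← intervalIntegral.integral_const_mul, ← intervalIntegral.integral_const_mul,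
      ← intervalIntegral.integral_sub
        ((intervalIntegrable_mul_of_continuous (by fun_prop) hp hx).const_mul _)
        ((intervalIntegrable_mul_of_continuous (by fun_prop) hp hx).const_mul _)]
    refine intervalIntegral.integral_congr fun t _ => ?_
    simp only [mul_sub, Complex.sin_sub]
    ring
  have hiter1 := intervalIntegrable_iter
    (hcp (V := fun t => U t * Complex.sin (freq n * t)) (by fun_prop))
    (hcp (V := fun t => Complex.cos (freq n * t) * T t) (by fun_prop))
  have hiter2 := intervalIntegrable_iter
    (hcp (V := fun t => U t * Complex.cos (freq n * t)) (by fun_prop))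
    (hcp (V := fun t => Complex.sin (freq n * t) * T t) (by fun_prop))
  have hUT := hcp (V := fun t => U t * T t) (by fun_prop)
  have hUy : IntervalIntegrable (fun t => U t * p t * (freq n * y t)) volume 0 1 :=
    IsPrimitive.mul_continuousOn (hcp hUc) (continuousOn_const.mul h.1.continuousOn)
  have hb := norm_integral_mul_le hp h1
    (u := fun t => U t * (freq n * y t - (freq n * T t +
      ∫ u in (0 : ℝ)..t, Complex.sin (freq n * (t - u)) * (p u * T u))))
    (C := 2 * Q ^ 2 / (2 * π * n)) (fun t ht => by
      rw [norm_mul]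
      exact (mul_le_of_le_one_left (norm_nonneg _) (hU t)).trans
        (h.second_order hn hp hP hQ hQm hK T hT ht)) (by positivity)
  refine (le_of_eq ?_).trans (hb.trans ((mul_le_mul_of_nonneg_right hQ (by positivity)).trans_eq
    (by ring)))
  congr 1
  rw [iterInt, iterInt, ← intervalIntegral.integral_sub hiter1 hiter2,
    ← intervalIntegral.integral_const_mul, ← intervalIntegral.integral_add
    (hUT.const_mul _) (hiter1.sub hiter2),
    ← intervalIntegral.integral_sub hUy ((hUT.const_mul _).add (hiter1.sub hiter2))]
  refine intervalIntegral.integral_congr fun t ht => ?_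
  rw [uIcc_of_le zero_le_one] at ht
  rw [hI t ht]
  ring

theorem integral_norm_sub_const_le {q : ℝ → ℂ} (hq : IntervalIntegrable q volume 0 1) (τ : ℂ) :
    ∫ t in (0 : ℝ)..1, ‖q t - τ‖ ≤ (∫ t in (0 : ℝ)..1, ‖q t‖) + ‖τ‖ := by
  refine (intervalIntegral.integral_mono_on zero_le_one (hq.sub (by simp)).norm
    (hq.norm.add (by simp)) (g := fun t => ‖q t‖ + ‖τ‖) fun t _ => norm_sub_le _ _).trans_eq ?_
  rw [intervalIntegral.integral_add hq.norm (by simp)]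
  simp

/-- The constant `τ` drops out, since `sin` and `cos` are orthogonal. -/
theorem sineCoeff_eq {q : ℝ → ℂ} (hq : IntervalIntegrable q volume 0 1) {n : ℕ}
    (hn : 1 ≤ n) (τ : ℂ) :
    ∫ t in (0 : ℝ)..1, Complex.sin (freq n * t) * Complex.cos (freq n * t) * (q t - τ) =
      sineCoeff q n / 2 := by
  rw [weakLimit_sin_mul_cos.integral_shift hq, integral_sin_mul_cos_freq hn, mul_zero, sub_zero,
    sineCoeff, ← intervalIntegral.integral_div]
  refine intervalIntegral.integral_congr fun t _ => ?_
  simp only [Complex.ofReal_sin, four_pi_mul_eq, Complex.sin_two_mul]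
  ring

section Expansion

variable {q : ℝ → ℂ} (hq : IntervalIntegrable q volume 0 1)

theorem cosSol_expansion {n : ℕ} (hn : 1 ≤ n) {τ : ℂ} {Q : ℝ}
    (hQ : (∫ t in (0 : ℝ)..1, ‖q t‖) + ‖τ‖ ≤ Q) (hQm : 2 * Q ≤ 2 * π * n) :
    ‖freq n ^ 2 * (1 - (cosSol hq (freq n ^ 2 + τ)).extend 1) -
      (freq n * (∫ t in (0 : ℝ)..1, Complex.sin (freq n * t) * Complex.cos (freq n * t) *
          (q t - τ)) +
        (iterInt (fun t => Complex.sin (freq n * t) ^ 2 * (q t - τ))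
          (fun t => Complex.cos (freq n * t) ^ 2 * (q t - τ)) -
        iterInt (fun t => Complex.sin (freq n * t) * Complex.cos (freq n * t) * (q t - τ))
          (fun t => Complex.sin (freq n * t) * Complex.cos (freq n * t) * (q t - τ))))‖ ≤
      2 * Q ^ 3 / (2 * π * n) := by
  have hp : IntervalIntegrable (fun t => q t - τ) volume 0 1 := hq.sub (by simp)
  have hP : ∀ t, q t - (freq n ^ 2 + τ) = (q t - τ) - freq n ^ 2 := fun t => by ring
  have hs := isSolution_cosSol hq (freq n ^ 2 + τ)
  have h := hs.integral_second_order hn hp hP ((integral_norm_sub_const_le hq τ).trans hQ) hQm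
    (by rw [cosSol_zero, cosSol'_zero, mul_one, norm_zero, add_zero, norm_freq])
    (T := fun t => Complex.cos (freq n * t)) (U := fun t => Complex.sin (freq n * t))
    (by fun_prop) (fun t => by rw [cosSol_zero, cosSol'_zero]; ring) (by fun_prop)
    (norm_sin_freq_le n)
  have h1 := (hs.variation_of_constants hP (right_mem_Icc.2 zero_le_one)).1
  simp only [sin_freq_one_sub] at h1
  rw [cosSol_zero, cosSol'_zero, Complex.ofReal_one, mul_one (freq n), cos_freq, zero_mul] at h1
  have e : freq n ^ 2 * (1 - (cosSol hq (freq n ^ 2 + τ)).extend 1) = ∫ t in (0 : ℝ)..1,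
      Complex.sin (freq n * t) * (q t - τ) * (freq n * (cosSol hq (freq n ^ 2 + τ)).extend t) := by
    have : freq n ^ 2 * (1 - (cosSol hq (freq n ^ 2 + τ)).extend 1) =
      -freq n * (freq n * (cosSol hq (freq n ^ 2 + τ)).extend 1 - freq n) := by ring
    rw [this, h1, mul_one, add_zero, add_sub_cancel_left, ← intervalIntegral.integral_const_mul]
    refine intervalIntegral.integral_congr fun t _ => ?_
    ring
  rw [e]
  simpa only [sq, mul_comm (Complex.cos (freq n * _)) (Complex.sin (freq n * _))] using h

theorem sinSol'_expansion {n : ℕ} (hn : 1 ≤ n) {τ : ℂ} {Q : ℝ}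
    (hQ : (∫ t in (0 : ℝ)..1, ‖q t‖) + ‖τ‖ ≤ Q) (hQm : 2 * Q ≤ 2 * π * n) :
    ‖freq n ^ 2 * ((sinSol' hq (freq n ^ 2 + τ)).extend 1 - 1) -
      (freq n * (∫ t in (0 : ℝ)..1, Complex.sin (freq n * t) * Complex.cos (freq n * t) *
          (q t - τ)) +
        (iterInt (fun t => Complex.sin (freq n * t) * Complex.cos (freq n * t) * (q t - τ))
          (fun t => Complex.sin (freq n * t) * Complex.cos (freq n * t) * (q t - τ)) -
        iterInt (fun t => Complex.cos (freq n * t) ^ 2 * (q t - τ))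
          (fun t => Complex.sin (freq n * t) ^ 2 * (q t - τ))))‖ ≤
      2 * Q ^ 3 / (2 * π * n) := by
  have hp : IntervalIntegrable (fun t => q t - τ) volume 0 1 := hq.sub (by simp)
  have hP : ∀ t, q t - (freq n ^ 2 + τ) = (q t - τ) - freq n ^ 2 := fun t => by ring
  have hs := isSolution_sinSol hq (freq n ^ 2 + τ)
  have h := (hs.const_mul (freq n)).integral_second_order hn hp hP
    ((integral_norm_sub_const_le hq τ).trans hQ) hQm
    (by rw [sinSol_zero, sinSol'_zero, mul_zero, mul_zero, norm_zero, zero_add, mul_one, norm_freq])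
    (T := fun t => Complex.sin (freq n * t)) (U := fun t => Complex.cos (freq n * t))
    (by fun_prop) (fun t => by rw [sinSol_zero, sinSol'_zero]; ring) (by fun_prop)
    (norm_cos_freq_le n)
  have h1 := (hs.variation_of_constants hP (right_mem_Icc.2 zero_le_one)).2
  simp only [cos_freq_one_sub] at h1
  rw [sinSol_zero, sinSol'_zero, Complex.ofReal_one, mul_one, cos_freq, mul_zero, zero_mul] at h1
  have e : freq n ^ 2 * ((sinSol' hq (freq n ^ 2 + τ)).extend 1 - 1) = ∫ t in (0 : ℝ)..1,
      Complex.cos (freq n * t) * (q t - τ) *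
        (freq n * (freq n * (sinSol hq (freq n ^ 2 + τ)).extend t)) := by
    rw [h1, mul_one, zero_add, add_sub_cancel_left, ← intervalIntegral.integral_const_mul]
    refine intervalIntegral.integral_congr fun t _ => ?_
    ring
  rw [e]
  simpa only [sq, mul_comm (Complex.cos (freq n * _)) (Complex.sin (freq n * _))] using h

theorem sinSol_expansion {n : ℕ} (hn : 1 ≤ n) {τ : ℂ} {Q : ℝ}
    (hQ : (∫ t in (0 : ℝ)..1, ‖q t‖) + ‖τ‖ ≤ Q) (hQm : 2 * Q ≤ 2 * π * n) :
    ‖freq n ^ 2 * (sinSol hq (freq n ^ 2 + τ)).extend 1 +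
      ∫ t in (0 : ℝ)..1, Complex.sin (freq n * t) ^ 2 * (q t - τ)‖ ≤
      2 * Q ^ 2 / (2 * π * n) := by
  have hp : IntervalIntegrable (fun t => q t - τ) volume 0 1 := hq.sub (by simp)
  have hP : ∀ t, q t - (freq n ^ 2 + τ) = (q t - τ) - freq n ^ 2 := fun t => by ring
  have hs := isSolution_sinSol hq (freq n ^ 2 + τ)
  have hQ' := (integral_norm_sub_const_le hq τ).trans hQ
  have hQ0 : 0 ≤ Q := (integral_norm_nonneg _).trans hQ'
  have h01 : (1 : ℝ) ∈ Icc (0 : ℝ) 1 := by simp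
  have h1 := (hs.variation_of_constants hP h01).1
  simp only [sin_freq_one_sub] at h1
  rw [sinSol_zero, sinSol'_zero, Complex.ofReal_one, mul_one, sin_freq, mul_zero, zero_mul] at h1
  have hb := norm_integral_mul_le hp h01 (u := fun t => Complex.sin (freq n * t) *
      (freq n * (sinSol hq (freq n ^ 2 + τ)).extend t - Complex.sin (freq n * t)))
    (C := 2 * Q / (2 * π * n)) (fun t ht => by
      have h := (hs.norm_sub_free_le hp hP hQ' (by rwa [norm_freq]) (freq_ne_zero hn)
        (K := 1) (by rw [sinSol_zero, sinSol'_zero]; simp) ht).2.1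
      rw [sinSol_zero, sinSol'_zero, mul_zero, zero_mul, zero_add, one_mul, norm_freq, freq_im,
        abs_zero, zero_mul, Real.exp_zero, mul_one, mul_one] at h
      rw [norm_mul]
      exact (mul_le_of_le_one_left (norm_nonneg _) (norm_sin_freq_le n t)).trans h) (by positivity)
  refine (le_of_eq ?_).trans (hb.trans ((mul_le_mul_of_nonneg_right hQ' (by positivity)).trans_eq
    (by ring)))
  rw [← norm_neg]
  congr 1
  rw [show ∀ w, freq n ^ 2 * w = freq n * (freq n * w) from fun w => by ring, h1, mul_zero,
    add_zero, zero_add, ← intervalIntegral.integral_const_mul,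
    ← intervalIntegral.integral_add, ← intervalIntegral.integral_neg]
  · refine intervalIntegral.integral_congr fun t _ => ?_
    ring
  · exact ((IsPrimitive.mul_continuousOn hp
      (C01.continuous_extend _).continuousOn).continuousOn_mul
      (Continuous.continuousOn (by fun_prop))).const_mul _
  · exact intervalIntegrable_mul_of_continuous (by fun_prop) hp h01

/-- Near the double free eigenvalue `(2 π n) ^ 2` the rescaled characteristic determinant is a
quadratic polynomial in the displacement `τ`, up to the sine coefficient of the potential. The
cubic error term keeps the expansion meaningful for `τ` up to a small multiple of `n`. -/
theorem exists_charDet_expansion (hq0 : ∫ t in (0 : ℝ)..1, q t = 0) (β₁ β₂ : ℂ) :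
    ∃ (δ : ℕ → ℝ) (C : ℝ), Tendsto δ atTop (𝓝 0) ∧ 0 ≤ C ∧ ∀ n : ℕ, 1 ≤ n → ∀ τ : ℂ,
      2 * ((∫ t in (0 : ℝ)..1, ‖q t‖) + ‖τ‖) ≤ 2 * π * n →
      ‖freq n ^ 2 * charDet hq β₁ β₂ (freq n ^ 2 + τ) -
        ((1 - β₁) * τ ^ 2 / 8 + β₂ * τ / 2 + (1 + β₁) / 2 * (freq n * sineCoeff q n))‖ ≤
        δ n * (1 + ‖τ‖) ^ 2 + C * (1 + ‖τ‖) ^ 3 / n := by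
  obtain ⟨δ₁, h₁, H₁⟩ := weakLimit_sin_sq.exists_iterInt_shift_le hq hq0 weakLimit_cos_sq
  obtain ⟨δ₂, h₂, H₂⟩ := weakLimit_cos_sq.exists_iterInt_shift_le hq hq0 weakLimit_sin_sq
  obtain ⟨δ₃, h₃, H₃⟩ := weakLimit_sin_mul_cos.exists_iterInt_shift_le hq hq0 weakLimit_sin_mul_cos
  obtain ⟨δ₄, h₄, H₄⟩ := weakLimit_sin_sq.exists_integral_shift_le hq hq0
  set q₁ := ∫ t in (0 : ℝ)..1, ‖q t‖
  have hq₁ : 0 ≤ q₁ := integral_norm_nonneg q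
  refine ⟨fun n => (δ₁ n + δ₃ n) + ‖β₁‖ * (δ₃ n + δ₂ n) + ‖β₂‖ * δ₄ n,
    2 * (1 + ‖β₁‖) * (q₁ + 1) ^ 3 + 2 * ‖β₂‖ * (q₁ + 1) ^ 2, ?_, by positivity, ?_⟩
  · simpa using ((h₁.add h₃).add ((h₃.add h₂).const_mul ‖β₁‖)).add (h₄.const_mul ‖β₂‖)
  intro n hn τ hτ
  have E₁ := cosSol_expansion hq hn le_rfl hτ
  have E₂ := sinSol'_expansion hq hn le_rfl hτ
  have E₃ := sinSol_expansion hq hn le_rfl hτ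
  rw [sineCoeff_eq hq hn] at E₁ E₂
  replace H₁ := H₁ n τ
  replace H₂ := H₂ n τ
  replace H₃ := H₃ n τ
  replace H₄ := H₄ n τ
  have hn1 : (1 : ℝ) ≤ n := by exact_mod_cast hn
  set D := (1 + ‖τ‖)
  have hD1 : 1 ≤ D := le_add_of_nonneg_right (norm_nonneg _)
  have hQD : q₁ + ‖τ‖ ≤ (q₁ + 1) * D := by
    have := norm_nonneg τ
    simp only [D]
    nlinarith
  have hQ0 : 0 ≤ q₁ + ‖τ‖ := by positivity
  have hpi : (n : ℝ) ≤ 2 * π * n := by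
    have := Real.pi_gt_three
    nlinarith
  have hQ3 : 2 * (q₁ + ‖τ‖) ^ 3 / (2 * π * n) ≤ 2 * (q₁ + 1) ^ 3 * D ^ 3 / n := by
    rw [mul_assoc 2 ((q₁ + 1) ^ 3), ← mul_pow]
    gcongr
  have hQ2 : 2 * (q₁ + ‖τ‖) ^ 2 / (2 * π * n) ≤ 2 * (q₁ + 1) ^ 2 * D ^ 3 / n := by
    have h1 : (q₁ + ‖τ‖) ^ 2 ≤ (q₁ + 1) ^ 2 * D ^ 3 := by
      refine (pow_le_pow_left₀ hQ0 hQD 2).trans ?_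
      rw [mul_pow]
      exact mul_le_mul_of_nonneg_left (pow_le_pow_right₀ hD1 (by norm_num)) (by positivity)
    rw [mul_assoc 2 ((q₁ + 1) ^ 2)]
    gcongr
  replace E₁ := E₁.trans hQ3
  replace E₂ := E₂.trans hQ3
  replace E₃ := E₃.trans hQ2
  rw [charDet_eq]
  generalize iterInt (fun t => Complex.sin (freq n * t) ^ 2 * (q t - τ))
    (fun t => Complex.cos (freq n * t) ^ 2 * (q t - τ)) = I₁ at *
  generalize iterInt (fun t => Complex.cos (freq n * t) ^ 2 * (q t - τ))
    (fun t => Complex.sin (freq n * t) ^ 2 * (q t - τ)) = I₂ at *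
  generalize iterInt (fun t => Complex.sin (freq n * t) * Complex.cos (freq n * t) * (q t - τ))
    (fun t => Complex.sin (freq n * t) * Complex.cos (freq n * t) * (q t - τ)) = I₃ at *
  generalize ∫ t in (0 : ℝ)..1, Complex.sin (freq n * t) ^ 2 * (q t - τ) = I₄ at *
  generalize (cosSol hq (freq n ^ 2 + τ)).extend 1 = c at *
  generalize (sinSol' hq (freq n ^ 2 + τ)).extend 1 = s' at *
  generalize (sinSol hq (freq n ^ 2 + τ)).extend 1 = s at *
  have e : freq n ^ 2 * (1 - c + β₁ * (s' - 1) + β₂ * s) -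
      ((1 - β₁) * τ ^ 2 / 8 + β₂ * τ / 2 + (1 + β₁) / 2 * (freq n * sineCoeff q n)) =
      (freq n ^ 2 * (1 - c) - (freq n * (sineCoeff q n / 2) + (I₁ - I₃))) +
      β₁ * (freq n ^ 2 * (s' - 1) - (freq n * (sineCoeff q n / 2) + (I₃ - I₂))) +
      β₂ * (freq n ^ 2 * s + I₄) + (I₁ - 1 / 2 * (1 / 2) * τ ^ 2 / 2)
      - (I₃ - 0 * 0 * τ ^ 2 / 2) + β₁ * (I₃ - 0 * 0 * τ ^ 2 / 2)
      - β₁ * (I₂ - 1 / 2 * (1 / 2) * τ ^ 2 / 2) - β₂ * (I₄ + 1 / 2 * τ) := by ring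
  rw [e]
  have t1 := norm_mul_le_of_le (le_refl ‖β₁‖) E₂
  have t2 := norm_mul_le_of_le (le_refl ‖β₂‖) E₃
  have t3 := norm_mul_le_of_le (le_refl ‖β₁‖) H₃
  have t4 := norm_mul_le_of_le (le_refl ‖β₁‖) H₂
  have t5 := norm_mul_le_of_le (le_refl ‖β₂‖) H₄
  refine (norm_sub_le_of_le (norm_sub_le_of_le (norm_add_le_of_le (norm_sub_le_of_le
    (norm_add_le_of_le (norm_add_le_of_le (norm_add_le_of_le E₁ t1) t2) H₁) H₃) t3) t4)
    t5).trans_eq ?_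
  ring

end Expansion

/-! ### Simple zeros of perturbed functions -/

/-- Stability of a simple zero `τ₀` of `P`: a holomorphic function uniformly close to `P` near `τ₀`
has exactly one zero near `τ₀`, and that zero is simple. It is the fixed point of the simplified
Newton map `τ ↦ τ - F τ / P' τ₀`, which Cauchy's estimate makes a contraction. -/
theorem exists_simple_zero {P : ℂ → ℂ} (hP : Differentiable ℂ P) {τ₀ : ℂ}
    (h0 : P τ₀ = 0) (h1 : deriv P τ₀ ≠ 0) {r₀ : ℝ} (hr₀ : 0 < r₀) :
    ∃ r ε : ℝ, 0 < r ∧ r ≤ r₀ ∧ 0 < ε ∧ ∀ F : ℂ → ℂ, Differentiable ℂ F →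
      (∀ τ ∈ Metric.closedBall τ₀ (2 * r), ‖F τ - P τ‖ ≤ ε) →
      ∃ ρ ∈ Metric.closedBall τ₀ r, F ρ = 0 ∧ deriv F ρ ≠ 0 ∧
        ‖ρ - τ₀‖ ≤ 2 * ‖F τ₀‖ / ‖deriv P τ₀‖ ∧
        ∀ τ ∈ Metric.closedBall τ₀ r, F τ = 0 → τ = ρ := by
  set a := deriv P τ₀
  have ha : 0 < ‖a‖ := norm_pos_iff.2 h1
  have hc : ContinuousAt (deriv P) τ₀ := (hP.deriv).continuous.continuousAt
  obtain ⟨r₁, hr₁, H₁⟩ := Metric.continuousAt_iff.1 hc (‖a‖ / 4) (by positivity)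
  set r := min r₀ (r₁ / 2)
  have hr : 0 < r := lt_min hr₀ (by positivity)
  refine ⟨r, ‖a‖ * r / 4, hr, min_le_left _ _, by positivity, fun F hF hFP => ?_⟩
  have hdP : ∀ τ ∈ Metric.closedBall τ₀ r, ‖deriv P τ - a‖ ≤ ‖a‖ / 4 := fun τ hτ => by
    have := H₁ (x := τ) ((Metric.mem_closedBall.1 hτ).trans_lt
      ((min_le_right _ _).trans_lt (by linarith)))
    rw [dist_eq_norm] at this
    exact this.le
  have hdF : ∀ τ ∈ Metric.closedBall τ₀ r, ‖deriv F τ - a‖ ≤ ‖a‖ / 2 := fun τ hτ => by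
    have h2 : ‖deriv (fun w => F w - P w) τ‖ ≤ ‖a‖ * r / 4 / r := by
      refine Complex.norm_deriv_le_of_forall_mem_sphere_norm_le hr
        (hF.sub hP).diffContOnCl fun w hw => hFP w ?_
      rw [Metric.mem_closedBall] at hτ ⊢
      have := dist_triangle w τ τ₀
      rw [Metric.mem_sphere] at hw
      linarith
    have e : deriv (fun w => F w - P w) τ = deriv F τ - deriv P τ :=
      ((hF τ).hasDerivAt.sub (hP τ).hasDerivAt).deriv
    rw [e, show ‖a‖ * r / 4 / r = ‖a‖ / 4 by field_simp] at h2
    have := norm_add_le (deriv F τ - deriv P τ) (deriv P τ - a)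
    rw [sub_add_sub_cancel] at this
    linarith [hdP τ hτ]
  set g : ℂ → ℂ := fun τ => τ - F τ / a
  have hg : ∀ τ, HasDerivAt g (1 - deriv F τ / a) τ := fun τ =>
    (hasDerivAt_id τ).sub ((hF τ).hasDerivAt.div_const a)
  have hlip : ∀ x ∈ Metric.closedBall τ₀ r, ∀ y ∈ Metric.closedBall τ₀ r,
      ‖g y - g x‖ ≤ 1 / 2 * ‖y - x‖ := fun x hx y hy => by
    refine (convex_closedBall τ₀ r).norm_image_sub_le_of_norm_hasDerivWithin_le
      (fun w _ => (hg w).hasDerivWithinAt) (fun w hw => ?_) hx hy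
    rw [show 1 - deriv F w / a = -((deriv F w - a) / a) by field_simp; ring, norm_neg, norm_div,
      div_le_iff₀ ha]
    linarith [hdF w hw]
  have hgc : ∀ τ, g τ = τ ↔ F τ = 0 := fun τ => by simp [g, h1]
  have hτ₀ : τ₀ ∈ Metric.closedBall τ₀ r := Metric.mem_closedBall_self hr.le
  have hgτ₀ : ‖g τ₀ - τ₀‖ = ‖F τ₀‖ / ‖a‖ := by simp [g]
  have hF0 : ‖F τ₀‖ ≤ ‖a‖ * r / 4 := by
    simpa [h0] using hFP τ₀ (Metric.mem_closedBall_self (by positivity))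
  have hmaps : MapsTo g (Metric.closedBall τ₀ r) (Metric.closedBall τ₀ r) := fun τ hτ => by
    have h3 := hlip τ₀ hτ₀ τ hτ
    rw [mem_closedBall_iff_norm] at hτ ⊢
    have h4 := norm_add_le (g τ - g τ₀) (g τ₀ - τ₀)
    rw [sub_add_sub_cancel, hgτ₀] at h4
    have h5 : ‖F τ₀‖ / ‖a‖ ≤ r / 4 := by
      rw [div_le_iff₀ ha]; linarith
    linarith
  have hcontr : ContractingWith (1 / 2) (hmaps.restrict g _ _) := by
    refine ⟨by norm_num, LipschitzWith.of_dist_le_mul fun x y => ?_⟩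
    have := hlip y y.2 x x.2
    simpa [Subtype.dist_eq, dist_eq_norm] using this
  obtain ⟨ρ, hρ, hfix, -⟩ := hcontr.exists_fixedPoint' Metric.isClosed_closedBall.isComplete hmaps
    hτ₀ (edist_ne_top _ _)
  have hgρ : g ρ = ρ := hfix
  refine ⟨ρ, hρ, (hgc ρ).1 hgρ, fun hd => ?_, ?_, fun τ hτ hFτ => ?_⟩
  · have := hdF ρ hρ
    rw [hd, zero_sub, norm_neg] at this
    linarith
  · have h3 := hlip τ₀ hτ₀ ρ hρ
    have h4 := norm_add_le (g ρ - g τ₀) (g τ₀ - τ₀)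
    rw [sub_add_sub_cancel, hgτ₀, hgρ] at h4
    rw [hgρ] at h3
    rw [mul_div_assoc]
    linarith
  · have h3 := hlip ρ hρ τ hτ
    rw [hgρ, (hgc τ).2 hFτ] at h3
    have : ‖τ - ρ‖ = 0 := by linarith [norm_nonneg (τ - ρ)]
    exact sub_eq_zero.1 (norm_eq_zero.1 this)

/-! ### Eigenvalues near the free eigenvalues -/

section Local

variable {q : ℝ → ℂ} (hq : IntervalIntegrable q volume 0 1)

/-- The rescaled characteristic determinant near the free eigenvalue `(2 π n) ^ 2`. -/
noncomputable def localDet (β₁ β₂ : ℂ) (n : ℕ) (τ : ℂ) : ℂ :=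
  freq n ^ 2 * charDet hq β₁ β₂ (freq n ^ 2 + τ)

/-- The limit of `localDet` if the sine coefficients are `o(1/n)`. -/
noncomputable def limitPoly (β₁ β₂ τ : ℂ) : ℂ := (1 - β₁) * τ ^ 2 / 8 + β₂ * τ / 2

theorem differentiable_localDet (β₁ β₂ : ℂ) (n : ℕ) : Differentiable ℂ (localDet hq β₁ β₂ n) :=
  ((differentiable_charDet hq β₁ β₂).comp (differentiable_id.const_add (freq n ^ 2))).const_mul _

theorem hasDerivAt_limitPoly (β₁ β₂ τ : ℂ) :
    HasDerivAt (limitPoly β₁ β₂) ((1 - β₁) * τ / 4 + β₂ / 2) τ := by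
  have h := (((hasDerivAt_pow 2 τ).const_mul (1 - β₁)).div_const 8).add
    (((hasDerivAt_id τ).const_mul β₂).div_const 2)
  refine h.congr_deriv ?_
  push_cast
  ring

theorem deriv_localDet (β₁ β₂ : ℂ) (n : ℕ) (τ : ℂ) :
    deriv (localDet hq β₁ β₂ n) τ =
      freq n ^ 2 * deriv (charDet hq β₁ β₂) (freq n ^ 2 + τ) := by
  have h1 : HasDerivAt (fun τ => freq n ^ 2 + τ) 1 τ := (hasDerivAt_id τ).const_add _
  have h2 := (((differentiable_charDet hq β₁ β₂ _).hasDerivAt.comp τ h1).const_mul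
    (freq n ^ 2)).deriv
  rw [mul_one] at h2
  exact h2

theorem isLittleO_one_div_iff {u : ℕ → ℂ} {l : Filter ℕ} (hl : l ≤ atTop) :
    (u =o[l] fun n : ℕ => 1 / (n : ℝ)) ↔ Tendsto (fun n : ℕ => (n : ℂ) * u n) l (𝓝 0) := by
  have hn : ∀ᶠ n : ℕ in l, 1 ≤ n := hl (eventually_ge_atTop 1)
  have e : (u =o[l] fun n : ℕ => 1 / (n : ℝ)) ↔ (u =o[l] fun n : ℕ => 1 / (n : ℂ)) := by
    rw [← isLittleO_norm_right, ← isLittleO_norm_right (g' := fun n : ℕ => 1 / (n : ℂ))]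
    simp
  rw [e, isLittleO_iff_tendsto' (by
    filter_upwards [hn] with n hn h
    have : (n : ℂ) ≠ 0 := by exact_mod_cast (by omega : n ≠ 0)
    simp [this] at h)]
  refine tendsto_congr fun n => ?_
  rw [div_div_eq_mul_div, div_one, mul_comm]

/-- Uniform convergence of `localDet` to `limitPoly` on bounded sets. -/
theorem eventually_norm_localDet_sub_le (hq0 : ∫ t in (0 : ℝ)..1, q t = 0) (β₁ β₂ : ℂ)
    {l : Filter ℕ} (hl : l ≤ atTop) (hs : sineCoeff q =o[l] fun n : ℕ => 1 / (n : ℝ)) (R : ℝ)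
    {ε : ℝ} (hε : 0 < ε) :
    ∀ᶠ n in l, ∀ τ : ℂ, ‖τ‖ ≤ R → ‖localDet hq β₁ β₂ n τ - limitPoly β₁ β₂ τ‖ ≤ ε := by
  obtain ⟨δ, C, hδ, hC, H⟩ := exists_charDet_expansion hq hq0 β₁ β₂
  rw [isLittleO_one_div_iff hl] at hs
  have hs' := (hs.norm.const_mul (‖(1 + β₁) / 2‖ * (2 * π)))
  have h1 : Tendsto (fun n : ℕ => δ n * (1 + R) ^ 2 + C * (1 + R) ^ 3 / n +
      ‖(1 + β₁) / 2‖ * (2 * π) * ‖(n : ℂ) * sineCoeff q n‖) l (𝓝 0) := by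
    simpa using (((hδ.mono_left hl).mul_const ((1 + R) ^ 2)).add
      ((tendsto_const_div_atTop_nhds_zero_nat (C * (1 + R) ^ 3)).mono_left hl)).add hs'
  have hδ0 : ∀ᶠ n in l, δ n * (1 + R) ^ 2 + C * (1 + R) ^ 3 / n +
      ‖(1 + β₁) / 2‖ * (2 * π) * ‖(n : ℂ) * sineCoeff q n‖ < ε := h1.eventually (gt_mem_nhds hε)
  filter_upwards [hδ0, hl (eventually_ge_atTop 1), hl (eventually_ge_atTop
    ⌈(∫ t in (0 : ℝ)..1, ‖q t‖) + R⌉₊)] with n h2 hn hnR τ hτ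
  have hn1 : (1 : ℝ) ≤ n := by exact_mod_cast hn
  have hnR' : (∫ t in (0 : ℝ)..1, ‖q t‖) + R ≤ n := Nat.ceil_le.1 hnR
  have h3 := H n hn τ (by nlinarith [Real.pi_gt_three])
  have h5 : ∀ x : ℝ, δ n * x ^ 2 + C * x ^ 3 / n = (δ n + C * x / n) * x ^ 2 := fun x => by ring
  have hδn : 0 ≤ δ n + C * (1 + ‖τ‖) / n := by
    have h4 := (norm_nonneg _).trans h3
    rw [h5] at h4
    exact nonneg_of_mul_nonneg_left h4 (by positivity)
  have h6 : (δ n + C * (1 + ‖τ‖) / n) * (1 + ‖τ‖) ^ 2 ≤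
      (δ n + C * (1 + R) / n) * (1 + R) ^ 2 := by
    have hτ0 := norm_nonneg τ
    have : δ n + C * (1 + ‖τ‖) / n ≤ δ n + C * (1 + R) / n := by gcongr
    exact mul_le_mul this (by gcongr) (by positivity) (hδn.trans this)
  have e : localDet hq β₁ β₂ n τ - limitPoly β₁ β₂ τ =
      (freq n ^ 2 * charDet hq β₁ β₂ (freq n ^ 2 + τ) -
        ((1 - β₁) * τ ^ 2 / 8 + β₂ * τ / 2 + (1 + β₁) / 2 * (freq n * sineCoeff q n))) +
      (1 + β₁) / 2 * (freq n * sineCoeff q n) := by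
    rw [localDet, limitPoly]; ring
  rw [e]
  rw [h5] at h3
  rw [h5] at h2
  refine (norm_add_le _ _).trans ((add_le_add (h3.trans h6) (le_of_eq ?_)).trans h2.le)
  rw [norm_mul, norm_mul, norm_mul, norm_freq, Complex.norm_natCast]
  ring

/-- A simple zero `τ₀` of `limitPoly` (the last hypothesis says that the derivative at `τ₀` does not
vanish) is the limit of simple zeros of `localDet`, the only ones near `τ₀`. -/
theorem exists_localDet_zero (hq0 : ∫ t in (0 : ℝ)..1, q t = 0) {β₁ β₂ : ℂ}
    {l : Filter ℕ} (hl : l ≤ atTop) (hs : sineCoeff q =o[l] fun n : ℕ => 1 / (n : ℝ)) {τ₀ : ℂ}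
    (h0 : limitPoly β₁ β₂ τ₀ = 0) (h1 : (1 - β₁) * τ₀ / 4 + β₂ / 2 ≠ 0) :
    ∃ (r : ℝ) (ρ : ℕ → ℂ), 0 < r ∧ Tendsto ρ l (𝓝 τ₀) ∧ ∀ᶠ n in l,
      localDet hq β₁ β₂ n (ρ n) = 0 ∧ deriv (localDet hq β₁ β₂ n) (ρ n) ≠ 0 ∧
        ∀ τ ∈ Metric.closedBall τ₀ r, localDet hq β₁ β₂ n τ = 0 → τ = ρ n := by
  have hd := fun τ => hasDerivAt_limitPoly β₁ β₂ τ
  rw [← (hd τ₀).deriv] at h1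
  obtain ⟨r, ε, hr, hr1, hε, H⟩ := exists_simple_zero (fun τ => (hd τ).differentiableAt) h0 h1
    one_pos
  have hev := eventually_norm_localDet_sub_le hq hq0 β₁ β₂ hl hs (‖τ₀‖ + 2 * r) hε
  have hex : ∀ n, ∃ ρ, (∀ τ : ℂ, ‖τ‖ ≤ ‖τ₀‖ + 2 * r →
      ‖localDet hq β₁ β₂ n τ - limitPoly β₁ β₂ τ‖ ≤ ε) → localDet hq β₁ β₂ n ρ = 0 ∧
      deriv (localDet hq β₁ β₂ n) ρ ≠ 0 ∧
        ‖ρ - τ₀‖ ≤ 2 * ‖localDet hq β₁ β₂ n τ₀‖ / ‖deriv (limitPoly β₁ β₂) τ₀‖ ∧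
        ∀ τ ∈ Metric.closedBall τ₀ r, localDet hq β₁ β₂ n τ = 0 → τ = ρ := fun n => by
    by_cases hb : ∀ τ : ℂ, ‖τ‖ ≤ ‖τ₀‖ + 2 * r →
      ‖localDet hq β₁ β₂ n τ - limitPoly β₁ β₂ τ‖ ≤ ε
    · obtain ⟨ρ, -, h2, h3, h4, h5⟩ := H _ (differentiable_localDet hq β₁ β₂ n) fun τ hτ => hb τ (by
        rw [mem_closedBall_iff_norm] at hτ
        have := norm_le_norm_add_norm_sub τ₀ τ
        rw [norm_sub_rev] at this
        linarith)
      exact ⟨ρ, fun _ => ⟨h2, h3, h4, h5⟩⟩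
    · exact ⟨0, fun h => absurd h hb⟩
  choose ρ hρ using hex
  refine ⟨r, ρ, hr, ?_, ?_⟩
  · rw [tendsto_iff_norm_sub_tendsto_zero]
    have h2 : Tendsto (fun n => localDet hq β₁ β₂ n τ₀) l (𝓝 0) := by
      rw [Metric.tendsto_nhds]
      intro η hη
      filter_upwards [eventually_norm_localDet_sub_le hq hq0 β₁ β₂ hl hs ‖τ₀‖ (half_pos hη)]
        with n hn
      have := hn τ₀ le_rfl
      rw [h0, sub_zero] at this
      rw [dist_zero_right]
      linarith
    refine squeeze_zero' (Eventually.of_forall fun _ => norm_nonneg _) (hev.mono fun n hn =>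
      (hρ n hn).2.2.1) ?_
    simpa using (h2.norm.const_mul 2).div_const ‖deriv (limitPoly β₁ β₂) τ₀‖
  · filter_upwards [hev] with n hn
    exact ⟨(hρ n hn).1, (hρ n hn).2.1, (hρ n hn).2.2.2⟩

end Local

/-! ### Eigenfunctions near the free eigenvalues -/

section Eigenfunctions

variable {q : ℝ → ℂ} (hq : IntervalIntegrable q volume 0 1)

/-- Solutions at spectral parameters within bounded distance of `(2 π n) ^ 2`. -/
theorem sol_near_freq {R : ℝ} {n : ℕ} (hn : 1 ≤ n)
    (hnR : (∫ t in (0 : ℝ)..1, ‖q t‖) + R ≤ n) {τ : ℂ} (hτ : ‖τ‖ ≤ R) {x : ℝ}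
    (hx : x ∈ Icc (0 : ℝ) 1) :
    ‖(cosSol hq (freq n ^ 2 + τ)).extend x - Complex.cos (freq n * x)‖ ≤
      2 * ((∫ t in (0 : ℝ)..1, ‖q t‖) + R) / n ∧
    ‖(cosSol' hq (freq n ^ 2 + τ)).extend 1‖ ≤ 2 * ((∫ t in (0 : ℝ)..1, ‖q t‖) + R) ∧
    ‖(sinSol hq (freq n ^ 2 + τ)).extend x‖ ≤ 2 / n ∧
    ‖(sinSol' hq (freq n ^ 2 + τ)).extend 1 - 1‖ ≤
      2 * ((∫ t in (0 : ℝ)..1, ‖q t‖) + R) / n := by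
  set Q := (∫ t in (0 : ℝ)..1, ‖q t‖) + R
  have hp : IntervalIntegrable (fun t => q t - τ) volume 0 1 := hq.sub (by simp)
  have hP : ∀ t, q t - (freq n ^ 2 + τ) = (q t - τ) - freq n ^ 2 := fun t => by ring
  have hQ : ∫ t in (0 : ℝ)..1, ‖q t - τ‖ ≤ Q :=
    (integral_norm_sub_const_le hq τ).trans (by simpa [Q] using hτ)
  have hQ0 : 0 ≤ Q := (integral_norm_nonneg _).trans hQ
  have hn1 : (1 : ℝ) ≤ n := by exact_mod_cast hn
  have hnM : (n : ℝ) ≤ 2 * π * n := by nlinarith [Real.pi_gt_three]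
  have hQm : 2 * Q ≤ ‖freq n‖ := by rw [norm_freq]; nlinarith [Real.pi_gt_three]
  have hm := freq_ne_zero hn
  have hM : 0 < 2 * π * (n : ℝ) := by linarith
  have hc := fun {x : ℝ} (hx : x ∈ Icc (0 : ℝ) 1) =>
    (isSolution_cosSol hq (freq n ^ 2 + τ)).norm_sub_free_le hp hP hQ hQm hm (K := 2 * π * n)
      (by rw [cosSol_zero, cosSol'_zero, mul_one, norm_zero, add_zero, norm_freq]) hx
  have hs := fun {x : ℝ} (hx : x ∈ Icc (0 : ℝ) 1) =>
    (isSolution_sinSol hq (freq n ^ 2 + τ)).norm_sub_free_le hp hP hQ hQm hm (K := 1)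
      (by rw [sinSol_zero, sinSol'_zero, mul_zero, norm_zero, zero_add, norm_one]) hx
  simp only [norm_freq, freq_im, abs_zero, zero_mul, Real.exp_zero, mul_one, cosSol_zero,
    cosSol'_zero, sinSol_zero, sinSol'_zero, mul_zero, add_zero, zero_add, one_mul] at hc hs
  have e : 2 * (2 * π * n) * Q / (2 * π * n) = 2 * Q := by field_simp
  have h1 : (1 : ℝ) ∈ Icc (0 : ℝ) 1 := by simp
  refine ⟨?_, ?_, ?_, ?_⟩
  · have := (hc hx).2.1
    rw [← mul_sub, norm_mul, norm_freq, e, mul_comm, ← le_div_iff₀ hM] at this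
    exact this.trans (by gcongr)
  · have := (hc h1).2.2
    rwa [Complex.ofReal_one, mul_one, sin_freq, mul_zero, sub_zero, e] at this
  · have := (hs hx).1
    rw [norm_mul, norm_freq, mul_comm, ← le_div_iff₀ hM] at this
    exact this.trans (by gcongr)
  · have := (hs h1).2.2
    rw [Complex.ofReal_one, mul_one, cos_freq] at this
    exact this.trans (by gcongr)

/-- `sinBoundary` tends to `1 + β₁`, so that the eigenfunctions exist in the form `eigenSol`, and
`sinSol` is `O(1/n)`, so that all of them are close to the same free eigenfunction. -/
theorem exists_eigenSol_near_cos {β₁ : ℂ} (hβ₁ : β₁ ≠ -1) (β₂ : ℂ) (R : ℝ) (hR : 0 ≤ R) :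
    ∃ C : ℝ, 0 ≤ C ∧ ∀ᶠ n : ℕ in atTop, ∀ τ : ℂ, ‖τ‖ ≤ R →
      sinBoundary hq β₁ β₂ (freq n ^ 2 + τ) ≠ 0 ∧ ∀ x ∈ Icc (0 : ℝ) 1,
        ‖(eigenSol hq β₁ β₂ (freq n ^ 2 + τ)).extend x - Complex.cos (freq n * x)‖ ≤ C / n := by
  set Q := (∫ t in (0 : ℝ)..1, ‖q t‖) + R
  have hQ0 : 0 ≤ Q := add_nonneg (integral_norm_nonneg q) hR
  have hb : 0 < ‖1 + β₁‖ := by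
    rw [norm_pos_iff]
    intro h
    exact hβ₁ (by linear_combination h)
  set D := ‖β₁‖ * (2 * Q) + ‖β₂‖ * (1 + 2 * Q)
  refine ⟨2 * Q + D / (‖1 + β₁‖ / 2) * 2, by positivity, ?_⟩
  have hlim : Tendsto (fun n : ℕ => (‖β₁‖ * (2 * Q) + ‖β₂‖ * 2) / (n : ℝ)) atTop (𝓝 0) :=
    tendsto_const_div_atTop_nhds_zero_nat _
  filter_upwards [eventually_ge_atTop 1, eventually_ge_atTop ⌈Q⌉₊,
    hlim.eventually (gt_mem_nhds (half_pos hb))] with n hn hnQ hsmall τ hτ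
  have hnQ' : Q ≤ n := Nat.ceil_le.1 hnQ
  have hn1 : (1 : ℝ) ≤ n := by exact_mod_cast hn
  have hsol := fun {x : ℝ} (hx : x ∈ Icc (0 : ℝ) 1) => sol_near_freq hq hn hnQ' hτ hx
  have h1 : (1 : ℝ) ∈ Icc (0 : ℝ) 1 := by simp
  obtain ⟨hc, hc', hs, hs'⟩ := hsol h1
  have hS : ‖1 + β₁‖ / 2 ≤ ‖sinBoundary hq β₁ β₂ (freq n ^ 2 + τ)‖ := by
    have e : sinBoundary hq β₁ β₂ (freq n ^ 2 + τ) = (1 + β₁) +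
        (β₁ * ((sinSol' hq (freq n ^ 2 + τ)).extend 1 - 1) +
          β₂ * (sinSol hq (freq n ^ 2 + τ)).extend 1) := by
      have e' : (sinSol' hq (freq n ^ 2 + τ)).extend 1 =
        1 + (slopeOf hq (freq n ^ 2 + τ) (sinSol hq (freq n ^ 2 + τ))).extend 1 := rfl
      rw [e', sinBoundary, evalOne_apply, evalOne_apply]
      ring
    have h2 : ‖β₁ * ((sinSol' hq (freq n ^ 2 + τ)).extend 1 - 1) +
          β₂ * (sinSol hq (freq n ^ 2 + τ)).extend 1‖ ≤
        (‖β₁‖ * (2 * Q) + ‖β₂‖ * 2) / (n : ℝ) := by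
      refine (norm_add_le_of_le (norm_mul_le_of_le le_rfl hs') (norm_mul_le_of_le le_rfl
        hs)).trans_eq ?_
      ring
    have h3 := norm_sub_le_norm_add (1 + β₁)
      (β₁ * ((sinSol' hq (freq n ^ 2 + τ)).extend 1 - 1) +
        β₂ * (sinSol hq (freq n ^ 2 + τ)).extend 1)
    rw [e]
    linarith
  refine ⟨norm_pos_iff.1 (lt_of_lt_of_le (half_pos hb) hS), fun x hx => ?_⟩
  have hC : ‖cosBoundary hq β₁ β₂ (freq n ^ 2 + τ)‖ ≤ D := by
    rw [cosBoundary, evalOne_apply, evalOne_apply]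
    refine norm_add_le_of_le (norm_mul_le_of_le le_rfl hc') (norm_mul_le_of_le le_rfl ?_)
    have h2 := norm_add_le_of_le hc (norm_cos_freq_le n 1)
    rw [sub_add_cancel] at h2
    have h3 : 2 * Q / n ≤ 2 * Q := div_le_self (by positivity) hn1
    linarith
  obtain ⟨hcx, -, hsx, -⟩ := hsol hx
  have hB : ‖-(cosBoundary hq β₁ β₂ (freq n ^ 2 + τ) / sinBoundary hq β₁ β₂ (freq n ^ 2 + τ))‖ ≤
      D / (‖1 + β₁‖ / 2) := by
    rw [norm_neg, norm_div]
    gcongr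
  rw [eigenSol, C01.extend_add, C01.extend_smul, add_sub_right_comm]
  refine (norm_add_le_of_le hcx (norm_mul_le_of_le hB hsx)).trans_eq ?_
  ring

end Eigenfunctions

/-! ### Localization of all large eigenvalues -/

theorem sqrt_mul_self_re (w : ℂ) : ∃ m : ℂ, m ^ 2 = w ∧ 0 ≤ m.re := by
  refine ⟨w ^ (2⁻¹ : ℂ), ?_, ?_⟩
  · have := Complex.cpow_nat_inv_pow w (n := 2) two_ne_zero
    exact_mod_cast this
  · rw [Complex.cpow_inv_two_re]
    positivity

theorem norm_one_sub_cos (m : ℂ) :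
    ‖1 - Complex.cos m‖ = 2 * (Real.sin (m.re / 2) ^ 2 + Real.sinh (m.im / 2) ^ 2) := by
  have e : 1 - Complex.cos m = 2 * Complex.sin (m / 2) ^ 2 := by
    have := Complex.cos_two_mul (m / 2)
    rw [mul_div_cancel₀ _ two_ne_zero, Complex.cos_sq'] at this
    rw [this]; ring
  have hre : (m / 2).re = m.re / 2 := by simp
  have him : (m / 2).im = m.im / 2 := by simp
  rw [e, norm_mul, norm_pow, Complex.norm_ofNat, ← Complex.normSq_eq_norm_sq, Complex.sin_eq, hre,
    him, ← Complex.ofReal_sin, ← Complex.ofReal_cos, ← Complex.ofReal_sinh, ← Complex.ofReal_cosh,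
    ← Complex.ofReal_mul, ← Complex.ofReal_mul, Complex.normSq_add_mul_I]
  have h1 := Real.cosh_sq (m.im / 2)
  have h2 := Real.sin_sq_add_cos_sq (m.re / 2)
  congr 1
  rw [mul_pow, mul_pow, h1]
  linear_combination Real.sinh (m.im / 2) ^ 2 * h2

/-- Where `cos m` is close to `1`, relative to its growth, `m` is close to `2 π ℤ`. -/
theorem exists_nat_near_of_norm_one_sub_cos_le {m : ℂ} (hm : 0 ≤ m.re) {κ : ℝ}
    (hκ : 0 ≤ κ) (hκ1 : κ ≤ 1 / 4)
    (h : ‖1 - Complex.cos m‖ ≤ κ ^ 2 * Real.exp |m.im|) :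
    ∃ n : ℕ, ‖m - freq n‖ ≤ 8 * κ := by
  rw [norm_one_sub_cos] at h
  have hsinh0 := sq_nonneg (Real.sinh (m.im / 2))
  have hsin0 := sq_nonneg (Real.sin (m.re / 2))
  have hexp : Real.exp |m.im| ≤ 2 + 4 * Real.sinh (m.im / 2) ^ 2 := by
    have h1 : Real.cosh |m.im| = 1 + 2 * Real.sinh (m.im / 2) ^ 2 := by
      have h2 := Real.cosh_two_mul (m.im / 2)
      rw [mul_div_cancel₀ _ two_ne_zero, Real.cosh_sq] at h2
      rw [Real.cosh_abs, h2]
      ring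
    have h3 : Real.exp |m.im| ≤ 2 * Real.cosh |m.im| := by
      rw [Real.cosh_eq]
      linarith [Real.exp_pos (-|m.im|)]
    linarith
  have hbound : Real.sin (m.re / 2) ^ 2 + Real.sinh (m.im / 2) ^ 2 ≤ 2 * κ ^ 2 := by
    have hk2 : κ ^ 2 ≤ 1 / 16 := by nlinarith
    nlinarith [mul_le_mul_of_nonneg_left hexp (sq_nonneg κ),
      mul_le_mul_of_nonneg_right hk2 hsinh0]
  have hsinh : |Real.sinh (m.im / 2)| ≤ 3 / 2 * κ :=
    abs_le_of_sq_le_sq (by nlinarith) (by positivity)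
  have hsin : |Real.sin (m.re / 2)| ≤ 3 / 2 * κ := abs_le_of_sq_le_sq (by nlinarith) (by positivity)
  have him : |m.im| ≤ 3 * κ := by
    have h1 : |m.im / 2| ≤ |Real.sinh (m.im / 2)| := by
      rw [Real.abs_sinh]
      exact Real.self_le_sinh_iff.2 (abs_nonneg _)
    rw [abs_div, abs_two] at h1
    linarith
  set k := round (m.re / (2 * π))
  have hk0 : 0 ≤ k := by
    simp only [k, round_eq]
    exact Int.floor_nonneg.2 (by positivity)
  obtain ⟨n, hn⟩ := Int.eq_ofNat_of_zero_le hk0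
  set y := m.re / 2 - π * n
  have hy : |y| ≤ π / 2 := by
    have h1 := abs_sub_round (m.re / (2 * π))
    change |_ - (k : ℝ)| ≤ _ at h1
    rw [hn] at h1
    have e : y = π * (m.re / (2 * π) - n) := by
      simp only [y]; field_simp
    rw [e, abs_mul, abs_of_pos Real.pi_pos]
    push_cast at h1
    nlinarith [Real.pi_pos]
  have hsy : |Real.sin y| = |Real.sin (m.re / 2)| := by
    simp only [y]
    rw [mul_comm, Real.sin_sub_nat_mul_pi, abs_mul, abs_pow, abs_neg, abs_one, one_pow, one_mul]
  have hyk : |y| ≤ π / 2 * (3 / 2 * κ) := by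
    have h1 := Real.mul_abs_le_abs_sin hy
    rw [hsy] at h1
    have h2 := h1.trans hsin
    rw [div_mul_eq_mul_div, div_le_iff₀ Real.pi_pos] at h2
    linarith
  refine ⟨n, ?_⟩
  have hre : |(m - freq n).re| ≤ 5 * κ := by
    have e : (m - freq n).re = 2 * y := by
      simp only [Complex.sub_re, freq, Complex.ofReal_re, y]; ring
    rw [e, abs_mul, abs_two]
    nlinarith [Real.pi_lt_d2]
  have him' : |(m - freq n).im| ≤ 3 * κ := by
    rwa [Complex.sub_im, freq_im, sub_zero]
  linarith [Complex.norm_le_abs_re_add_abs_im (m - freq n)]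

section Localization

variable {q : ℝ → ℂ} (hq : IntervalIntegrable q volume 0 1)

/-- All large eigenvalues are close to free ones, relative to the gaps. -/
theorem exists_freq_near_of_charDet_eq_zero {β₁ : ℂ} (hβ₁ : β₁ ≠ 1) (β₂ : ℂ) {η : ℝ} (hη : 0 < η)
    (N : ℕ) : ∃ R : ℝ, ∀ ev : ℂ, charDet hq β₁ β₂ ev = 0 → R ≤ ‖ev‖ →
      ∃ n ≥ N, ‖ev - freq n ^ 2‖ ≤ η * n := by
  set q₁ := ∫ t in (0 : ℝ)..1, ‖q t‖
  have hq₁ : 0 ≤ q₁ := integral_norm_nonneg q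
  have hb : 0 < ‖1 - β₁‖ := by
    rw [norm_pos_iff, sub_ne_zero]
    exact hβ₁.symm
  set A := (2 * q₁ * (1 + ‖β₁‖) + 2 * ‖β₂‖) / ‖1 - β₁‖
  have hA : 0 ≤ A := by positivity
  -- `θ` bounds the distance of the square roots
  set θ := min 1 (η / 14)
  have hθ : 0 < θ := lt_min one_pos (by positivity)
  set κ := θ / 8
  have hκ : 0 < κ := by positivity
  have hκ1 : κ ≤ 1 / 4 := by
    have : θ ≤ 1 := min_le_left _ _
    simp only [κ]; linarith
  set r := 2 * q₁ + A / κ ^ 2 + 2 * π * (N + 1) + 1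
  have hr : 1 ≤ r := by
    have : 0 ≤ 2 * q₁ + A / κ ^ 2 + 2 * π * (N + 1) := by positivity
    linarith
  refine ⟨r ^ 2, fun ev hev hR => ?_⟩
  obtain ⟨m, rfl, hmre⟩ := sqrt_mul_self_re ev
  rw [norm_pow] at hR
  have hmr : r ≤ ‖m‖ := le_of_sq_le_sq hR (norm_nonneg _)
  have hm0 : 0 < ‖m‖ := by linarith
  have hm := norm_pos_iff.1 hm0
  have hpos1 : 0 ≤ A / κ ^ 2 := by positivity
  have hpos2 : 0 ≤ 2 * π * ((N : ℝ) + 1) := by positivity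
  have hQm : 2 * q₁ ≤ ‖m‖ := by linarith
  have hAm : A / ‖m‖ ≤ κ ^ 2 := by
    rw [div_le_iff₀ hm0]
    have : A / κ ^ 2 ≤ ‖m‖ := by linarith
    rw [div_le_iff₀ (by positivity)] at this
    linarith
  have h1 : (1 : ℝ) ∈ Icc (0 : ℝ) 1 := by simp
  have hc := (isSolution_cosSol hq (m ^ 2)).norm_sub_free_le hq (fun t => rfl) (Q := q₁) le_rfl
    hQm hm (K := ‖m‖) (by rw [cosSol_zero, cosSol'_zero, mul_one, norm_zero, add_zero]) h1
  have hs := (isSolution_sinSol hq (m ^ 2)).norm_sub_free_le hq (fun t => rfl) (Q := q₁) le_rfl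
    hQm hm (K := 1) (by rw [sinSol_zero, sinSol'_zero, mul_zero, norm_zero, zero_add, norm_one]) h1
  simp only [mul_one, cosSol_zero, cosSol'_zero, sinSol_zero, sinSol'_zero, mul_zero, add_zero,
    zero_add, one_mul, zero_mul, Complex.ofReal_one] at hc hs
  set E := Real.exp |m.im|
  have hc1 : ‖(cosSol hq (m ^ 2)).extend 1 - Complex.cos m‖ ≤ 2 * q₁ / ‖m‖ * E := by
    have h2 := hc.2.1
    rw [← mul_sub, norm_mul, mul_comm, ← le_div_iff₀ hm0] at h2
    refine h2.trans_eq ?_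
    field_simp
  have hs1 : ‖(sinSol hq (m ^ 2)).extend 1‖ ≤ 2 / ‖m‖ * E := by
    have h2 := hs.1
    rw [norm_mul, mul_comm, ← le_div_iff₀ hm0] at h2
    refine h2.trans_eq ?_
    ring
  have hs2 := hs.2.2
  rw [charDet_eq] at hev
  have e : (1 - β₁) * (1 - Complex.cos m) = ((cosSol hq (m ^ 2)).extend 1 - Complex.cos m) -
      β₁ * ((sinSol' hq (m ^ 2)).extend 1 - Complex.cos m) -
      β₂ * (sinSol hq (m ^ 2)).extend 1 := by linear_combination hev
  have h3 : ‖(1 - β₁) * (1 - Complex.cos m)‖ ≤ 2 * q₁ / ‖m‖ * E + ‖β₁‖ * (2 * q₁ / ‖m‖ * E) +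
      ‖β₂‖ * (2 / ‖m‖ * E) := by
    rw [e]
    exact norm_sub_le_of_le (norm_sub_le_of_le hc1 (norm_mul_le_of_le le_rfl hs2))
      (norm_mul_le_of_le le_rfl hs1)
  have h4 : ‖1 - Complex.cos m‖ ≤ κ ^ 2 * E := by
    rw [norm_mul, mul_comm, ← le_div_iff₀ hb] at h3
    refine h3.trans (le_trans (le_of_eq ?_)
      (mul_le_mul_of_nonneg_right hAm (Real.exp_nonneg _)))
    simp only [A]
    field_simp
  obtain ⟨n, hn⟩ := exists_nat_near_of_norm_one_sub_cos_le hmre hκ.le hκ1 h4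
  have hκθ : 8 * κ = θ := by simp only [κ]; ring
  rw [hκθ] at hn
  have hθ1 : θ ≤ 1 := min_le_left _ _
  have hθη : θ ≤ η / 14 := min_le_right _ _
  have hmn : ‖m‖ ≤ 2 * π * n + 1 := by
    have := norm_le_norm_add_norm_sub (freq n) m
    rw [norm_sub_rev, norm_freq] at this
    rw [norm_sub_rev] at hn
    linarith [norm_sub_rev m (freq n)]
  have hNn : N + 1 ≤ n := by
    have h5 : 2 * π * ((N : ℝ) + 1) ≤ 2 * π * n := by linarith
    have h6 : ((N + 1 : ℕ) : ℝ) ≤ n := by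
      push_cast
      exact le_of_mul_le_mul_left h5 (by positivity)
    exact_mod_cast h6
  refine ⟨n, by omega, ?_⟩
  have hn1 : (1 : ℝ) ≤ n := by exact_mod_cast (by omega : 1 ≤ n)
  rw [show m ^ 2 - freq n ^ 2 = (m - freq n) * (m + freq n) by ring]
  have h7 : ‖m + freq n‖ ≤ 14 * n := by
    have := norm_add_le m (freq n)
    rw [norm_freq] at this
    nlinarith [Real.pi_lt_d2]
  refine (norm_mul_le_of_le hn h7).trans ?_
  nlinarith

/-- In the window left by the coarse localization, a quadratic lower bound for the limit polynomial
confines the zeros of the determinant to a bounded neighbourhood of the free eigenvalue. -/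
theorem exists_bound_of_localDet_eq_zero (hq0 : ∫ t in (0 : ℝ)..1, q t = 0) {β₁ : ℂ}
    (hβ₁ : β₁ ≠ 1) (β₂ : ℂ) (hs : sineCoeff q =o[atTop] fun n : ℕ => 1 / (n : ℝ)) :
    ∃ (η R : ℝ), 0 < η ∧ ∀ᶠ n : ℕ in atTop, ∀ τ : ℂ, ‖τ‖ ≤ η * n →
      localDet hq β₁ β₂ n τ = 0 → ‖τ‖ ≤ R := by
  obtain ⟨δ, C, hδ, hC, H⟩ := exists_charDet_expansion hq hq0 β₁ β₂
  have hb : 0 < ‖1 - β₁‖ := by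
    rw [norm_pos_iff, sub_ne_zero]
    exact hβ₁.symm
  set k := ‖1 - β₁‖ / 8
  have hk : 0 < k := by positivity
  rw [isLittleO_one_div_iff le_rfl] at hs
  have hs' := (hs.norm.const_mul (‖(1 + β₁) / 2‖ * (2 * π)))
  rw [norm_zero, mul_zero] at hs'
  set η := min 1 (k / (4 * (C + 1)))
  have hη : 0 < η := lt_min one_pos (by positivity)
  have hη1 : η ≤ 1 := min_le_left _ _
  have hηC : C * η ≤ k / 4 := by
    have h1 : η ≤ k / (4 * (C + 1)) := min_le_right _ _
    rw [le_div_iff₀ (by positivity)] at h1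
    nlinarith
  refine ⟨η, 2 * (2 * k + ‖β₂‖ / 2 + 1) / k, hη, ?_⟩
  filter_upwards [eventually_ge_atTop 1, eventually_ge_atTop ⌈∫ t in (0 : ℝ)..1, ‖q t‖⌉₊,
    hδ.eventually (gt_mem_nhds (by positivity : 0 < k / 8)),
    (tendsto_const_div_atTop_nhds_zero_nat C).eventually (gt_mem_nhds (by positivity : 0 < k / 8)),
    hs'.eventually (gt_mem_nhds one_pos)] with n hn hnq hδn hCn hsn τ hτ hdet
  have hn1 : (1 : ℝ) ≤ n := by exact_mod_cast hn
  have hnq' : (∫ t in (0 : ℝ)..1, ‖q t‖) ≤ n := Nat.ceil_le.1 hnq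
  have h1 := H n hn τ (by nlinarith [Real.pi_gt_three])
  rw [localDet] at hdet
  rw [hdet, zero_sub, norm_neg] at h1
  have e1 : ‖(1 + β₁) / 2 * (freq n * sineCoeff q n)‖ ≤ 1 := by
    refine le_trans (le_of_eq ?_) hsn.le
    rw [norm_mul, norm_mul, norm_mul, norm_freq, Complex.norm_natCast]
    ring
  have e2 : ‖(1 - β₁) * τ ^ 2 / 8‖ = k * ‖τ‖ ^ 2 := by
    rw [norm_div, norm_mul, norm_pow, Complex.norm_ofNat]; simp only [k]; ring
  have e3 : ‖β₂ * τ / 2‖ = ‖β₂‖ / 2 * ‖τ‖ := by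
    rw [norm_div, norm_mul, Complex.norm_ofNat]; ring
  have h2 : k * ‖τ‖ ^ 2 ≤ δ n * (1 + ‖τ‖) ^ 2 + C * (1 + ‖τ‖) ^ 3 / n + 1 + ‖β₂‖ / 2 * ‖τ‖ := by
    rw [← e2, ← e3]
    have := norm_sub_le_of_le (norm_sub_le_of_le h1 e1) (le_refl ‖β₂ * τ / 2‖)
    refine le_trans (le_of_eq ?_) this
    congr 1
    ring
  set D := 1 + ‖τ‖
  have hτ0 := norm_nonneg τ
  have hD : 1 ≤ D := by simp only [D]; linarith
  have hτD : ‖τ‖ = D - 1 := by simp only [D]; ring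
  have h3 : C * D ^ 3 / n ≤ D ^ 2 * (k / 4 + k / 8) := by
    have h4 : C * D / n ≤ k / 4 + k / 8 := by
      have h5 : C * D / n = C / n + C * (‖τ‖ / n) := by simp only [D]; ring
      have h6 : ‖τ‖ / n ≤ η := by rwa [div_le_iff₀ (by linarith)]
      rw [h5]
      nlinarith
    calc C * D ^ 3 / n = D ^ 2 * (C * D / n) := by ring
      _ ≤ _ := mul_le_mul_of_nonneg_left h4 (by positivity)
  have h7 : δ n * D ^ 2 ≤ k / 8 * D ^ 2 := mul_le_mul_of_nonneg_right hδn.le (by positivity)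
  have h8 : k / 2 * D ^ 2 ≤ (2 * k + ‖β₂‖ / 2 + 1) * D := by
    rw [hτD] at h2
    nlinarith [norm_nonneg β₂]
  have h9 : k / 2 * D ≤ 2 * k + ‖β₂‖ / 2 + 1 := by
    have : (k / 2 * D) * D ≤ (2 * k + ‖β₂‖ / 2 + 1) * D := by linarith
    exact le_of_mul_le_mul_right this (by linarith)
  rw [le_div_iff₀ hk, hτD]
  nlinarith

end Localization

/-! ### Normalized eigenfunctions -/

theorem C01.toL2_sub (f g : C01) : (f - g).toL2 = f.toL2 - g.toL2 :=
  MemLp.toLp_sub f.memLp_extend g.memLp_extend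

theorem C01.toL2_smul (c : ℂ) (f : C01) : (c • f).toL2 = c • f.toL2 :=
  MemLp.toLp_const_smul c f.memLp_extend

theorem C01.norm_toL2_le {f : C01} {C : ℝ} (hC : 0 ≤ C)
    (h : ∀ x ∈ Icc (0 : ℝ) 1, ‖f.extend x‖ ≤ C) : ‖f.toL2‖ ≤ C := by
  have h1 := Lp.norm_le_of_ae_bound (f := f.toL2) hC (by
    filter_upwards [f.coeFn_toL2, ae_restrict_mem measurableSet_Icc] with x h1 hx
    rw [h1]
    exact h x hx)
  simpa [measureUnivNNReal] using h1

/-- The free eigenfunction `cos (2 π n x)`, as an element of `C[0,1]`. -/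
noncomputable def freeCos (n : ℕ) : C01 :=
  C01.ofContinuousOn (fun x => Complex.cos (freq n * x)) (Continuous.continuousOn (by fun_prop))

theorem extend_freeCos (n : ℕ) {x : ℝ} (hx : x ∈ Icc (0 : ℝ) 1) :
    (freeCos n).extend x = Complex.cos (freq n * x) := C01.extend_ofContinuousOn _ hx

theorem cos_freq_eq (n : ℕ) (x : ℝ) :
    Complex.cos (freq n * x) = (Real.cos (2 * π * n * x) : ℂ) := by
  rw [freq, Complex.ofReal_cos]; push_cast; rfl

theorem integral_cos_sq_freq {n : ℕ} (hn : 1 ≤ n) :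
    ∫ x in (0 : ℝ)..1, Real.cos (2 * π * n * x) ^ 2 = 1 / 2 := by
  have hc : (2 * π * n : ℝ) ≠ 0 := by
    have : (1 : ℝ) ≤ n := by exact_mod_cast hn
    positivity
  have hsin : Real.sin (2 * π * n) = 0 := by
    rw [show 2 * π * n = ((2 * n : ℕ) : ℝ) * π by push_cast; ring]
    exact Real.sin_nat_mul_pi _
  rw [intervalIntegral.integral_comp_mul_left (fun x => Real.cos x ^ 2) hc, integral_cos_sq]
  simp only [mul_zero, mul_one, hsin, Real.sin_zero, smul_eq_mul]
  field_simp
  ring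

theorem norm_toL2_freeCos {n : ℕ} (hn : 1 ≤ n) : √2 * ‖(freeCos n).toL2‖ = 1 := by
  have h : ‖(freeCos n).toL2‖ = (1 / 2 : ℝ) ^ (1 / 2 : ℝ) := by
    rw [C01.toL2, Lp.norm_toLp, MemLp.eLpNorm_eq_integral_rpow_norm two_ne_zero
      ENNReal.ofNat_ne_top (freeCos n).memLp_extend, ENNReal.toReal_ofReal (by positivity)]
    have e : ∫ x, ‖(freeCos n).extend x‖ ^ (2 : ENNReal).toReal ∂unitMeasure = 1 / 2 := by
      rw [← integral_cos_sq_freq hn, intervalIntegral.integral_of_le zero_le_one,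
        ← integral_Icc_eq_integral_Ioc]
      refine setIntegral_congr_fun measurableSet_Icc fun x hx => ?_
      rw [extend_freeCos n hx, cos_freq_eq, Complex.norm_real, ENNReal.toReal_ofNat,
        Real.rpow_two, Real.norm_eq_abs, sq_abs]
    rw [e]
    norm_num
  rw [h, ← Real.sqrt_eq_rpow, ← Real.sqrt_mul zero_le_two]
  norm_num

/-- Normalization preserves closeness to the free eigenfunction. -/
theorem exists_normalized_near {n : ℕ} (hn : 1 ≤ n) {f : C01} {ε : ℝ} (hε : ε ≤ 1 / 4)
    (h : ∀ x ∈ Icc (0 : ℝ) 1, ‖f.extend x - Complex.cos (freq n * x)‖ ≤ ε) :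
    ∃ c : ℂ, c ≠ 0 ∧ ‖(c • f).toL2‖ = 1 ∧ ∀ x ∈ Icc (0 : ℝ) 1,
      ‖(c • f).extend x - ((√2 * Real.cos (2 * π * n * x) : ℝ) : ℂ)‖ ≤ 7 * ε := by
  have hε0 : 0 ≤ ε := (norm_nonneg _).trans (h 0 (by simp))
  set κ := ‖f.toL2‖
  set κ₀ := ‖(freeCos n).toL2‖
  have hκ₀ : √2 * κ₀ = 1 := norm_toL2_freeCos hn
  have h2 : √2 ≤ 3 / 2 := Real.sqrt_le_iff.2 ⟨by norm_num, by norm_num⟩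
  have h2' : 0 < √2 := by positivity
  have hκ₀' : 13 / 20 ≤ κ₀ := by nlinarith [norm_nonneg (freeCos n).toL2]
  have hdiff : |κ - κ₀| ≤ ε := by
    refine (abs_norm_sub_norm_le _ _).trans ?_
    rw [← C01.toL2_sub]
    refine C01.norm_toL2_le hε0 fun x hx => ?_
    rw [C01.extend_sub, extend_freeCos n hx]
    exact h x hx
  have hκ : 2 / 5 ≤ κ := by linarith [(abs_le.1 hdiff).1]
  have hκ0 : 0 < κ := by linarith
  have hinv : κ⁻¹ ≤ 5 / 2 := by
    rw [inv_le_comm₀ hκ0 (by norm_num)]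
    linarith
  refine ⟨(κ⁻¹ : ℝ), by exact_mod_cast inv_ne_zero hκ0.ne', ?_, fun x hx => ?_⟩
  · rw [C01.toL2_smul, norm_smul, Complex.norm_real, norm_inv, norm_norm]
    exact inv_mul_cancel₀ hκ0.ne'
  · rw [C01.extend_smul, Complex.ofReal_mul, ← cos_freq_eq]
    have e : ((κ⁻¹ : ℝ) : ℂ) * f.extend x - (√2 : ℂ) * Complex.cos (freq n * x) =
        ((κ⁻¹ : ℝ) : ℂ) * (f.extend x - Complex.cos (freq n * x)) +
        ((κ⁻¹ - √2 : ℝ) : ℂ) * Complex.cos (freq n * x) := by push_cast; ring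
    have e2 : κ⁻¹ - √2 = κ⁻¹ * √2 * (κ₀ - κ) := by
      have : κ⁻¹ * κ = 1 := inv_mul_cancel₀ hκ0.ne'
      linear_combination -κ⁻¹ * hκ₀ + √2 * this
    have h3 : ‖((κ⁻¹ - √2 : ℝ) : ℂ)‖ ≤ 5 / 2 * (3 / 2) * ε := by
      rw [Complex.norm_real, Real.norm_eq_abs, e2, abs_mul, abs_of_pos (by positivity),
        abs_sub_comm]
      gcongr
    have h4 : ‖((κ⁻¹ : ℝ) : ℂ)‖ ≤ 5 / 2 := by
      rwa [Complex.norm_real, Real.norm_of_nonneg (by positivity)]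
    rw [e]
    refine (norm_add_le_of_le (norm_mul_le_of_le h4 (h x hx)) (norm_mul_le_of_le h3
      (norm_cos_freq_le n x))).trans ?_
    linarith

section Pairs

variable {q : ℝ → ℂ} (hq : IntervalIntegrable q volume 0 1)

/-- The two zeros of `limitPoly`: the limits of the displacements of the two eigenvalues near
`(2 π n) ^ 2`. -/
noncomputable def limitRoot (β₁ β₂ : ℂ) : Fin 2 → ℂ := ![0, 4 * β₂ / (β₁ - 1)]

/-- Near `(2 π n) ^ 2`, along any sequence of `n` with sine coefficients `o(1/n)`, there are two
simple eigenvalues, with normalized eigenfunctions both close to `√2 cos (2 π n x)`. -/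
theorem exists_eigenvalue_pairs (hq0 : ∫ t in (0 : ℝ)..1, q t = 0) {β₁ β₂ : ℂ} (hβ₁ : β₁ ≠ 1)
    (hβ₁' : β₁ ≠ -1) (hβ₂ : β₂ ≠ 0) {l : Filter ℕ} [l.NeBot] (hl : l ≤ atTop)
    (hs : sineCoeff q =o[l] fun n : ℕ => 1 / (n : ℝ)) :
    ∃ (r C : ℝ) (ρ : Fin 2 → ℕ → ℂ) (V : Fin 2 → ℕ → C01), 0 < r ∧
      (∀ j, Tendsto (ρ j) l (𝓝 (limitRoot β₁ β₂ j))) ∧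
      ∀ᶠ n in l, ρ 0 n ≠ ρ 1 n ∧ ∀ j,
        IsSimpleEigenvalue (slOperator q β₁ β₂) (freq n ^ 2 + ρ j n) ∧
        deriv (charDet hq β₁ β₂) (freq n ^ 2 + ρ j n) ≠ 0 ∧
        ((V j n).toL2, (freq n ^ 2 + ρ j n) • (V j n).toL2) ∈ (slOperator q β₁ β₂).graph ∧
        ‖(V j n).toL2‖ = 1 ∧
        rootSubspace (slOperator q β₁ β₂) (freq n ^ 2 + ρ j n) =
          Submodule.span ℂ {(V j n).toL2} ∧
        (∀ x ∈ Icc (0 : ℝ) 1,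
          ‖(V j n).extend x - ((√2 * Real.cos (2 * π * n * x) : ℝ) : ℂ)‖ ≤ C / n) ∧
        ∀ τ ∈ Metric.closedBall (limitRoot β₁ β₂ j) r, localDet hq β₁ β₂ n τ = 0 → τ = ρ j n := by
  have hb : β₁ - 1 ≠ 0 := sub_ne_zero.2 hβ₁
  have hroot : ∀ j, limitPoly β₁ β₂ (limitRoot β₁ β₂ j) = 0 ∧
      (1 - β₁) * limitRoot β₁ β₂ j / 4 + β₂ / 2 ≠ 0 := by
    intro j
    fin_cases j
    · simp [limitRoot, limitPoly, hβ₂]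
    · simp only [limitRoot, limitPoly, Fin.mk_one, Fin.isValue, Matrix.cons_val_one,
        Matrix.cons_val_fin_one]
      constructor
      · field_simp
        ring
      · have : (1 - β₁) * (4 * β₂ / (β₁ - 1)) / 4 + β₂ / 2 = -β₂ / 2 := by
          field_simp
          ring
        rw [this]
        simpa using hβ₂
  choose r ρ hr hρ hev using fun j => exists_localDet_zero hq hq0 hl hs (hroot j).1 (hroot j).2
  set R := ‖limitRoot β₁ β₂ 1‖ + 1
  obtain ⟨C, hC, hE⟩ := exists_eigenSol_near_cos hq hβ₁' β₂ R (by positivity)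
  have hR : ∀ j, ∀ᶠ n in l, ‖ρ j n‖ ≤ R := by
    intro j
    refine ((hρ j).norm.eventually (gt_mem_nhds ?_)).mono fun n hn => le_of_lt hn
    fin_cases j
    · simp only [limitRoot, Fin.zero_eta, Fin.isValue, Matrix.cons_val_zero, norm_zero, R]
      positivity
    · exact lt_add_one _
  have hne : ∀ᶠ n in l, ρ 0 n ≠ ρ 1 n := by
    have h1 := (hρ 0).sub (hρ 1)
    have h2 : limitRoot β₁ β₂ 0 - limitRoot β₁ β₂ 1 ≠ 0 := by simp [limitRoot, hβ₂, hb]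
    exact (h1.eventually_ne h2).mono fun n hn => sub_ne_zero.1 hn
  have key : ∀ᶠ n in l, ∀ j, ∃ v : C01,
        IsSimpleEigenvalue (slOperator q β₁ β₂) (freq n ^ 2 + ρ j n) ∧
        deriv (charDet hq β₁ β₂) (freq n ^ 2 + ρ j n) ≠ 0 ∧
        (v.toL2, (freq n ^ 2 + ρ j n) • v.toL2) ∈ (slOperator q β₁ β₂).graph ∧
        ‖v.toL2‖ = 1 ∧
        rootSubspace (slOperator q β₁ β₂) (freq n ^ 2 + ρ j n) = Submodule.span ℂ {v.toL2} ∧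
        (∀ x ∈ Icc (0 : ℝ) 1,
          ‖v.extend x - ((√2 * Real.cos (2 * π * n * x) : ℝ) : ℂ)‖ ≤ 7 * C / n) := by
    have hCn : ∀ᶠ n : ℕ in atTop, C / n < 1 / 4 :=
      (tendsto_const_div_atTop_nhds_zero_nat C).eventually (gt_mem_nhds (by norm_num))
    filter_upwards [hl hE, hl hCn, hl (eventually_ge_atTop 1), eventually_all.2 hR,
      eventually_all.2 hev] with n hE hCn hn hR hev j
    obtain ⟨h1, h2, -⟩ := hev j
    obtain ⟨hS, hcos⟩ := hE _ (hR j)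
    have hf : freq n ^ 2 ≠ 0 := pow_ne_zero _ (freq_ne_zero hn)
    have hdet : charDet hq β₁ β₂ (freq n ^ 2 + ρ j n) = 0 := (mul_eq_zero.1 h1).resolve_left hf
    rw [deriv_localDet] at h2
    have hd := right_ne_zero_of_mul h2
    obtain ⟨c, hc, hc1, hc2⟩ := exists_normalized_near hn hCn.le hcos
    refine ⟨c • eigenSol hq β₁ β₂ (freq n ^ 2 + ρ j n), isSimpleEigenvalue_of_charDet hq hdet hS hd,
      hd, ?_, hc1, ?_, fun x hx => (hc2 x hx).trans_eq (by ring)⟩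
    · rw [slOperator_graph, C01.toL2_smul, smul_comm]
      exact Submodule.smul_mem _ c (mem_slGraph_eigenSol hq hdet hS)
    · rw [rootSubspace_eq_span hq hdet hS hd, C01.toL2_smul,
        Submodule.span_singleton_smul_eq (IsUnit.mk0 c hc)]
  choose V hV using fun j => (eventually_all.1 key j).choice
  refine ⟨min (r 0) (r 1), 7 * C, ρ, V, lt_min (hr 0) (hr 1), hρ, ?_⟩
  filter_upwards [hne, eventually_all.2 hV, eventually_all.2 hev] with n hne hV hev
  refine ⟨hne, fun j => ?_⟩
  obtain ⟨h1, h2, h3, h4, h5, h6⟩ := hV j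
  refine ⟨h1, h2, h3, h4, h5, h6,
    fun τ hτ => (hev j).2.2 τ (Metric.closedBall_subset_closedBall ?_ hτ)⟩
  fin_cases j
  exacts [min_le_left _ _, min_le_right _ _]

end Pairs

/-! ### Riesz bases -/

/-- Distinct normalized directions of a Riesz basis are uniformly separated. -/
theorem IsRieszBasis.exists_le_norm_sub {H : Type*} [NormedAddCommGroup H] [InnerProductSpace ℂ H]
    {ι : Type*} {e : ι → H} (h : IsRieszBasis e) :
    ∃ d : ℝ, 0 < d ∧ ∀ i j, i ≠ j → ∀ a b : ℂ, ‖a • e i‖ = 1 → d ≤ ‖a • e i - b • e j‖ := by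
  obtain ⟨v, A, he⟩ := h
  set K := ‖(A : H →L[ℂ] H)‖
  set L := ‖(A.symm : H →L[ℂ] H)‖
  have hK : 0 ≤ K := norm_nonneg _
  have hL : 0 ≤ L := norm_nonneg _
  refine ⟨1 / ((K + 1) * (L + 1)), by positivity, fun i j hij a b h1 => ?_⟩
  have hv : ∀ i, ‖v i‖ = 1 := v.orthonormal.1
  have ha : 1 ≤ (K + 1) * ‖a‖ := by
    rw [norm_smul, he] at h1
    have h2 := (A : H →L[ℂ] H).le_opNorm (v i)
    rw [hv, mul_one] at h2
    change ‖A (v i)‖ ≤ K at h2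
    nlinarith [norm_nonneg a]
  have h3 : ‖a‖ ≤ ‖a • v i - b • v j‖ := by
    have h4 := norm_inner_le_norm (𝕜 := ℂ) (v i) (a • v i - b • v j)
    rw [inner_sub_right, inner_smul_right, inner_smul_right, v.orthonormal.2 hij,
      inner_self_eq_norm_sq_to_K, hv] at h4
    simpa using h4
  have h5 : ‖a • v i - b • v j‖ ≤ L * ‖a • e i - b • e j‖ := by
    have h6 := (A.symm : H →L[ℂ] H).le_opNorm (a • e i - b • e j)
    rw [he, he] at h6 ⊢
    simpa using h6
  rw [div_le_iff₀ (by positivity)]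
  nlinarith [norm_nonneg (a • e i - b • e j), norm_nonneg a]

/-- A one-dimensional root subspace contains exactly one direction of a root system. -/
theorem exists_eq_smul_of_rootSubspace_eq_span {H : Type*} [NormedAddCommGroup H]
    [InnerProductSpace ℂ H] {T : H →ₗ.[ℂ] H} {ι : Type*} {e : ι → H} {ev : ι → ℂ} {w : ℂ}
    (hli : LinearIndependent ℂ (fun i : {i : ι // ev i = w} => e i))
    (hspan : Submodule.span ℂ (e '' {i | ev i = w}) = rootSubspace T w) {v : H} (hv : v ≠ 0)
    (hroot : rootSubspace T w = Submodule.span ℂ {v}) : ∃ i, ev i = w ∧ ∃ c : ℂ, v = c • e i := by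
  have hne : {i | ev i = w}.Nonempty := by
    by_contra hem
    rw [not_nonempty_iff_eq_empty] at hem
    rw [hem, image_empty, Submodule.span_empty, hroot] at hspan
    exact hv (Submodule.span_singleton_eq_bot.1 hspan.symm)
  obtain ⟨i, hi⟩ := hne
  have hmem : e i ∈ Submodule.span ℂ {v} := by
    rw [← hroot, ← hspan]
    exact Submodule.subset_span ⟨i, hi, rfl⟩
  obtain ⟨c, hc⟩ := Submodule.mem_span_singleton.1 hmem
  have hc0 : c ≠ 0 := by
    rintro rfl
    exact hli.ne_zero ⟨i, hi⟩ (by simpa using hc.symm)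
  exact ⟨i, hi, c⁻¹, by rw [← hc, smul_smul, inv_mul_cancel₀ hc0, one_smul]⟩

/-- The root system contains multiples of the two normalized eigenfunctions near `(2 π n) ^ 2`,
whose distance is `O(1/n)`; this contradicts the uniform separation in a Riesz basis. -/
theorem not_isRieszBasis_of_isRootSystem {q : ℝ → ℂ} (hq : IntervalIntegrable q volume 0 1)
    (hq0 : ∫ t in (0 : ℝ)..1, q t = 0) {β₁ β₂ : ℂ} (hβ₁ : β₁ ≠ 1)
    (hβ₁' : β₁ ≠ -1) (hβ₂ : β₂ ≠ 0) {l : Filter ℕ} [l.NeBot] (hl : l ≤ atTop)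
    (hs : sineCoeff q =o[l] fun n : ℕ => 1 / (n : ℝ)) {ι : Type*} {e : ι → L2}
    (he : IsRootSystem (slOperator q β₁ β₂) e) : ¬ IsRieszBasis e := by
  intro hR
  obtain ⟨d, hd, hsep⟩ := hR.exists_le_norm_sub
  obtain ⟨ev, hev⟩ := he
  obtain ⟨r, C, ρ, V, -, -, H⟩ := exists_eigenvalue_pairs hq hq0 hβ₁ hβ₁' hβ₂ hl hs
  have hC : ∀ᶠ n : ℕ in l, 2 * C / n < d :=
    hl ((tendsto_const_div_atTop_nhds_zero_nat (2 * C)).eventually (gt_mem_nhds hd))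
  obtain ⟨n, ⟨hne, hn⟩, hCn⟩ := (H.and hC).exists
  have hi : ∀ j, ∃ i, ev i = freq n ^ 2 + ρ j n ∧ ∃ c : ℂ, (V j n).toL2 = c • e i := fun j => by
    obtain ⟨-, -, -, h1, h2, -⟩ := hn j
    exact exists_eq_smul_of_rootSubspace_eq_span (hev _).1 (hev _).2
      (norm_ne_zero_iff.1 (by rw [h1]; exact one_ne_zero)) h2
  obtain ⟨i, hi0, a, ha⟩ := hi 0
  obtain ⟨j, hj0, b, hb⟩ := hi 1
  have hij : i ≠ j := by
    rintro rfl
    exact hne (add_left_cancel (hi0.symm.trans hj0))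
  have h1 := hsep i j hij a b (by rw [← ha]; exact (hn 0).2.2.2.1)
  rw [← ha, ← hb, ← C01.toL2_sub] at h1
  have hx : ∀ x ∈ Icc (0 : ℝ) 1, ‖(V 0 n - V 1 n).extend x‖ ≤ 2 * C / n := fun x hx => by
    have := norm_sub_le_of_le ((hn 0).2.2.2.2.2.1 x hx) ((hn 1).2.2.2.2.2.1 x hx)
    rw [sub_sub_sub_cancel_right] at this
    exact this.trans_eq (by ring)
  have h2 := C01.norm_toL2_le ((norm_nonneg _).trans (hx 0 (by simp))) hx
  linarith

/-! ### The list of all large eigenvalues -/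

theorem finite_zeros_inter_closedBall {f : ℂ → ℂ} (hf : Differentiable ℂ f) {z₀ : ℂ}
    (h₀ : deriv f z₀ ≠ 0) (R : ℝ) : ({z | f z = 0} ∩ Metric.closedBall 0 R).Finite := by
  by_contra hinf
  obtain ⟨z, -, hz⟩ := Set.Infinite.exists_accPt_of_subset_isCompact hinf
    (isCompact_closedBall (0 : ℂ) R) inter_subset_right
  have hfreq : ∃ᶠ w in 𝓝[≠] z, f w = 0 :=
    (accPt_iff_frequently_nhdsNE.1 hz).mono fun w hw => hw.1
  have h := AnalyticOnNhd.eqOn_zero_of_preconnected_of_frequently_eq_zero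
    (fun w _ => hf.analyticAt w) isPreconnected_univ (mem_univ z) hfreq
  have e : f = fun _ => 0 := funext fun w => h (mem_univ w)
  exact h₀ (by rw [e, deriv_const])

/-- The square roots of a bounded perturbation of `freq n ^ 2`, to first order. -/
theorem tendsto_mul_sqrt_sub_freq {ρ m : ℕ → ℂ} {T : ℂ} (hρ : Tendsto ρ atTop (𝓝 T))
    (hm : ∀ n, m n ^ 2 = freq n ^ 2 + ρ n) (hre : ∀ n, 0 ≤ (m n).re) :
    Tendsto (fun n : ℕ => (n : ℂ) * (m n - freq n)) atTop (𝓝 (T / (4 * π))) := by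
  have hπ := Real.pi_pos
  have hD : ∀ n : ℕ, 2 * π * n ≤ ‖m n + freq n‖ := fun n => by
    refine le_trans ?_ (Complex.re_le_norm _)
    rw [Complex.add_re, freq, Complex.ofReal_re]
    linarith [hre n]
  have hmul : ∀ n, (m n - freq n) * (m n + freq n) = ρ n := fun n => by
    linear_combination hm n
  have hinv : Tendsto (fun n : ℕ => 1 / (n : ℝ)) atTop (𝓝 0) := tendsto_one_div_atTop_nhds_zero_nat
  have h0 : Tendsto (fun n : ℕ => (m n - freq n) / n) atTop (𝓝 0) := by
    refine squeeze_zero_norm' (a := fun n : ℕ => ‖ρ n‖ * (1 / (n : ℝ))) ?_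
      (by simpa using hρ.norm.mul hinv)
    filter_upwards [eventually_ge_atTop 1] with n hn
    have hn' : (1 : ℝ) ≤ n := by exact_mod_cast hn
    rw [norm_div, Complex.norm_natCast, mul_one_div, ← hmul n, norm_mul]
    gcongr
    refine le_mul_of_one_le_right (norm_nonneg _) (le_trans ?_ (hD n))
    nlinarith [Real.pi_gt_three]
  have h1 : Tendsto (fun n : ℕ => (m n - freq n) / n + 4 * π) atTop (𝓝 (4 * π)) := by
    simpa using h0.add_const (4 * π : ℂ)
  refine (hρ.div h1 (by simp [hπ.ne'])).congr' ?_
  filter_upwards [eventually_ge_atTop 1] with n hn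
  have hn0 : (n : ℂ) ≠ 0 := by exact_mod_cast (by omega : n ≠ 0)
  have hn' : (1 : ℝ) ≤ n := by exact_mod_cast hn
  have hD0 : m n + freq n ≠ 0 := norm_pos_iff.1 (lt_of_lt_of_le (by positivity) (hD n))
  have e : (m n - freq n) / n + 4 * π = (m n + freq n) / n := by
    rw [freq]
    push_cast
    field_simp
    ring
  rw [Pi.div_apply, e, ← hmul n]
  field_simp

theorem limitPoly_eq_mul {β₁ : ℂ} (hβ₁ : β₁ ≠ 1) (β₂ τ : ℂ) : limitPoly β₁ β₂ τ =
    (1 - β₁) / 8 * (τ - limitRoot β₁ β₂ 0) * (τ - limitRoot β₁ β₂ 1) := by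
  have hb : β₁ - 1 ≠ 0 := sub_ne_zero.2 hβ₁
  simp only [limitPoly, limitRoot, Fin.isValue, Matrix.cons_val_zero, Matrix.cons_val_one,
    Matrix.cons_val_fin_one]
  field_simp
  ring

/-- Distinct squared frequencies are too far apart for bounded displacements to make them meet. -/
theorem eq_of_freq_sq_add_eq {n n' : ℕ} {a b : ℂ} {R : ℝ} (ha : ‖a‖ ≤ R) (hb : ‖b‖ ≤ R)
    (hn : R < n) (hn' : R < n') (h : freq n ^ 2 + a = freq n' ^ 2 + b) : n = n' := by
  by_contra hne
  have h1 : ‖freq n ^ 2 - freq n' ^ 2‖ ≤ R + R := by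
    rw [show freq n ^ 2 - freq n' ^ 2 = b - a by linear_combination h]
    exact norm_sub_le_of_le hb ha
  have h2 : (1 : ℝ) ≤ |(n : ℝ) - n'| := by
    have : (1 : ℤ) ≤ |(n : ℤ) - n'| := Int.one_le_abs (sub_ne_zero.2 (by exact_mod_cast hne))
    exact_mod_cast this
  have h3 : ‖freq n ^ 2 - freq n' ^ 2‖ = (2 * π) ^ 2 * ((n : ℝ) + n') * |(n : ℝ) - n'| := by
    rw [freq, freq, ← Complex.ofReal_pow, ← Complex.ofReal_pow, ← Complex.ofReal_sub,
      Complex.norm_real, Real.norm_eq_abs,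
      show (2 * π * n) ^ 2 - (2 * π * n') ^ 2 = (2 * π) ^ 2 * ((n : ℝ) + n') * ((n : ℝ) - n') by
        ring,
      abs_mul, abs_of_nonneg (by positivity)]
  have h4 : 1 * ((n : ℝ) + n') * 1 ≤ (2 * π) ^ 2 * ((n : ℝ) + n') * |(n : ℝ) - n'| := by
    gcongr
    nlinarith [Real.pi_gt_three]
  linarith

/-- Every zero of the determinant of large modulus lies in one of the two shrinking families of
discs around the predicted positions. -/
theorem exists_eq_of_charDet_eq_zero {q : ℝ → ℂ} (hq : IntervalIntegrable q volume 0 1)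
    (hq0 : ∫ t in (0 : ℝ)..1, q t = 0) {β₁ β₂ : ℂ} (hβ₁ : β₁ ≠ 1)
    (hs : sineCoeff q =o[atTop] fun n : ℕ => 1 / (n : ℝ)) {r : ℝ} (hr : 0 < r)
    {ρ : Fin 2 → ℕ → ℂ} {N : ℕ}
    (hρ : ∀ n ≥ N, ∀ j, ∀ τ ∈ Metric.closedBall (limitRoot β₁ β₂ j) r,
      localDet hq β₁ β₂ n τ = 0 → τ = ρ j n) :
    ∃ R : ℝ, ∀ ev : ℂ, charDet hq β₁ β₂ ev = 0 → R ≤ ‖ev‖ →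
      ∃ j, ∃ n ≥ N, ev = freq n ^ 2 + ρ j n := by
  obtain ⟨η, R, hη, hloc⟩ := exists_bound_of_localDet_eq_zero hq hq0 hβ₁ β₂ hs
  have hb : 0 < ‖(1 - β₁) / 8‖ := by
    rw [norm_pos_iff]
    exact div_ne_zero (sub_ne_zero.2 hβ₁.symm) (by norm_num)
  set ε := ‖(1 - β₁) / 8‖ * r * r / 2
  have hε : 0 < ε := by positivity
  obtain ⟨N', hN'⟩ := eventually_atTop.1
    (hloc.and (eventually_norm_localDet_sub_le hq hq0 β₁ β₂ le_rfl hs R hε))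
  obtain ⟨R', hR'⟩ := exists_freq_near_of_charDet_eq_zero hq hβ₁ β₂ hη (max N N')
  refine ⟨R', fun ev hev hle => ?_⟩
  obtain ⟨n, hn, hnear⟩ := hR' ev hev hle
  obtain ⟨h1, h2⟩ := hN' n ((le_max_right _ _).trans hn)
  have hdet : localDet hq β₁ β₂ n (ev - freq n ^ 2) = 0 := by
    rw [localDet, add_sub_cancel, hev, mul_zero]
  have h3 := h2 _ (h1 _ hnear hdet)
  have hj : ∃ j, ‖ev - freq n ^ 2 - limitRoot β₁ β₂ j‖ ≤ r := by
    by_contra! hfar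
    rw [hdet, zero_sub, norm_neg, limitPoly_eq_mul hβ₁, norm_mul, norm_mul] at h3
    have : ‖(1 - β₁) / 8‖ * r * r ≤ ε := le_trans (by
      gcongr
      exacts [(hfar 0).le, (hfar 1).le]) h3
    linarith [show ‖(1 - β₁) / 8‖ * r * r = 2 * ε by ring]
  obtain ⟨j, hj⟩ := hj
  refine ⟨j, n, (le_max_left _ _).trans hn, ?_⟩
  rw [← hρ n ((le_max_left _ _).trans hn) j _ (mem_closedBall_iff_norm.2 hj) hdet, add_sub_cancel]

/-! ### Asymptotics of the eigenvalues and the basis property -/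

theorem theorem1 (q : ℝ → ℂ) (hq : IntervalIntegrable q volume 0 1)
    (hq0 : ∫ t in (0 : ℝ)..1, q t = 0) (β₁ β₂ : ℂ)
    (hβ₁ : β₁ ≠ 1) (hβ₁' : β₁ ≠ -1) (hβ₂ : β₂ ≠ 0) :
    -- part (a)
    ((sineCoeff q =o[atTop] fun n : ℕ => 1 / (n : ℝ)) →
      ∃ (N : ℕ) (μ : Fin 2 → ℕ → ℂ) (φ : Fin 2 → ℕ → ℝ → ℂ),
        -- all eigenvalues except finitely many are listed, once each, by the two sequences,
        -- and the listed ones are simple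
        {ev : ℂ | IsEigenvalue (slOperator q β₁ β₂) ev ∧
          ∀ j, ∀ n ≥ N, ev ≠ μ j n ^ 2}.Finite ∧
        (∀ j, ∀ n ≥ N, IsSimpleEigenvalue (slOperator q β₁ β₂) (μ j n ^ 2) ∧ 0 ≤ (μ j n).re) ∧
        InjOn (fun p : Fin 2 × ℕ => μ p.1 p.2 ^ 2) {p | N ≤ p.2} ∧
        -- asymptotics of the square roots
        ((fun n : ℕ => μ 0 n - 2 * π * n) =o[atTop] fun n : ℕ => 1 / (n : ℝ)) ∧
        ((fun n : ℕ => μ 1 n - (2 * π * n + β₂ / (β₁ - 1) * (1 / (π * n))))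
          =o[atTop] fun n : ℕ => 1 / (n : ℝ)) ∧
        -- asymptotics of the normalized eigenfunctions, uniformly on `[0,1]`
        (∀ j, ∀ n ≥ N, IsNormalizedEigenfunction (slOperator q β₁ β₂) (μ j n ^ 2) (φ j n)) ∧
        ∃ C : ℝ, ∀ j, ∀ n ≥ N, ∀ x ∈ Icc (0 : ℝ) 1,
          ‖φ j n x - ((√2 * Real.cos (2 * π * n * x) : ℝ) : ℂ)‖ ≤ C / n) ∧
    -- part (b)
    (∀ nk : ℕ → ℕ, StrictMono nk →
      ((fun k : ℕ => sineCoeff q (nk k)) =o[atTop] fun k : ℕ => 1 / (nk k : ℝ)) →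
      ∀ (ι : Type) (e : ι → L2), IsRootSystem (slOperator q β₁ β₂) e → ¬ IsRieszBasis e) := by
  refine ⟨fun hs => ?_, fun nk hnk hs ι e he => ?_⟩
  · obtain ⟨r, C, ρ, V, hr, hρ, H⟩ := exists_eigenvalue_pairs hq hq0 hβ₁ hβ₁' hβ₂ le_rfl hs
    have hsq : ∀ j n, ∃ m : ℂ, m ^ 2 = freq n ^ 2 + ρ j n ∧ 0 ≤ m.re :=
      fun j n => sqrt_mul_self_re _
    choose μ hμ hre using hsq
    -- the displacements stay bounded, hence discs around different `freq n ^ 2` do not interfere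
    set R := max (‖limitRoot β₁ β₂ 0‖ + 1) (‖limitRoot β₁ β₂ 1‖ + 1)
    have hR : ∀ j, ∀ᶠ n in atTop, ‖ρ j n‖ ≤ R := by
      intro j
      refine ((hρ j).norm.eventually (gt_mem_nhds ?_)).mono fun n hn => le_of_lt hn
      fin_cases j
      exacts [(lt_add_one _).trans_le (le_max_left _ _), (lt_add_one _).trans_le (le_max_right _ _)]
    have hRn : ∀ᶠ n : ℕ in atTop, R < n :=
      tendsto_natCast_atTop_atTop.eventually (eventually_gt_atTop R)
    obtain ⟨N, hN⟩ := eventually_atTop.1 (H.and ((eventually_all.2 hR).and hRn))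
    have hlim := fun j => tendsto_mul_sqrt_sub_freq (hρ j) (hμ j) (hre j)
    obtain ⟨R', hR'⟩ := exists_eq_of_charDet_eq_zero hq hq0 hβ₁ hs hr (ρ := ρ) (N := N)
      fun n hn j => ((hN n hn).1.2 j).2.2.2.2.2.2
    refine ⟨N, μ, fun j n => (V j n).extend, ?_, fun j n hn => ⟨?_, hre j n⟩, ?_, ?_, ?_,
      fun j n hn => ⟨(V j n).continuous_extend.continuousOn, ?_⟩, C, fun j n hn =>
      ((hN n hn).1.2 j).2.2.2.2.2.1⟩
    -- the unlisted eigenvalues are zeros of an entire function in a bounded set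
    · refine (finite_zeros_inter_closedBall (differentiable_charDet hq β₁ β₂)
        ((hN N le_rfl).1.2 0).2.1 R').subset fun ev hev => ?_
      have hdet := charDet_eq_zero_of_isEigenvalue hq hev.1
      refine ⟨hdet, mem_closedBall_zero_iff.2 (le_of_not_gt fun hlt => ?_)⟩
      obtain ⟨j, n, hn, e⟩ := hR' ev hdet hlt.le
      exact hev.2 j n hn (by rw [hμ, e])
    · rw [hμ]
      exact ((hN n hn).1.2 j).1
    · rintro ⟨i, n⟩ hn ⟨j, n'⟩ hn' h
      simp only [hμ] at h
      obtain ⟨⟨hne, -⟩, h1, h2⟩ := hN n hn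
      obtain ⟨-, h1', h2'⟩ := hN n' hn'
      obtain rfl := eq_of_freq_sq_add_eq (h1 i) (h1' j) h2 h2' h
      have h := add_left_cancel h
      fin_cases i <;> fin_cases j
      exacts [rfl, absurd h hne, absurd h.symm hne, rfl]
    · rw [isLittleO_one_div_iff le_rfl]
      refine ((hlim 0).congr fun n => ?_).trans_eq ?_
      · rw [freq]; push_cast; rfl
      · simp [limitRoot]
    · rw [isLittleO_one_div_iff le_rfl]
      have h := (hlim 1).sub_const (limitRoot β₁ β₂ 1 / (4 * π))
      rw [sub_self] at h
      refine h.congr' ?_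
      filter_upwards [eventually_ge_atTop 1] with n hn
      have hn0 : (n : ℂ) ≠ 0 := by exact_mod_cast (by omega : n ≠ 0)
      have hπ : (π : ℂ) ≠ 0 := by exact_mod_cast Real.pi_ne_zero
      have hb : β₁ - 1 ≠ 0 := sub_ne_zero.2 hβ₁
      simp only [limitRoot, freq, Fin.isValue, Matrix.cons_val_one, Matrix.cons_val_fin_one]
      push_cast
      field_simp
      ring
    · obtain ⟨-, -, h1, h2, -⟩ := (hN n hn).1.2 j
      obtain ⟨u, hu, hTu⟩ := (LinearPMap.mem_graph_iff _).1 h1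
      refine ⟨u, ?_, by rw [hu]; exact h2, ?_⟩
      · rw [hu]
        exact C01.coeFn_toL2 _
      · rw [hTu, hu, hμ]
  · have hl : map nk atTop ≤ atTop := hnk.tendsto_atTop
    exact not_isRieszBasis_of_isRootSystem hq hq0 hβ₁ hβ₁' hβ₂ hl (isLittleO_map.2 hs) he
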